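/- Let $\ell>0$ and let $q\in W^{-1,2}(0,\ell)$ be a complex distribution, written $q=\sigma'$ with $\sigma\in L^2(0,\ell)$, so that $(q|\psi)=-\int_0^\ell\sigma\psi'$ for $\psi\in W^{1,2}_0(0,\ell)$. For $y\in W^{1,2}(0,\ell)$ let $\mathbf S_qy=-y''+qy$ be the distribution $(\mathbf S_qy|\phi)=\int_0^\ell y'\phi'+(q|y\phi)$, $\phi\in W^{1,2}_0(0,\ell)$. Assume that $q$ is admissible: there is $f\in W^{1,2}(0,\ell)$ with $\mathbf S_qf=0$, $f(x)\ne0$ for all $x\in[0,\ell]$, and $f(0)=1$. Put $\mathbf D_fy=y'-\frac{f'}{f}y$. For $\rho\in\mathbb C$ let $C_f(\rho,\cdot)$ and $S_f(\rho,\cdot)$ be the solutions in $W^{1,2}(0,\ell)$ of $\mathbf S_qy=\rho^2y$ with $C_f(\rho,0)=1$, $\mathbf D_fC_f(\rho,0)=0$, and $S_f(\rho,0)=0$, $\mathbf D_fS_f(\rho,0)=1$ (for such solutions $\mathbf D_fy\in W^{1,2}(0,\ell)$, so that the value at $0$ makes sense). Let $K_f$ be the transmutation kernel, i.e. the function in $L^2(\{0\le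 x\le\ell,\ |t|\le x\})$, with $K_f(x,\cdot)\in L^2(-x,x)$ for every $x\in(0,\ell]$, such that for every $\rho\in\mathbb C$ $$e_f(\rho,x)=e^{i\rho x}+\int_{-x}^xK_f(x,t)e^{i\rho t}\,dt$$ is the solution of $\mathbf S_qy=\rho^2y$ with $y(0)=1$, $\mathbf D_fy(0)=i\rho$. Let $P_m$ be the Legendre polynomials, $a_m(x)=(m+\tfrac12)\int_{-x}^xK_f(x,t)P_m(t/x)\,dt$, $\alpha_m=2a_m$, $K_{f,N}(x,t)=\sum_{m=0}^N\frac{a_m(x)}xP_m(t/x)$ and $\epsilon_N(x)=\|K_f(x,\cdot)-K_{f,N}(x,\cdot)\|_{L^2(-x,x)}$, and let $j_m(\zeta)=\sqrt{\frac{\pi}{2\zeta}}\,J_{m+\frac12}(\zeta)$ be the spherical Bessel functions (entire functions of $\zeta$). **Theorem.** The solutions $C_f(\rho,\cdot)$, $S_f(\rho,\cdot)$ and the kernel $K_f$ exist. For every $x\in(0,\ell]$, $\epsilon_N(x)\to0$ as $N\to\infty$ (so $K_f(x,t)=\sum_{m\ge0}\frac{a_m(x)}xP_m(t/x)$ in $L^2(-x,x)$),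 and $$C_f(\rho,x)=\cos(\rho x)+\sum_{m=0}^\infty(-1)^m\alpha_{2m}(x)j_{2m}(\rho x)\qquad(\rho\in\mathbb C),$$ $$S_f(\rho,x)=\frac{\sin(\rho x)}\rho+\frac1\rho\sum_{m=0}^\infty(-1)^m\alpha_{2m+1}(x)j_{2m+1}(\rho x)\qquad(\rho\in\mathbb C\setminus\{0\}),$$ where the series converge, and, in the limit $\rho\to0$ of the right-hand side, $S_f(0,x)=x+\frac x3\alpha_1(x)$. For $N\in\mathbb N$, $N\ge1$, the partial sums $$C_{f,N}(\rho,x)=\cos(\rho x)+\sum_{m=0}^{[N/2]}(-1)^m\alpha_{2m}(x)j_{2m}(\rho x),\qquad S_{f,N}(\rho,x)=\frac{\sin(\rho x)}\rho+\frac1\rho\sum_{m=0}^{[(N-1)/2]}(-1)^m\alpha_{2m+1}(x)j_{2m+1}(\rho x)$$ satisfy, for every $C>0$ and every $\rho\in\mathbb C$ with $|\operatorname{Im}\rho|\le C$, $$|C_f(\rho,x)-C_{f,N}(\rho,x)|\le\epsilon_N(x)\sqrt{\frac{\sinh(2Cx)}C},\qquad|\rho S_f(\rho,x)-\rho S_{f,N}(\rho,x)|\le\epsilon_N(x)\sqrt{\frac{\sinh(2Cx)}C},$$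 (at $\rho=0$ the product $\rho S_{f,N}(\rho,x)$ is read as $0$); moreover, if $|K_f(x,t)-K_{f,N}(x,t)|\le M$ for almost every $t\in(-x,x)$, then both left-hand sides are at most $M\,\frac{2\sinh(Cx)}C$. Consequently, for each $x\in(0,\ell]$ and each $C>0$, as $N\to\infty$, $C_{f,N}(\rho,x)\to C_f(\rho,x)$ uniformly in $|\operatorname{Im}\rho|\le C$ and $S_{f,N}(\rho,x)\to S_f(\rho,x)$ uniformly in $|\operatorname{Im}\rho|\le C$, $\rho\ne0$. -/

import Mathlib

namespace NSBF

noncomputable section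

open MeasureTheory

/-! ### Sobolev functions on an interval and the distributional Schroedinger operator -/

/-- `u` (restricted to `[0, ℓ]`) belongs to `W^{1,2}(0,ℓ)`: it is the absolutely continuous
representative of its class, and its derivative is square integrable. -/
def MemW12 (ℓ : ℝ) (u : ℝ → ℂ) : Prop :=
  AbsolutelyContinuousOnInterval u 0 ℓ ∧ MemLp (deriv u) 2 (volume.restrict (Set.Ioo 0 ℓ))

/-- `φ ∈ W₀^{1,2}(0,ℓ)`. -/
def MemW12Zero (ℓ : ℝ) (φ : ℝ → ℂ) : Prop :=
  MemW12 ℓ φ ∧ φ 0 = 0 ∧ φ ℓ = 0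

/-- The action `(q | ψ) = - ∫ σ ψ'` of the distribution `q = σ' ∈ W^{-1,2}(0,ℓ)`,
`σ ∈ L²(0,ℓ)`, on `ψ ∈ W₀^{1,2}(0,ℓ)`. -/
def potentialPairing (ℓ : ℝ) (σ ψ : ℝ → ℂ) : ℂ :=
  -∫ x in (0 : ℝ)..ℓ, σ x * deriv ψ x

/-- The action `(S_q y | φ) = ∫ y' φ' + (q | y φ)` of the distribution `S_q y = -y'' + q y`,
where `q = σ'`. -/
def schrodingerPairing (ℓ : ℝ) (σ y φ : ℝ → ℂ) : ℂ :=
  (∫ x in (0 : ℝ)..ℓ, deriv y x * deriv φ x) + potentialPairing ℓ σ (fun x => y x * φ x)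

/-- `y ∈ W^{1,2}(0,ℓ)` and `S_q y = lam y` as distributions, where `q = σ'`. -/
def IsWeakSolution (ℓ : ℝ) (σ : ℝ → ℂ) (lam : ℂ) (y : ℝ → ℂ) : Prop :=
  MemW12 ℓ y ∧ ∀ φ : ℝ → ℂ, MemW12Zero ℓ φ →
    schrodingerPairing ℓ σ y φ = lam * ∫ x in (0 : ℝ)..ℓ, y x * φ x

/-- `f` is a nonvanishing solution of `S_q f = 0` on `[0,ℓ]`, normalized by `f(0) = 1`. -/
structure IsNonvanishingSolution (ℓ : ℝ) (σ f : ℝ → ℂ) : Prop where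
  isSolution : IsWeakSolution ℓ σ 0 f
  ne_zero : ∀ x ∈ Set.Icc 0 ℓ, f x ≠ 0
  normalized : f 0 = 1

/-- The operator `D_f y = y' - (f'/f) y`. -/
def darbouxD (f y : ℝ → ℂ) (x : ℝ) : ℂ :=
  deriv y x - deriv f x / f x * y x

/-- `y` solves the Cauchy problem `S_q y = lam y`, `y(0) = c₀`, `(D_f y)(0) = c₁`. The value of
`D_f y` at `0` is that of the continuous representative of `D_f y ∈ W^{1,2}(0,ℓ)`. -/
structure IsCauchySolution (ℓ : ℝ) (σ f : ℝ → ℂ) (lam c₀ c₁ : ℂ) (y : ℝ → ℂ) : Prop where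
  isSolution : IsWeakSolution ℓ σ lam y
  init_value : y 0 = c₀
  init_deriv : ∃ v : ℝ → ℂ, MemW12 ℓ v ∧
    (∀ᵐ x ∂(volume.restrict (Set.Ioo 0 ℓ)), v x = darbouxD f y x) ∧ v 0 = c₁

/-! ### The transmutation kernel -/

/-- The triangle `0 ≤ x ≤ ℓ`, `|t| ≤ x`. -/
def triangle (ℓ : ℝ) : Set (ℝ × ℝ) :=
  {p | 0 ≤ p.1 ∧ p.1 ≤ ℓ ∧ |p.2| ≤ p.1}

/-- `K` is the transmutation kernel `K_f`: it is in `L²` of the triangle, each slice `K(x,·)`,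
`0 < x ≤ ℓ`, is in `L²(-x,x)`, and for every `ρ` the function
`e_f(ρ,x) = e^{iρx} + ∫_{-x}^x K(x,t) e^{iρt} dt` is the solution of `S_q y = ρ² y` with
`y(0) = 1`, `(D_f y)(0) = iρ`. -/
structure IsTransmutationKernel (ℓ : ℝ) (σ f : ℝ → ℂ) (K : ℝ → ℝ → ℂ) : Prop where
  memLp : MemLp (Function.uncurry K) 2 (volume.restrict (triangle ℓ))
  memLp_slice : ∀ x ∈ Set.Ioc 0 ℓ, MemLp (K x) 2 (volume.restrict (Set.Ioo (-x) x))
  represents : ∀ ρ : ℂ, IsCauchySolution ℓ σ f (ρ ^ 2) 1 (Complex.I * ρ)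
    (fun x => Complex.exp (Complex.I * ρ * x) +
      ∫ t in (-x)..x, K x t * Complex.exp (Complex.I * ρ * t))

/-! ### Legendre polynomials and spherical Bessel functions -/

/-- The Legendre polynomial `P_m` (Rodrigues' formula). -/
def legendreP (m : ℕ) : Polynomial ℝ :=
  Polynomial.C ((2 ^ m * (m.factorial : ℝ))⁻¹) *
    (Polynomial.derivative^[m]) ((Polynomial.X ^ 2 - 1) ^ m)

/-- The Bessel function `J_ν(z)` of the first kind (principal branch). -/
def besselJ (ν z : ℂ) : ℂ :=
  ∑' k : ℕ, (-1) ^ k / ((k.factorial : ℂ) * Complex.Gamma (k + ν + 1)) *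
    (z / 2) ^ (2 * (k : ℂ) + ν)

/-- The spherical Bessel function `j_m`, as an entire function: the power series obtained from
`√(π/(2z)) J_{m+1/2}(z)` by cancelling the half-integer powers of `z`. -/
def sphericalBesselJ (m : ℕ) (z : ℂ) : ℂ :=
  (Real.sqrt Real.pi / 2 : ℝ) * ∑' k : ℕ,
    (-1) ^ k / ((k.factorial : ℂ) * Complex.Gamma (k + m + 3 / 2)) * (z / 2) ^ (2 * k + m)

/-- Off the branch cut, `j_m(z) = √(π/(2z)) J_{m+1/2}(z)`. -/
theorem sphericalBesselJ_eq (m : ℕ) (z : ℂ) (hz : z ∈ Complex.slitPlane) :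
    sphericalBesselJ m z =
      ((Real.pi : ℂ) / (2 * z)) ^ (1 / 2 : ℂ) * besselJ (m + 1 / 2) z := by
  have hz0 : z ≠ 0 := Complex.slitPlane_ne_zero hz
  obtain ⟨w, rfl⟩ : ∃ w, z = 2 * w := ⟨z / 2, by ring⟩
  have hw0 : w ≠ 0 := by rintro rfl; simp at hz0
  have harg : w.arg ≠ Real.pi := by
    have h := Complex.mem_slitPlane_iff_arg.1 hz
    have h2 := Complex.arg_real_mul w (r := 2) (by norm_num)
    push_cast at h2
    rw [h2] at h
    exact h.1
  have e1 : ((Real.pi : ℂ) / (2 * (2 * w))) ^ (1 / 2 : ℂ) * w ^ (1 / 2 : ℂ)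
      = (Real.sqrt Real.pi / 2 : ℝ) := by
    have hq : (0 : ℝ) < Real.pi / 4 := by positivity
    have h1 : (Real.pi : ℂ) / (2 * (2 * w)) = ((Real.pi / 4 : ℝ) : ℂ) * w⁻¹ := by
      push_cast; field_simp; norm_num
    have h3 : Real.sqrt Real.pi / 2 = (Real.pi / 4) ^ (1 / 2 : ℝ) := by
      rw [← Real.sqrt_eq_rpow, Real.sqrt_div Real.pi_pos.le,
        show (4 : ℝ) = 2 ^ 2 by norm_num, Real.sqrt_sq (by norm_num)]
    rw [h1, Complex.cpow_def_of_ne_zero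
        (mul_ne_zero (by exact_mod_cast hq.ne') (inv_ne_zero hw0)),
      Complex.cpow_def_of_ne_zero hw0, ← Complex.exp_add, Complex.log_ofReal_mul hq
        (inv_ne_zero hw0), Complex.log_inv _ harg, h3, Real.rpow_def_of_pos hq]
    push_cast
    congr 1
    ring
  unfold sphericalBesselJ besselJ
  rw [← e1, mul_assoc, ← tsum_mul_left]
  congr 2
  ext k
  have h4 : (2 * (k : ℂ) + (m + 1 / 2)) = ((2 * k + m : ℕ) : ℂ) + 1 / 2 := by push_cast; ring
  have h5 : (k : ℂ) + (m + 1 / 2) + 1 = k + m + 3 / 2 := by ring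
  rw [h4, h5, mul_div_cancel_left₀ w two_ne_zero, Complex.cpow_add _ _ hw0,
    Complex.cpow_natCast]
  ring

/-- `a_m(x) = (m + 1/2) ∫_{-x}^x K(x,t) P_m(t/x) dt`, the Fourier-Legendre coefficients of
`K(x,·)`: `K(x,t) = ∑ (a_m(x)/x) P_m(t/x)`. -/
def legendreCoeff (K : ℝ → ℝ → ℂ) (m : ℕ) (x : ℝ) : ℂ :=
  ((m : ℂ) + 1 / 2) * ∫ t in (-x)..x, K x t * ((legendreP m).eval (t / x) : ℝ)

/-- `α_m = 2 a_m`. -/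
def alphaCoeff (K : ℝ → ℝ → ℂ) (m : ℕ) (x : ℝ) : ℂ :=
  2 * legendreCoeff K m x

/-- The partial sum `K_N(x,t)`, up to degree `N`, of the Fourier-Legendre series. -/
def kernelPartial (K : ℝ → ℝ → ℂ) (N : ℕ) (x t : ℝ) : ℂ :=
  ∑ m ∈ Finset.range (N + 1), legendreCoeff K m x / x * ((legendreP m).eval (t / x) : ℝ)

/-- `ε_N(x) = ‖K(x,·) - K_N(x,·)‖_{L²(-x,x)}`. -/
def kernelError (K : ℝ → ℝ → ℂ) (N : ℕ) (x : ℝ) : ℝ :=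
  Real.sqrt (∫ t in (-x)..x, ‖K x t - kernelPartial K N x t‖ ^ 2)

/-- `C_{f,N}(ρ,x)`. -/
def cosPartial (K : ℝ → ℝ → ℂ) (N : ℕ) (ρ : ℂ) (x : ℝ) : ℂ :=
  Complex.cos (ρ * x) + ∑ m ∈ Finset.range (N / 2 + 1),
    (-1) ^ m * alphaCoeff K (2 * m) x * sphericalBesselJ (2 * m) (ρ * x)

/-- `S_{f,N}(ρ,x)`, for `ρ ≠ 0` and `N ≥ 1`. -/
def sinPartial (K : ℝ → ℝ → ℂ) (N : ℕ) (ρ : ℂ) (x : ℝ) : ℂ :=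
  Complex.sin (ρ * x) / ρ + 1 / ρ * ∑ m ∈ Finset.range ((N - 1) / 2 + 1),
    (-1) ^ m * alphaCoeff K (2 * m + 1) x * sphericalBesselJ (2 * m + 1) (ρ * x)

end

end NSBF

namespace NSBF

open MeasureTheory Set Filter Topology

/-! ### Calculus in `W^{1,2}` -/

/-! Everything rests on the factorisation provided by f. Testing the equation of y with fψ and that
of f with yψ makes the potential term appear twice with the same argument, so it cancels and leaves
the divergence form (f²(y/f)')' = -lam f y (`isWeakSolution_iff`). By the lemma of du Bois-Reymond
this is a linear first order system for the pair (y/f, f D_f y) with the continuous coefficients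
f^{-2} and -lam f². Cauchy problems therefore have unique solutions (`IsCauchySolution.unique`).

The kernel is constructed with p = f'/f in L². With v = D_f y, the equation S_q y = ρ²y reads y' =
py + v, v' = -pv - ρ²y. Suppose g_p(ρ,·) satisfies g' = iρ g + p g_p(-ρ,·), g(0) = 1. Then half of
g_p(ρ) + g_{-p}(ρ) + g_p(-ρ) - g_{-p}(-ρ) solves this system with data 1 and iρ. The function g_p is
sought as e^{iρx} plus the Fourier transform of a function G(x,·) supported in [-x,x]. Its integral
equation becomes a Volterra equation G = G₀ + TG that no longer contains ρ. The free term G₀ is a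
rescaled p and only square integrable, but TG₀ is bounded, and T halves an exponentially weighted
sup norm. The Neumann series thus converges pointwise (`volterraSol_eq`, `volterraExp_eq`,
`isTransmutationKernel_transmutationKernel`).

By uniqueness, the even and odd parts of e_f in ρ give C_f = cos(ρx) + ∫ K cos(ρt) and ρ S_f =
sin(ρx) + ∫ K sin(ρt). The Legendre polynomials form an orthogonal basis of L²(-x,x), and Rodrigues'
formula gives ∫ P_m e^{izt} = 2 i^m j_m(z). Parseval's identity then yields both series. A partial
sum is the same representation with K replaced by K_N, so the error is ∫ (K - K_N) cos(ρt) or ∫ (K -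
K_N) sin(ρt). It is bounded by Cauchy-Schwarz and |cos(ρt)|, |sin(ρt)| ≤ cosh(Ct). Uniformity for
S_f itself uses that sin(ρt)/ρ stays bounded in the strip, also near ρ = 0. The value at ρ = 0 comes
from continuity of S_f in ρ. -/

theorem ac_of_dist_le {X : Type*} [PseudoMetricSpace X] {F : ℝ → X} {u : ℝ → ℂ} {a b C : ℝ}
    (hF : AbsolutelyContinuousOnInterval F a b)
    (h : ∀ x ∈ uIcc a b, ∀ y ∈ uIcc a b, dist (u x) (u y) ≤ C * dist (F x) (F y)) :
    AbsolutelyContinuousOnInterval u a b := by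
  have h0 := Tendsto.const_mul C hF
  rw [mul_zero] at h0
  refine squeeze_zero' (.of_forall fun E => Finset.sum_nonneg fun _ _ => dist_nonneg) ?_ h0
  filter_upwards [mem_inf_of_right (mem_principal_self _)] with E hE
  rw [Finset.mul_sum]
  exact Finset.sum_le_sum fun i hi => h _ (hE.1 i hi).1 _ (hE.1 i hi).2

/-- Increments of ∫ g are dominated in norm by those of the real primitive ∫ |g|, whose absolute
continuity is thereby inherited. -/
theorem ac_integral {g : ℝ → ℂ} {a b : ℝ} (h : IntervalIntegrable g volume a b) :
    AbsolutelyContinuousOnInterval (fun x => ∫ t in a..x, g t) a b := by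
  have hsub : ∀ x ∈ uIcc a b, IntervalIntegrable g volume a x := fun x hx =>
    h.mono_set (uIcc_subset_uIcc_left hx)
  refine ac_of_dist_le (C := 1)
    (h.norm.absolutelyContinuousOnInterval_intervalIntegral (c := a) left_mem_uIcc) ?_
  intro x hx y hy
  rw [one_mul, dist_eq_norm, Real.dist_eq,
    intervalIntegral.integral_interval_sub_left (hsub x hx) (hsub y hy),
    intervalIntegral.integral_interval_sub_left (hsub x hx).norm (hsub y hy).norm]
  exact intervalIntegral.norm_integral_le_abs_integral_norm

theorem ae_Ioo_of_ae_uIcc {ℓ : ℝ} {P : ℝ → Prop} (hℓ : 0 ≤ ℓ)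
    (h : ∀ᵐ x, x ∈ uIcc 0 ℓ → P x) : ∀ᵐ x ∂(volume.restrict (Ioo 0 ℓ)), P x := by
  rw [ae_restrict_iff' measurableSet_Ioo]
  filter_upwards [h] with x hx hx'
  exact hx (by rw [uIcc_of_le hℓ]; exact Ioo_subset_Icc_self hx')

theorem intervalIntegrable_of_memLp_two {ℓ : ℝ} {g : ℝ → ℂ} (hℓ : 0 ≤ ℓ)
    (hg : MemLp g 2 (volume.restrict (Ioo 0 ℓ))) : IntervalIntegrable g volume 0 ℓ := by
  rw [intervalIntegrable_iff_integrableOn_Ioo_of_le hℓ]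
  exact hg.integrable (by norm_num)

theorem integral_eq_setIntegral_Ioo {ℓ : ℝ} (hℓ : 0 ≤ ℓ) (g : ℝ → ℂ) :
    ∫ x in (0 : ℝ)..ℓ, g x = ∫ x in Ioo 0 ℓ, g x := by
  rw [intervalIntegral.integral_of_le hℓ, integral_Ioc_eq_integral_Ioo]

theorem integral_congr_ae_Ioo {ℓ : ℝ} (hℓ : 0 ≤ ℓ) {g h : ℝ → ℂ}
    (H : ∀ᵐ x ∂(volume.restrict (Ioo 0 ℓ)), g x = h x) :
    ∫ x in (0 : ℝ)..ℓ, g x = ∫ x in (0 : ℝ)..ℓ, h x := by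
  rw [integral_eq_setIntegral_Ioo hℓ, integral_eq_setIntegral_Ioo hℓ]
  exact integral_congr_ae H

theorem MemLp.mul_two {ℓ : ℝ} (hℓ : 0 ≤ ℓ) {g h : ℝ → ℂ}
    (hg : MemLp g 2 (volume.restrict (Ioo 0 ℓ))) (hh : MemLp h 2 (volume.restrict (Ioo 0 ℓ))) :
    IntervalIntegrable (fun x => g x * h x) volume 0 ℓ := by
  rw [intervalIntegrable_iff_integrableOn_Ioo_of_le hℓ]
  exact hg.integrable_mul hh

theorem memLp_mul_continuousOn {ℓ : ℝ} {g u : ℝ → ℂ}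
    (hg : MemLp g 2 (volume.restrict (Ioo 0 ℓ))) (hu : ContinuousOn u (Icc 0 ℓ)) :
    MemLp (fun x => g x * u x) 2 (volume.restrict (Ioo 0 ℓ)) := by
  obtain ⟨C, hC⟩ := isCompact_Icc.exists_bound_of_continuousOn hu
  refine MemLp.of_le_mul (c := C) hg (hg.1.mul
    ((hu.mono Ioo_subset_Icc_self).aestronglyMeasurable measurableSet_Ioo)) ?_
  rw [ae_restrict_iff' measurableSet_Ioo]
  refine .of_forall fun x hx => ?_
  rw [norm_mul, mul_comm]
  exact mul_le_mul_of_nonneg_right (hC x (Ioo_subset_Icc_self hx)) (norm_nonneg _)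

theorem memLp_of_continuousOn {ℓ : ℝ} {u : ℝ → ℂ} (hu : ContinuousOn u (Icc 0 ℓ)) :
    MemLp u 2 (volume.restrict (Ioo 0 ℓ)) := by
  have : IsFiniteMeasure (volume.restrict (Ioo (0 : ℝ) ℓ)) :=
    ⟨by simp [Real.volume_Ioo]⟩
  simpa using memLp_mul_continuousOn (memLp_const (1 : ℂ)) hu

section

variable {ℓ : ℝ} {u w g : ℝ → ℂ}

theorem MemW12.continuousOn (hℓ : 0 ≤ ℓ) (hu : MemW12 ℓ u) : ContinuousOn u (Icc 0 ℓ) := by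
  simpa [uIcc_of_le hℓ] using hu.1.continuousOn

theorem MemW12.ae_differentiableAt (hℓ : 0 ≤ ℓ) (hu : MemW12 ℓ u) :
    ∀ᵐ x ∂(volume.restrict (Ioo 0 ℓ)), DifferentiableAt ℝ u x :=
  ae_Ioo_of_ae_uIcc hℓ hu.1.boundedVariationOn.ae_differentiableAt_of_mem_uIcc

/-- The difference u - ∫ u' is absolutely continuous with derivative zero almost everywhere, hence
constant. With the converse `memW12_of_eq_integral`, membership in W^{1,2} becomes being a primitive
of an L² function. -/
theorem MemW12.eq_integral (hℓ : 0 ≤ ℓ) (hu : MemW12 ℓ u) {x : ℝ} (hx : x ∈ Icc 0 ℓ) :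
    u x = u 0 + ∫ t in (0 : ℝ)..x, deriv u t := by
  have hi := intervalIntegrable_of_memLp_two hℓ hu.2
  have hac := hu.1.sub (ac_integral hi)
  obtain ⟨C, hC⟩ := hac.const_of_ae_hasDerivAt_zero (by
    filter_upwards [hu.1.boundedVariationOn.ae_differentiableAt_of_mem_uIcc,
      hi.ae_hasDerivAt_integral] with x hx₁ hx₂ hx₃
    simpa using (hx₁ hx₃).hasDerivAt.sub (hx₂ hx₃ 0 left_mem_uIcc))
  have h1 := hC 0 left_mem_uIcc
  have h2 := hC x (by rwa [uIcc_of_le hℓ])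
  simp only [Pi.sub_apply, intervalIntegral.integral_same, sub_zero] at h1 h2
  rw [h1, ← h2]; ring

theorem ae_hasDerivAt_of_eq_integral (hℓ : 0 ≤ ℓ) {c : ℂ} (hg : IntervalIntegrable g volume 0 ℓ)
    (h : ∀ x ∈ Icc 0 ℓ, u x = c + ∫ t in (0 : ℝ)..x, g t) :
    ∀ᵐ x ∂(volume.restrict (Ioo 0 ℓ)), HasDerivAt u (g x) x := by
  have h1 := ae_Ioo_of_ae_uIcc hℓ hg.ae_hasDerivAt_integral
  filter_upwards [h1, ae_restrict_mem measurableSet_Ioo] with x hx hx'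
  refine ((hx 0 left_mem_uIcc).const_add c).congr_of_eventuallyEq ?_
  filter_upwards [isOpen_Ioo.mem_nhds hx'] with y hy
  exact h y (Ioo_subset_Icc_self hy)

theorem deriv_ae_eq_of_eq_integral (hℓ : 0 ≤ ℓ) {c : ℂ} (hg : IntervalIntegrable g volume 0 ℓ)
    (h : ∀ x ∈ Icc 0 ℓ, u x = c + ∫ t in (0 : ℝ)..x, g t) :
    deriv u =ᵐ[volume.restrict (Ioo 0 ℓ)] g :=
  (ae_hasDerivAt_of_eq_integral hℓ hg h).mono fun _ hx => hx.deriv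

theorem memW12_of_eq_integral (hℓ : 0 ≤ ℓ) {c : ℂ} (hg : MemLp g 2 (volume.restrict (Ioo 0 ℓ)))
    (h : ∀ x ∈ Icc 0 ℓ, u x = c + ∫ t in (0 : ℝ)..x, g t) : MemW12 ℓ u := by
  have hi := intervalIntegrable_of_memLp_two hℓ hg
  refine ⟨ac_of_dist_le (C := 1) (ac_integral hi) ?_,
    hg.ae_eq (deriv_ae_eq_of_eq_integral hℓ hi h).symm⟩
  intro x hx y hy
  rw [uIcc_of_le hℓ] at hx hy
  rw [h x hx, h y hy, dist_add_left, one_mul]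

theorem MemW12.mul_deriv (hℓ : 0 ≤ ℓ) (hu : MemW12 ℓ u) (hw : MemW12 ℓ w) :
    ∀ᵐ x ∂(volume.restrict (Ioo 0 ℓ)),
      deriv (fun x => u x * w x) x = deriv u x * w x + u x * deriv w x := by
  filter_upwards [hu.ae_differentiableAt hℓ, hw.ae_differentiableAt hℓ] with x h1 h2
  exact (h1.hasDerivAt.mul h2.hasDerivAt).deriv

theorem MemW12.mul (hℓ : 0 ≤ ℓ) (hu : MemW12 ℓ u) (hw : MemW12 ℓ w) :
    MemW12 ℓ (fun x => u x * w x) := by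
  have hac : AbsolutelyContinuousOnInterval (u • w) 0 ℓ := hu.1.smul hw.1
  have hL := (memLp_mul_continuousOn hu.2 (hw.continuousOn hℓ)).add
    (memLp_mul_continuousOn hw.2 (hu.continuousOn hℓ))
  refine ⟨hac, hL.ae_eq ?_⟩
  filter_upwards [hu.mul_deriv hℓ hw] with x hx
  rw [hx, Pi.add_apply, mul_comm (u x)]

theorem MemW12.inv_deriv (hℓ : 0 ≤ ℓ) (hu : MemW12 ℓ u) (h0 : ∀ x ∈ Icc 0 ℓ, u x ≠ 0) :
    ∀ᵐ x ∂(volume.restrict (Ioo 0 ℓ)), deriv (fun x => (u x)⁻¹) x = -deriv u x / u x ^ 2 := by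
  filter_upwards [hu.ae_differentiableAt hℓ, ae_restrict_mem measurableSet_Ioo] with x h1 h2
  exact (h1.hasDerivAt.fun_inv (h0 x (Ioo_subset_Icc_self h2))).deriv

theorem MemW12.inv (hℓ : 0 ≤ ℓ) (hu : MemW12 ℓ u) (h0 : ∀ x ∈ Icc 0 ℓ, u x ≠ 0) :
    MemW12 ℓ (fun x => (u x)⁻¹) := by
  have hc := hu.continuousOn hℓ
  obtain ⟨C, hC⟩ := isCompact_Icc.exists_bound_of_continuousOn (hc.inv₀ h0)
  constructor
  -- C bounds |1/u|, and 1/u(x) - 1/u(y) is (u(y) - u(x)) times two such factors.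
  · refine ac_of_dist_le (C := C * C) hu.1 ?_
    intro x hx y hy
    rw [uIcc_of_le hℓ] at hx hy
    have h1 := hC x hx
    have h2 := hC y hy
    have h3 : (u x)⁻¹ - (u y)⁻¹ = (u x)⁻¹ * (u y)⁻¹ * (u y - u x) := by
      field_simp [h0 x hx, h0 y hy]
    rw [dist_eq_norm, h3, norm_mul, norm_mul, dist_comm, dist_eq_norm]
    gcongr
    · exact (norm_nonneg _).trans h1
    · exact h1
    · exact h2
  · have hc2 : ContinuousOn (fun x => -((u x) ^ 2)⁻¹) (Icc 0 ℓ) :=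
      ((hc.pow 2).inv₀ fun x hx => pow_ne_zero 2 (h0 x hx)).neg
    refine (memLp_mul_continuousOn hu.2 hc2).ae_eq ?_
    filter_upwards [hu.inv_deriv hℓ h0] with x hx
    rw [hx]; ring

/-- Integration by parts against a function vanishing at both ends. -/
theorem MemW12Zero.integral_mul_deriv (hℓ : 0 ≤ ℓ) (hu : MemW12 ℓ u) (hw : MemW12Zero ℓ w) :
    ∫ x in (0 : ℝ)..ℓ, u x * deriv w x = -∫ x in (0 : ℝ)..ℓ, deriv u x * w x := by
  have h1 := (hu.mul hℓ hw.1).eq_integral hℓ (right_mem_Icc.2 hℓ)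
  rw [integral_congr_ae_Ioo hℓ (hu.mul_deriv hℓ hw.1), hw.2.1, hw.2.2,
    intervalIntegral.integral_add] at h1
  · simp only [mul_zero, zero_add] at h1
    linear_combination -h1
  · exact intervalIntegrable_of_memLp_two hℓ (memLp_mul_continuousOn hu.2 (hw.1.continuousOn hℓ))
  · simpa only [mul_comm] using intervalIntegrable_of_memLp_two hℓ
      (memLp_mul_continuousOn hw.1.2 (hu.continuousOn hℓ))

theorem memLp_star {h : ℝ → ℂ} {μ : Measure ℝ} {p : ENNReal} (hh : MemLp h p μ) :
    MemLp (fun x => (starRingEnd ℂ) (h x)) p μ :=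
  hh.of_le (Complex.continuous_conj.comp_aestronglyMeasurable hh.1)
    (.of_forall fun x => by simp)

/-- The lemma of du Bois-Reymond. -/
theorem ae_const_of_integral_mul_deriv_eq_zero (hℓ : 0 < ℓ) {h : ℝ → ℂ}
    (hh : MemLp h 2 (volume.restrict (Ioo 0 ℓ)))
    (H : ∀ ψ, MemW12Zero ℓ ψ → ∫ x in (0 : ℝ)..ℓ, h x * deriv ψ x = 0) :
    ∃ c : ℂ, h =ᵐ[volume.restrict (Ioo 0 ℓ)] fun _ => c := by
  have hfin : IsFiniteMeasure (volume.restrict (Ioo (0 : ℝ) ℓ)) := ⟨by simp [Real.volume_Ioo]⟩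
  -- With c the mean of h, the primitive ψ of conj(h - c) vanishes at both ends and is a test
  -- function. The hypothesis for this ψ gives ∫ |h - c|² = 0.
  set c : ℂ := (∫ x in (0 : ℝ)..ℓ, h x) / ℓ with hc
  have hhi := intervalIntegrable_of_memLp_two hℓ.le hh
  have hk : MemLp (fun x => h x - c) 2 (volume.restrict (Ioo 0 ℓ)) := hh.sub (memLp_const c)
  have hk0 : ∫ x in (0 : ℝ)..ℓ, (h x - c) = 0 := by
    rw [intervalIntegral.integral_sub hhi intervalIntegrable_const, intervalIntegral.integral_const,
      hc]
    have : (ℓ : ℂ) ≠ 0 := by exact_mod_cast hℓ.ne'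
    rw [sub_zero, Complex.real_smul]
    field_simp
    ring
  have hg := memLp_star hk
  have hgi := intervalIntegrable_of_memLp_two hℓ.le hg
  set ψ : ℝ → ℂ := fun x => ∫ t in (0 : ℝ)..x, (starRingEnd ℂ) (h t - c) with hψ
  have hψe : ∀ x ∈ Icc 0 ℓ, ψ x = 0 + ∫ t in (0 : ℝ)..x, (starRingEnd ℂ) (h t - c) :=
    fun x _ => by rw [hψ, zero_add]
  have hψ0 : MemW12Zero ℓ ψ := by
    refine ⟨memW12_of_eq_integral hℓ.le hg hψe, by simp [hψ], ?_⟩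
    rw [hψ]
    simp only
    rw [integral_eq_setIntegral_Ioo hℓ.le, integral_conj, ← integral_eq_setIntegral_Ioo hℓ.le, hk0,
      map_zero]
  have h1 := H ψ hψ0
  rw [integral_congr_ae_Ioo hℓ.le (h := fun x => h x * (starRingEnd ℂ) (h x - c)) (by
    filter_upwards [deriv_ae_eq_of_eq_integral hℓ.le hgi hψe] with x hx; rw [hx])] at h1
  have h2 : ∫ x in (0 : ℝ)..ℓ, c * (starRingEnd ℂ) (h x - c) = 0 := by
    rw [intervalIntegral.integral_const_mul]
    rw [integral_eq_setIntegral_Ioo hℓ.le, integral_conj, ← integral_eq_setIntegral_Ioo hℓ.le, hk0,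
      map_zero, mul_zero]
  have h3 : ∫ x in (0 : ℝ)..ℓ, (h x - c) * (starRingEnd ℂ) (h x - c) = 0 := by
    have := intervalIntegral.integral_sub (MemLp.mul_two hℓ.le hh hg)
      (hgi.const_mul c)
    rw [h1, h2, sub_zero] at this
    rw [← this]
    congr 1
    ext x
    ring
  rw [integral_eq_setIntegral_Ioo hℓ.le] at h3
  have h4 : ∫ x in Ioo 0 ℓ, ‖h x - c‖ ^ 2 = 0 := by
    have : ((∫ x in Ioo 0 ℓ, ‖h x - c‖ ^ 2 : ℝ) : ℂ) = 0 := by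
      rw [← h3, ← integral_complex_ofReal]
      congr 1
      ext x
      rw [Complex.mul_conj, Complex.normSq_eq_norm_sq]
    exact_mod_cast this
  rw [integral_eq_zero_iff_of_nonneg (fun x => by positivity) (by
    simpa using hk.integrable_norm_pow (by norm_num))] at h4
  refine ⟨c, ?_⟩
  filter_upwards [h4] with x hx
  simpa [sub_eq_zero] using hx

end

/-! ### Cauchy solutions and the equivalent first order system -/

section

variable {ℓ : ℝ} {σ f y v u w : ℝ → ℂ} {lam c₀ c₁ : ℂ}

theorem MemW12.add_deriv (hℓ : 0 ≤ ℓ) (hu : MemW12 ℓ u) (hw : MemW12 ℓ w) (α β : ℂ) :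
    ∀ᵐ x ∂(volume.restrict (Ioo 0 ℓ)),
      deriv (fun x => α * u x + β * w x) x = α * deriv u x + β * deriv w x := by
  filter_upwards [hu.ae_differentiableAt hℓ, hw.ae_differentiableAt hℓ] with x h1 h2
  exact ((h1.hasDerivAt.const_mul α).add (h2.hasDerivAt.const_mul β)).deriv

theorem MemW12.linearComb (hℓ : 0 ≤ ℓ) (hu : MemW12 ℓ u) (hw : MemW12 ℓ w) (α β : ℂ) :
    MemW12 ℓ (fun x => α * u x + β * w x) := by
  have hac : AbsolutelyContinuousOnInterval (fun x => α • u x + β • w x) 0 ℓ :=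
    (hu.1.const_smul α).add (hw.1.const_smul β)
  refine ⟨hac, MemLp.ae_eq ?_ ((hu.2.const_mul α).add (hw.2.const_mul β))⟩
  filter_upwards [hu.add_deriv hℓ hw α β] with x hx
  rw [hx, Pi.add_apply]

/-- Both pairings test the potential against the same product f y w, so σ drops out and only the
Wronskian f y' - f' y survives. -/
theorem integral_deriv_mul_sub (hℓ : 0 ≤ ℓ) (hf : MemW12 ℓ f) (hy : MemW12 ℓ y)
    (hw : MemW12 ℓ w) :
    schrodingerPairing ℓ σ y (fun x => f x * w x) - schrodingerPairing ℓ σ f (fun x => y x * w x) =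
      ∫ x in (0 : ℝ)..ℓ, (f x * deriv y x - deriv f x * y x) * deriv w x := by
  have e1 : (fun x => y x * (f x * w x)) = fun x => f x * (y x * w x) := by ext x; ring
  unfold schrodingerPairing
  rw [e1, add_sub_add_right_eq_sub, ← intervalIntegral.integral_sub]
  · refine integral_congr_ae_Ioo hℓ ?_
    filter_upwards [hf.mul_deriv hℓ hw, hy.mul_deriv hℓ hw] with x h1 h2
    rw [h1, h2]; ring
  · exact MemLp.mul_two hℓ hy.2 (hf.mul hℓ hw).2
  · exact MemLp.mul_two hℓ hf.2 (hy.mul hℓ hw).2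

theorem MemW12Zero.mul (hℓ : 0 ≤ ℓ) (hu : MemW12 ℓ u) (hw : MemW12Zero ℓ w) :
    MemW12Zero ℓ (fun x => u x * w x) :=
  ⟨hu.mul hℓ hw.1, by simp [hw.2.1], by simp [hw.2.2]⟩

/-- The equation `S_q y = lam y` in the divergence form `(f² (y/f)')' = - lam f y`. -/
theorem isWeakSolution_iff (hℓ : 0 ≤ ℓ) (hf : IsNonvanishingSolution ℓ σ f) (hy : MemW12 ℓ y) :
    IsWeakSolution ℓ σ lam y ↔ ∀ ψ, MemW12Zero ℓ ψ →
      ∫ x in (0 : ℝ)..ℓ, (f x * deriv y x - deriv f x * y x) * deriv ψ x =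
        lam * ∫ x in (0 : ℝ)..ℓ, f x * y x * ψ x := by
  have hfW := hf.isSolution.1
  have key : ∀ ψ, MemW12Zero ℓ ψ → schrodingerPairing ℓ σ y (fun x => f x * ψ x) =
      ∫ x in (0 : ℝ)..ℓ, (f x * deriv y x - deriv f x * y x) * deriv ψ x := fun ψ hψ => by
    rw [← integral_deriv_mul_sub (σ := σ) hℓ hfW hy hψ.1,
      hf.isSolution.2 _ (MemW12Zero.mul hℓ hy hψ), zero_mul, sub_zero]
  constructor
  · intro h ψ hψ
    rw [← key ψ hψ, h.2 _ (MemW12Zero.mul hℓ hfW hψ)]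
    congr 2
    ext x
    ring
  · refine fun h => ⟨hy, fun φ hφ => ?_⟩
    -- A general φ is f·w with w = φ/f. This identity holds only on [0,ℓ], so derivatives are
    -- compared through local equality on the open interval.
    have hψ := MemW12Zero.mul hℓ (hfW.inv hℓ hf.ne_zero) hφ
    set w : ℝ → ℂ := fun x => (f x)⁻¹ * φ x with hw
    have hwf : ∀ x ∈ Icc 0 ℓ, f x * w x = φ x := fun x hx => by
      rw [hw]; field_simp [hf.ne_zero x hx]
    have hd : ∀ {k : ℝ → ℂ}, ∀ x ∈ Ioo 0 ℓ,
        deriv (fun x => k x * (f x * w x)) x = deriv (fun x => k x * φ x) x := fun {k} x hx => by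
      refine Filter.EventuallyEq.deriv_eq ?_
      filter_upwards [isOpen_Ioo.mem_nhds hx] with z hz
      rw [hwf z (Ioo_subset_Icc_self hz)]
    have h1 : schrodingerPairing ℓ σ y (fun x => f x * w x) = schrodingerPairing ℓ σ y φ := by
      unfold schrodingerPairing potentialPairing
      congr 1
      · refine integral_congr_ae_Ioo hℓ ?_
        filter_upwards [ae_restrict_mem measurableSet_Ioo] with x hx
        have := hd (k := fun _ => 1) x hx
        simp only [one_mul] at this
        rw [this]
      · congr 1
        refine integral_congr_ae_Ioo hℓ ?_
        filter_upwards [ae_restrict_mem measurableSet_Ioo] with x hx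
        rw [hd x hx]
    rw [← h1, key w hψ, h w hψ]
    congr 1
    refine integral_congr_ae_Ioo hℓ ?_
    filter_upwards [ae_restrict_mem measurableSet_Ioo] with x hx
    rw [← hwf x (Ioo_subset_Icc_self hx)]
    ring

theorem memLp_wronskian (hℓ : 0 ≤ ℓ) (hf : MemW12 ℓ f) (hy : MemW12 ℓ y) :
    MemLp (fun x => f x * deriv y x - deriv f x * y x) 2 (volume.restrict (Ioo 0 ℓ)) := by
  have := (memLp_mul_continuousOn hy.2 (hf.continuousOn hℓ)).sub
    (memLp_mul_continuousOn hf.2 (hy.continuousOn hℓ))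
  refine this.ae_eq (.of_forall fun x => ?_)
  simp only [Pi.sub_apply]
  ring

/-- The terms with f' cancel in (f v)' = -lam f y, and integrating this against ψ gives the
divergence form. -/
theorem isCauchySolution_of_system (hℓ : 0 ≤ ℓ) (hf : IsNonvanishingSolution ℓ σ f)
    (hy : MemW12 ℓ y) (hv : MemW12 ℓ v)
    (h1 : ∀ᵐ x ∂(volume.restrict (Ioo 0 ℓ)), v x = darbouxD f y x)
    (h2 : ∀ᵐ x ∂(volume.restrict (Ioo 0 ℓ)), deriv v x = -(deriv f x / f x) * v x - lam * y x)
    (hy0 : y 0 = c₀) (hv0 : v 0 = c₁) : IsCauchySolution ℓ σ f lam c₀ c₁ y := by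
  refine ⟨(isWeakSolution_iff hℓ hf hy).2 fun ψ hψ => ?_, hy0, v, hv, h1, hv0⟩
  have hfW := hf.isSolution.1
  have hne : ∀ᵐ x ∂(volume.restrict (Ioo 0 ℓ)), f x ≠ 0 := by
    filter_upwards [ae_restrict_mem measurableSet_Ioo] with x hx
    exact hf.ne_zero x (Ioo_subset_Icc_self hx)
  calc _ = ∫ x in (0 : ℝ)..ℓ, (f x * v x) * deriv ψ x := by
        refine integral_congr_ae_Ioo hℓ ?_
        filter_upwards [h1, hne] with x hx h0
        rw [hx, darbouxD]
        field_simp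
    _ = -∫ x in (0 : ℝ)..ℓ, deriv (fun x => f x * v x) x * ψ x :=
        MemW12Zero.integral_mul_deriv hℓ (hfW.mul hℓ hv) hψ
    _ = -∫ x in (0 : ℝ)..ℓ, -lam * (f x * y x * ψ x) := by
        congr 1
        refine integral_congr_ae_Ioo hℓ ?_
        filter_upwards [hfW.mul_deriv hℓ hv, h2, hne] with x hx hx2 h0
        rw [hx, hx2]
        field_simp
        ring
    _ = _ := by rw [intervalIntegral.integral_const_mul]; ring

/-- By du Bois-Reymond, f y' - f' y + lam ∫ f y is almost everywhere constant. V is the continuous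
quasi-derivative f D_f y = f²(y/f)'. In the pair (y/f, V) the coefficients are continuous although
f' is merely square integrable. -/
theorem IsCauchySolution.exists_system (hℓ : 0 < ℓ) (hf : IsNonvanishingSolution ℓ σ f)
    (hy : IsCauchySolution ℓ σ f lam c₀ c₁ y) :
    ∃ V : ℝ → ℂ, ContinuousOn V (Icc 0 ℓ) ∧
      (∀ x ∈ Icc 0 ℓ, y x / f x = c₀ + ∫ t in (0 : ℝ)..x, V t / f t ^ 2) ∧
      ∀ x ∈ Icc 0 ℓ, V x = c₁ - lam * ∫ t in (0 : ℝ)..x, f t * y t := by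
  have hyW := hy.isSolution.1
  have hfW := hf.isSolution.1
  obtain ⟨v, hv, hvD, hv0⟩ := hy.init_deriv
  have hfy : MemLp (fun x => f x * y x) 2 (volume.restrict (Ioo 0 ℓ)) :=
    memLp_of_continuousOn ((hfW.continuousOn hℓ.le).mul (hyW.continuousOn hℓ.le))
  set G : ℝ → ℂ := fun x => ∫ t in (0 : ℝ)..x, f t * y t with hG
  have hGe : ∀ x ∈ Icc 0 ℓ, G x = 0 + ∫ t in (0 : ℝ)..x, f t * y t := fun x _ => by
    rw [zero_add]
  have hGW : MemW12 ℓ G := memW12_of_eq_integral hℓ.le hfy hGe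
  have hGd := deriv_ae_eq_of_eq_integral hℓ.le (intervalIntegrable_of_memLp_two hℓ.le hfy) hGe
  have hh := memLp_wronskian hℓ.le hfW hyW
  have hGL := memLp_of_continuousOn (hGW.continuousOn hℓ.le)
  obtain ⟨c, hc⟩ := ae_const_of_integral_mul_deriv_eq_zero hℓ (hh.add (hGL.const_mul lam))
    (fun ψ hψ => by
      have h1 := (isWeakSolution_iff hℓ.le hf hyW).1 hy.isSolution ψ hψ
      have h2 := MemW12Zero.integral_mul_deriv hℓ.le hGW hψ
      rw [integral_congr_ae_Ioo hℓ.le (g := fun x => deriv G x * ψ x)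
        (h := fun x => f x * y x * ψ x) (by filter_upwards [hGd] with x hx; rw [hx])] at h2
      simp only [Pi.add_apply, add_mul]
      rw [intervalIntegral.integral_add (MemLp.mul_two hℓ.le hh hψ.1.2)
        (MemLp.mul_two hℓ.le (hGL.const_mul lam) hψ.1.2), h1]
      simp only [mul_assoc]
      rw [intervalIntegral.integral_const_mul, h2]
      simp only [mul_assoc]
      ring)
  have hVc : ContinuousOn (fun x => c - lam * G x) (Icc 0 ℓ) :=
    continuousOn_const.sub (continuousOn_const.mul (hGW.continuousOn hℓ.le))
  have hne : ∀ᵐ x ∂(volume.restrict (Ioo 0 ℓ)), f x ≠ 0 := by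
    filter_upwards [ae_restrict_mem measurableSet_Ioo] with x hx
    exact hf.ne_zero x (Ioo_subset_Icc_self hx)
  -- Two continuous functions equal almost everywhere are equal on all of [0,ℓ]. Evaluation at 0,
  -- where f = 1, then identifies the constant c with c₁.
  have hfv : EqOn (fun x => f x * v x) (fun x => c - lam * G x) (Icc 0 ℓ) := by
    refine Measure.eqOn_Icc_of_ae_eq (μ := volume) hℓ.ne ?_
      ((hfW.continuousOn hℓ.le).mul (hv.continuousOn hℓ.le)) hVc
    rw [← Measure.restrict_congr_set Ioo_ae_eq_Icc]
    filter_upwards [hc, hvD, hne] with x h1 h2 h3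
    simp only [Pi.add_apply] at h1
    rw [h2, ← h1, darbouxD]
    field_simp
    ring
  have hc1 : c = c₁ := by
    have := hfv (left_mem_Icc.2 hℓ.le)
    simpa [hf.normalized, hv0, hG] using this.symm
  refine ⟨fun x => c - lam * G x, hVc, fun x hx => ?_, fun x _ => by rw [hc1]⟩
  have hW := hyW.mul hℓ.le (hfW.inv hℓ.le hf.ne_zero)
  have h1 := hW.eq_integral hℓ.le hx
  simp only [hf.normalized, inv_one, mul_one, hy.init_value] at h1
  rw [div_eq_mul_inv, h1]
  congr 1
  refine intervalIntegral.integral_congr_ae ?_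
  have h2 := hyW.mul_deriv hℓ.le (hfW.inv hℓ.le hf.ne_zero)
  have h3 : ∀ᵐ x ∂(volume.restrict (Ioo 0 ℓ)), deriv (fun x => y x * (f x)⁻¹) x =
      (c - lam * G x) / f x ^ 2 := by
    filter_upwards [h2, hfW.inv_deriv hℓ.le hf.ne_zero, hc, hne] with x h2 h4 h5 h6
    simp only [Pi.add_apply] at h5
    rw [h2, h4, ← h5]
    field_simp
    ring
  rw [Measure.restrict_congr_set Ioo_ae_eq_Ioc, ae_restrict_iff' measurableSet_Ioc] at h3
  filter_upwards [h3] with t ht ht'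
  rw [uIoc_of_le hx.1] at ht'
  exact ht ⟨ht'.1, ht'.2.trans hx.2⟩

/-- Continuity is known only on [0,ℓ], so the derivative is one-sided; right derivatives are enough
for ODE uniqueness. -/
theorem hasDerivWithinAt_of_eq_integral {g : ℝ → ℂ} {c : ℂ} (hg : ContinuousOn g (Icc 0 ℓ))
    (h : ∀ x ∈ Icc 0 ℓ, u x = c + ∫ t in (0 : ℝ)..x, g t) {x : ℝ} (hx : x ∈ Ico 0 ℓ) :
    HasDerivWithinAt u (g x) (Ici x) x := by
  have hx' : x ∈ Icc 0 ℓ := Ico_subset_Icc_self hx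
  have hcw : ContinuousWithinAt g (Icc x ℓ) x := (hg x hx').mono (Icc_subset_Icc_left hx.1)
  have hnb : Icc x ℓ ∈ 𝓝[≥] x := Icc_mem_nhdsGE hx.2
  have hci : ContinuousWithinAt g (Ioi x) x :=
    (hcw.mono_of_mem_nhdsWithin hnb).mono Ioi_subset_Ici_self
  have hsm : StronglyMeasurableAtFilter g (𝓝[>] x) volume :=
    ⟨Icc x ℓ, Icc_mem_nhdsGT hx.2,
      (hg.mono (Icc_subset_Icc_left hx.1)).aestronglyMeasurable measurableSet_Icc⟩
  have hi : IntervalIntegrable g volume 0 x := by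
    refine ContinuousOn.intervalIntegrable ?_
    rw [uIcc_of_le hx.1]
    exact hg.mono (Icc_subset_Icc_right hx.2.le)
  have h1 := (intervalIntegral.integral_hasDerivWithinAt_right hi hsm hci
    (s := Ici x)).const_add c
  refine h1.congr_of_eventuallyEq ?_ (h x hx')
  filter_upwards [hnb] with z hz
  exact h z ⟨hx.1.trans hz.1, hz.2⟩

/-- For the pair (y/f, f²(y/f)') the system is linear with bounded coefficients, hence Lipschitz,
and the Cauchy data fix the pair at 0. -/
theorem IsCauchySolution.unique (hℓ : 0 < ℓ) (hf : IsNonvanishingSolution ℓ σ f) {y₁ y₂ : ℝ → ℂ}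
    (h₁ : IsCauchySolution ℓ σ f lam c₀ c₁ y₁) (h₂ : IsCauchySolution ℓ σ f lam c₀ c₁ y₂) :
    EqOn y₁ y₂ (Icc 0 ℓ) := by
  have hfc := hf.isSolution.1.continuousOn hℓ.le
  have hf2 : ContinuousOn (fun x => (f x ^ 2)⁻¹) (Icc 0 ℓ) :=
    (hfc.pow 2).inv₀ fun x hx => pow_ne_zero 2 (hf.ne_zero x hx)
  obtain ⟨A, hA⟩ := isCompact_Icc.exists_bound_of_continuousOn hf2
  obtain ⟨B, hB⟩ := isCompact_Icc.exists_bound_of_continuousOn (hfc.pow 2)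
  set F : ℝ → ℂ × ℂ → ℂ × ℂ := fun t z => (z.2 / f t ^ 2, -lam * (f t ^ 2 * z.1)) with hF
  -- In the sup norm of ℂ × ℂ the larger of the bounds of the two components is a Lipschitz
  -- constant.
  set L : ℝ := max A (‖lam‖ * B) with hL
  have hL0 : 0 ≤ L := ((norm_nonneg _).trans (hA 0 (left_mem_Icc.2 hℓ.le))).trans (le_max_left _ _)
  have hlip : ∀ t ∈ Ico 0 ℓ, LipschitzOnWith ⟨L, hL0⟩ (F t) univ := fun t ht => by
    have ht' := Ico_subset_Icc_self ht
    refine LipschitzOnWith.of_dist_le_mul fun z _ z' _ => ?_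
    have hz1 := norm_fst_le (z - z')
    have hz2 := norm_snd_le (z - z')
    rw [dist_eq_norm, dist_eq_norm]
    change ‖F t z - F t z'‖ ≤ L * ‖z - z'‖
    rw [Prod.norm_def, max_le_iff]
    constructor
    · have : (F t z - F t z').1 = (f t ^ 2)⁻¹ * (z - z').2 := by
        simp only [hF, Prod.fst_sub, Prod.snd_sub]; ring
      rw [this, norm_mul]
      exact mul_le_mul ((hA t ht').trans (le_max_left _ _)) hz2 (norm_nonneg _) hL0
    · have : (F t z - F t z').2 = -lam * f t ^ 2 * (z - z').1 := by
        simp only [hF, Prod.fst_sub, Prod.snd_sub]; ring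
      rw [this, norm_mul, norm_mul, norm_neg]
      refine mul_le_mul (le_trans ?_ (le_max_right _ _)) hz1 (norm_nonneg _) hL0
      exact mul_le_mul_of_nonneg_left (hB t ht') (norm_nonneg _)
  have main : ∀ y, IsCauchySolution ℓ σ f lam c₀ c₁ y → ∃ Z : ℝ → ℂ × ℂ,
      ContinuousOn Z (Icc 0 ℓ) ∧ (∀ t ∈ Ico 0 ℓ, HasDerivWithinAt Z (F t (Z t)) (Ici t) t) ∧
      Z 0 = (c₀, c₁) ∧ ∀ x ∈ Icc 0 ℓ, y x = f x * (Z x).1 := by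
    intro y hy
    obtain ⟨V, hV, hyV, hVy⟩ := hy.exists_system hℓ hf
    have hyc := hy.isSolution.1.continuousOn hℓ.le
    refine ⟨fun x => (y x / f x, V x), (hyc.div hfc hf.ne_zero).prodMk hV, fun t ht => ?_, ?_,
      fun x hx => ?_⟩
    · refine HasDerivWithinAt.prodMk (hasDerivWithinAt_of_eq_integral
        (hV.div (hfc.pow 2) fun x hx => pow_ne_zero 2 (hf.ne_zero x hx)) hyV ht) ?_
      have h3 := hasDerivWithinAt_of_eq_integral (u := V) (c := c₁)
        (g := fun t => -lam * (f t * y t))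
        (continuousOn_const.mul (hfc.mul hyc)) (fun x hx => by
          rw [hVy x hx, intervalIntegral.integral_const_mul]; ring) ht
      have h0 := hf.ne_zero t (Ico_subset_Icc_self ht)
      have h4 : -lam * (f t * y t) = -lam * (f t ^ 2 * (y t / f t)) := by field_simp
      rw [h4] at h3
      exact h3
    · have h0 := hyV 0 (left_mem_Icc.2 hℓ.le)
      have h1 := hVy 0 (left_mem_Icc.2 hℓ.le)
      simp only [intervalIntegral.integral_same, add_zero, mul_zero, sub_zero] at h0 h1
      exact Prod.ext h0 h1
    · have := hf.ne_zero x hx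
      field_simp
  obtain ⟨Z₁, a1, a2, a3, a4⟩ := main y₁ h₁
  obtain ⟨Z₂, b1, b2, b3, b4⟩ := main y₂ h₂
  have := ODE_solution_unique_of_mem_Icc_right hlip a1 a2 (fun _ _ => mem_univ _) b1 b2
    (fun _ _ => mem_univ _) (a3.trans b3.symm)
  intro x hx
  rw [a4 x hx, b4 x hx, this hx]

theorem IsCauchySolution.linearComb (hℓ : 0 ≤ ℓ) (hf : IsNonvanishingSolution ℓ σ f)
    {y₁ y₂ : ℝ → ℂ} {d₀ d₁ : ℂ} (h₁ : IsCauchySolution ℓ σ f lam c₀ c₁ y₁)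
    (h₂ : IsCauchySolution ℓ σ f lam d₀ d₁ y₂) (α β : ℂ) :
    IsCauchySolution ℓ σ f lam (α * c₀ + β * d₀) (α * c₁ + β * d₁)
      (fun x => α * y₁ x + β * y₂ x) := by
  have hW₁ := h₁.isSolution.1
  have hW₂ := h₂.isSolution.1
  have hW := hW₁.linearComb hℓ hW₂ α β
  have hd := hW₁.add_deriv hℓ hW₂ α β
  have hfW := hf.isSolution.1
  obtain ⟨v₁, a1, a2, a3⟩ := h₁.init_deriv
  obtain ⟨v₂, b1, b2, b3⟩ := h₂.init_deriv
  refine ⟨(isWeakSolution_iff hℓ hf hW).2 fun ψ hψ => ?_, by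
    simp only [h₁.init_value, h₂.init_value], fun x => α * v₁ x + β * v₂ x,
    a1.linearComb hℓ b1 α β, ?_, by simp only [a3, b3]⟩
  · have e1 := (isWeakSolution_iff hℓ hf hW₁).1 h₁.isSolution ψ hψ
    have e2 := (isWeakSolution_iff hℓ hf hW₂).1 h₂.isSolution ψ hψ
    have i1 := MemLp.mul_two hℓ (memLp_wronskian hℓ hfW hW₁) hψ.1.2
    have i2 := MemLp.mul_two hℓ (memLp_wronskian hℓ hfW hW₂) hψ.1.2
    have hfc := hfW.continuousOn hℓ
    have j : ∀ {k : ℝ → ℂ}, MemW12 ℓ k →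
        IntervalIntegrable (fun x => f x * k x * ψ x) volume 0 ℓ := fun {k} hk => by
      refine ContinuousOn.intervalIntegrable ?_
      rw [uIcc_of_le hℓ]
      exact (hfc.mul (hk.continuousOn hℓ)).mul (hψ.1.continuousOn hℓ)
    have e3 : ∫ x in (0 : ℝ)..ℓ, f x * (α * y₁ x + β * y₂ x) * ψ x =
        α * (∫ x in (0 : ℝ)..ℓ, f x * y₁ x * ψ x) + β * ∫ x in (0 : ℝ)..ℓ, f x * y₂ x * ψ x := by
      rw [← intervalIntegral.integral_const_mul, ← intervalIntegral.integral_const_mul,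
        ← intervalIntegral.integral_add ((j hW₁).const_mul α) ((j hW₂).const_mul β)]
      congr 1
      ext x
      ring
    have e4 : ∫ x in (0 : ℝ)..ℓ, (f x * deriv (fun x => α * y₁ x + β * y₂ x) x -
        deriv f x * (α * y₁ x + β * y₂ x)) * deriv ψ x =
        α * (∫ x in (0 : ℝ)..ℓ, (f x * deriv y₁ x - deriv f x * y₁ x) * deriv ψ x) +
          β * ∫ x in (0 : ℝ)..ℓ, (f x * deriv y₂ x - deriv f x * y₂ x) * deriv ψ x := by
      rw [← intervalIntegral.integral_const_mul, ← intervalIntegral.integral_const_mul,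
        ← intervalIntegral.integral_add (i1.const_mul α) (i2.const_mul β)]
      refine integral_congr_ae_Ioo hℓ ?_
      filter_upwards [hd] with x hx
      rw [hx]
      ring
    rw [e3, e4, e1, e2]
    ring
  · filter_upwards [hd, a2, b2] with x h1 h2 h3
    rw [h2, h3, darbouxD, darbouxD, darbouxD, h1]
    ring

/-- Reduction of order: f ∫ f^{-2} solves the equation with lam = 0, and its D_f is 1/f. -/
theorem exists_isCauchySolution_zero_one (hℓ : 0 ≤ ℓ) (hf : IsNonvanishingSolution ℓ σ f) :
    ∃ y, IsCauchySolution ℓ σ f 0 0 1 y := by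
  have hfW := hf.isSolution.1
  have hfc := hfW.continuousOn hℓ
  have hf2 : ContinuousOn (fun x => (f x ^ 2)⁻¹) (Icc 0 ℓ) :=
    (hfc.pow 2).inv₀ fun x hx => pow_ne_zero 2 (hf.ne_zero x hx)
  have hL := memLp_of_continuousOn hf2
  have he : ∀ x ∈ Icc 0 ℓ, (∫ t in (0 : ℝ)..x, (f t ^ 2)⁻¹) =
    0 + ∫ t in (0 : ℝ)..x, (f t ^ 2)⁻¹ := fun x _ => by rw [zero_add]
  have hYW := memW12_of_eq_integral hℓ hL he
  refine ⟨fun x => f x * ∫ t in (0 : ℝ)..x, (f t ^ 2)⁻¹,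
    isCauchySolution_of_system hℓ hf (hfW.mul hℓ hYW) (hfW.inv hℓ hf.ne_zero) ?_ ?_ (by simp)
      (by simp [hf.normalized])⟩
  · filter_upwards [hfW.mul_deriv hℓ hYW, deriv_ae_eq_of_eq_integral hℓ
      (intervalIntegrable_of_memLp_two hℓ hL) he, ae_restrict_mem measurableSet_Ioo] with x h1 h2 hx
    have := hf.ne_zero x (Ioo_subset_Icc_self hx)
    rw [darbouxD, h1, h2]
    field_simp
    ring
  · filter_upwards [hfW.inv_deriv hℓ hf.ne_zero, ae_restrict_mem measurableSet_Ioo] with x h1 hx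
    have := hf.ne_zero x (Ioo_subset_Icc_self hx)
    rw [h1]
    field_simp
    ring

/-- Continuity at `ρ = 0` of the sine type solution. -/
theorem tendsto_sineSolution_zero (hℓ : 0 < ℓ) (hf : IsNonvanishingSolution ℓ σ f)
    {S : ℂ → ℝ → ℂ} (hS : ∀ ρ : ℂ, IsCauchySolution ℓ σ f (ρ ^ 2) 0 1 (S ρ)) {x : ℝ}
    (hx : x ∈ Icc 0 ℓ) : Tendsto (fun ρ => S ρ x) (𝓝 0) (𝓝 (S 0 x)) := by
  have hfc := hf.isSolution.1.continuousOn hℓ.le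
  have hf2 : ContinuousOn (fun x => (f x ^ 2)⁻¹) (Icc 0 ℓ) :=
    (hfc.pow 2).inv₀ fun x hx => pow_ne_zero 2 (hf.ne_zero x hx)
  obtain ⟨A, hA⟩ := isCompact_Icc.exists_bound_of_continuousOn hf2
  obtain ⟨B, hB⟩ := isCompact_Icc.exists_bound_of_continuousOn (hfc.pow 2)
  have hA0 : 0 ≤ A := (norm_nonneg _).trans (hA 0 (left_mem_Icc.2 hℓ.le))
  have hB0 : 0 ≤ B := (norm_nonneg _).trans (hB 0 (left_mem_Icc.2 hℓ.le))
  choose V hVc hSV hVS using fun ρ => (hS ρ).exists_system hℓ hf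
  have hVone : ∀ ρ M, (∀ z ∈ Icc 0 ℓ, ‖S ρ z / f z‖ ≤ M) → ∀ z ∈ Icc 0 ℓ,
      ‖V ρ z - 1‖ ≤ ‖ρ‖ ^ 2 * (B * M * ℓ) := by
    intro ρ M hM z hz
    have hM0 : 0 ≤ M := (norm_nonneg _).trans (hM z hz)
    rw [hVS ρ z hz, sub_sub_cancel_left, norm_neg, norm_mul, norm_pow]
    refine mul_le_mul_of_nonneg_left ?_ (by positivity)
    refine (intervalIntegral.norm_integral_le_of_norm_le_const (C := B * M) ?_).trans ?_
    · intro t ht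
      rw [uIoc_of_le hz.1] at ht
      have ht' : t ∈ Icc 0 ℓ := ⟨ht.1.le, ht.2.trans hz.2⟩
      have h0 := hf.ne_zero t ht'
      rw [show f t * S ρ t = f t ^ 2 * (S ρ t / f t) by field_simp, norm_mul]
      exact mul_le_mul (hB t ht') (hM t ht') (norm_nonneg _) hB0
    · rw [sub_zero, abs_of_nonneg hz.1]
      exact mul_le_mul_of_nonneg_left hz.2 (by positivity)
  have hYle : ∀ (ρ : ℂ) (D : ℝ) (c : ℂ), (∀ z ∈ Icc 0 ℓ, ‖V ρ z - c‖ ≤ D) → ∀ z ∈ Icc 0 ℓ,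
      ‖S ρ z / f z - c * ∫ t in (0 : ℝ)..z, (f t ^ 2)⁻¹‖ ≤ D * A * ℓ := by
    intro ρ D c hD z hz
    have hD0 : 0 ≤ D := (norm_nonneg _).trans (hD z hz)
    have hsub : Icc 0 z ⊆ Icc 0 ℓ := Icc_subset_Icc_right hz.2
    rw [hSV ρ z hz, zero_add, ← intervalIntegral.integral_const_mul,
      ← intervalIntegral.integral_sub]
    · refine (intervalIntegral.norm_integral_le_of_norm_le_const (C := D * A) ?_).trans ?_
      · intro t ht
        rw [uIoc_of_le hz.1] at ht
        have ht' : t ∈ Icc 0 ℓ := ⟨ht.1.le, ht.2.trans hz.2⟩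
        rw [div_eq_mul_inv, ← sub_mul, norm_mul]
        exact mul_le_mul (hD t ht') (hA t ht') (norm_nonneg _) hD0
      · rw [sub_zero, abs_of_nonneg hz.1]
        exact mul_le_mul_of_nonneg_left hz.2 (by positivity)
    · refine ContinuousOn.intervalIntegrable ?_
      rw [uIcc_of_le hz.1]
      simp only [div_eq_mul_inv]
      exact ((hVc ρ).mul hf2).mono hsub
    · refine ContinuousOn.intervalIntegrable ?_
      rw [uIcc_of_le hz.1]
      exact (continuousOn_const.mul hf2).mono hsub
  -- For such ρ the feedback of S/f on itself through V has factor below 1/2 and can be absorbed.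
  have hsmall : ∀ᶠ ρ : ℂ in 𝓝 0, ‖ρ‖ ^ 2 * (B * ℓ * (A * ℓ)) < 1 / 2 := by
    have : Tendsto (fun ρ : ℂ => ‖ρ‖ ^ 2 * (B * ℓ * (A * ℓ))) (𝓝 0) (𝓝 0) := by
      have : Continuous fun ρ : ℂ => ‖ρ‖ ^ 2 * (B * ℓ * (A * ℓ)) := by fun_prop
      simpa using this.tendsto 0
    exact this.eventually (gt_mem_nhds (by norm_num))
  have hbd : ∀ᶠ ρ : ℂ in 𝓝 0, ∀ z ∈ Icc 0 ℓ, ‖S ρ z / f z‖ ≤ 2 * (A * ℓ) := by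
    filter_upwards [hsmall] with ρ hρ
    have hc : ContinuousOn (fun z => ‖S ρ z / f z‖) (Icc 0 ℓ) :=
      (((hS ρ).isSolution.1.continuousOn hℓ.le).div hfc hf.ne_zero).norm
    obtain ⟨z₀, hz₀, hmax⟩ := isCompact_Icc.exists_isMaxOn ⟨0, left_mem_Icc.2 hℓ.le⟩ hc
    -- Since |V| ≤ 1 + |ρ|²BMℓ, the maximum satisfies M ≤ Aℓ + M/2, hence M ≤ 2Aℓ uniformly in small
    -- ρ.
    set M := ‖S ρ z₀ / f z₀‖ with hM
    have hM' : ∀ z ∈ Icc 0 ℓ, ‖S ρ z / f z‖ ≤ M := fun z hz => hmax hz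
    have h1 := hVone ρ M hM'
    have h2 := hYle ρ (1 + ‖ρ‖ ^ 2 * (B * M * ℓ)) 0 (fun z hz => by
      have := norm_add_le (V ρ z - 1) 1
      rw [sub_add_cancel, norm_one] at this
      rw [sub_zero]
      linarith [h1 z hz]) z₀ hz₀
    rw [zero_mul, sub_zero, ← hM] at h2
    have h3 : M * (‖ρ‖ ^ 2 * (B * ℓ * (A * ℓ))) ≤ M * (1 / 2) :=
      mul_le_mul_of_nonneg_left hρ.le (norm_nonneg _)
    have h4 : M ≤ 2 * (A * ℓ) := by nlinarith
    exact fun z hz => (hM' z hz).trans h4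
  have hlim : Tendsto (fun ρ : ℂ => S ρ x / f x) (𝓝 0) (𝓝 (S 0 x / f x)) := by
    -- For ρ = 0 the quasi-derivative V is identically 1, so S/f is exactly the primitive of f^{-2}.
    have h0 : S 0 x / f x = 1 * ∫ t in (0 : ℝ)..x, (f t ^ 2)⁻¹ := by
      have h1 := hYle 0 0 1 (fun z hz => by rw [hVS 0 z hz]; simp) x hx
      simpa [sub_eq_zero] using h1
    rw [h0, tendsto_iff_norm_sub_tendsto_zero]
    refine squeeze_zero' (.of_forall fun _ => norm_nonneg _)
      (g := fun ρ : ℂ => ‖ρ‖ ^ 2 * (B * (2 * (A * ℓ)) * ℓ) * A * ℓ) ?_ ?_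
    · filter_upwards [hbd] with ρ hρ
      exact hYle ρ _ 1 (hVone ρ _ hρ) x hx
    · have : Continuous fun ρ : ℂ => ‖ρ‖ ^ 2 * (B * (2 * (A * ℓ)) * ℓ) * A * ℓ := by fun_prop
      simpa using this.tendsto 0
  have := hlim.mul_const (f x)
  have h0 := hf.ne_zero x hx
  simpa [div_mul_cancel₀ _ h0] using this

end

/-! ### Legendre polynomials: Rodrigues' formula and integrals -/

theorem eval_iterate_derivative_sq_sub_one_pow {m j : ℕ} (h : j < m) {a : ℝ} (ha : a ^ 2 = 1) :
    (Polynomial.derivative^[j] ((Polynomial.X ^ 2 - 1 : Polynomial ℝ) ^ m)).eval a = 0 := by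
  obtain ⟨q, hq⟩ := Polynomial.pow_sub_dvd_iterate_derivative_pow
    (Polynomial.X ^ 2 - 1 : Polynomial ℝ) m j
  rw [hq]
  simp [ha, Nat.sub_ne_zero_of_lt h]

/-- Repeated integration by parts, with g (i + 1) the derivative of g i. Boundary terms vanish
because derivatives of (t² - 1)^m of order below m still contain the factor t² - 1. -/
theorem integral_iterate_derivative_mul {m : ℕ} {g : ℕ → ℝ → ℂ}
    (hg : ∀ i t, HasDerivAt (g i) (g (i + 1) t) t) {j : ℕ} (hj : j ≤ m) (i : ℕ) :
    ∫ t in (-1 : ℝ)..1,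
      (((Polynomial.derivative^[j] ((Polynomial.X ^ 2 - 1 : Polynomial ℝ) ^ m)).eval t : ℝ) : ℂ) *
        g i t =
    (-1) ^ j * ∫ t in (-1 : ℝ)..1, (((t ^ 2 - 1) ^ m : ℝ) : ℂ) * g (i + j) t := by
  have hgc : ∀ i, Continuous (g i) := fun i =>
    continuous_iff_continuousAt.2 fun t => (hg i t).continuousAt
  induction j generalizing i with
  | zero => simp
  | succ j ih =>
    set Q := Polynomial.derivative^[j] ((Polynomial.X ^ 2 - 1 : Polynomial ℝ) ^ m) with hQ
    have hd : ∀ t : ℝ, HasDerivAt (fun t : ℝ => ((Q.eval t : ℝ) : ℂ))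
        ((Q.derivative.eval t : ℝ) : ℂ) t := fun t => (Q.hasDerivAt t).ofReal_comp
    have h1 := intervalIntegral.integral_mul_deriv_eq_deriv_mul (a := -1) (b := 1)
      (fun t _ => hd t) (fun t _ => hg i t)
      ((Complex.continuous_ofReal.comp Q.derivative.continuous).intervalIntegrable _ _)
      ((hgc (i + 1)).intervalIntegrable _ _)
    have e1 : Q.eval 1 = 0 := eval_iterate_derivative_sq_sub_one_pow hj (by norm_num)
    have e2 : Q.eval (-1) = 0 := eval_iterate_derivative_sq_sub_one_pow hj (by norm_num)
    rw [e1, e2, ih (Nat.le_of_succ_le hj) (i + 1)] at h1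
    rw [Function.iterate_succ_apply', ← hQ, pow_succ, show i + (j + 1) = i + 1 + j by ring]
    simp only [Complex.ofReal_zero, zero_mul, sub_zero, zero_sub] at h1
    linear_combination h1

/-- Integration against a Legendre polynomial, by Rodrigues' formula. -/
theorem integral_legendreP_mul (m : ℕ) {g : ℕ → ℝ → ℂ}
    (hg : ∀ i t, HasDerivAt (g i) (g (i + 1) t) t) :
    ∫ t in (-1 : ℝ)..1, (((legendreP m).eval t : ℝ) : ℂ) * g 0 t =
      (2 ^ m * (m.factorial : ℂ))⁻¹ *
        ∫ t in (-1 : ℝ)..1, (((1 - t ^ 2) ^ m : ℝ) : ℂ) * g m t := by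
  have h := integral_iterate_derivative_mul hg (le_refl m) 0
  rw [zero_add] at h
  have e : ∀ t : ℝ, (((1 - t ^ 2) ^ m : ℝ) : ℂ) * g m t =
      (-1) ^ m * ((((t ^ 2 - 1) ^ m : ℝ) : ℂ) * g m t) := fun t => by
    push_cast
    rw [show (1 : ℂ) - t ^ 2 = -1 * (t ^ 2 - 1) by ring, mul_pow]
    ring
  simp only [e]
  rw [intervalIntegral.integral_const_mul, ← h, ← intervalIntegral.integral_const_mul]
  congr 1
  ext t
  simp only [legendreP, Polynomial.eval_mul, Polynomial.eval_C]
  push_cast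
  ring

/-- This is the Beta integral B(k + 1/2, m + 1). Splitting one factor 1 - t² gives a recursion in m
that also raises k, hence the induction for all k. -/
theorem integral_one_sub_sq_pow_mul_pow (m k : ℕ) :
    ∫ t in (-1 : ℝ)..1, (1 - t ^ 2) ^ m * t ^ (2 * k) =
      Real.Gamma (k + 1 / 2) * m.factorial / Real.Gamma (k + m + 3 / 2) := by
  induction m generalizing k with
  | zero =>
    have h0 : (0 : ℝ) < k + 1 / 2 := by positivity
    have h1 : (k : ℝ) + (0 : ℕ) + 3 / 2 = (k + 1 / 2) + 1 := by push_cast; ring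
    rw [h1, Real.Gamma_add_one h0.ne']
    simp only [pow_zero, one_mul, integral_pow, one_pow, Nat.factorial_zero, Nat.cast_one]
    have h2 := (Real.Gamma_pos_of_pos h0).ne'
    rw [Odd.neg_one_pow ⟨k, rfl⟩]
    push_cast
    field_simp
    ring
  | succ m ih =>
    have e : ∀ t : ℝ, (1 - t ^ 2) ^ (m + 1) * t ^ (2 * k) =
        (1 - t ^ 2) ^ m * t ^ (2 * k) - (1 - t ^ 2) ^ m * t ^ (2 * (k + 1)) := fun t => by ring
    simp only [e]
    rw [intervalIntegral.integral_sub, ih, ih]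
    · have h0 : (0 : ℝ) < k + 1 / 2 := by positivity
      have h1 : (0 : ℝ) < k + m + 3 / 2 := by positivity
      have a1 : ((k + 1 : ℕ) : ℝ) + 1 / 2 = (k + 1 / 2) + 1 := by push_cast; ring
      have a2 : ((k + 1 : ℕ) : ℝ) + m + 3 / 2 = (k + m + 3 / 2) + 1 := by push_cast; ring
      have a3 : (k : ℝ) + (m + 1 : ℕ) + 3 / 2 = (k + m + 3 / 2) + 1 := by push_cast; ring
      rw [a1, a2, a3, Real.Gamma_add_one h0.ne', Real.Gamma_add_one h1.ne']
      have h2 := (Real.Gamma_pos_of_pos h1).ne'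
      rw [Nat.factorial_succ]
      push_cast
      field_simp
      ring
    · exact (by fun_prop : Continuous fun t : ℝ => (1 - t ^ 2) ^ m * t ^ (2 * k)).intervalIntegrable
        _ _
    · exact (by fun_prop : Continuous fun t : ℝ =>
        (1 - t ^ 2) ^ m * t ^ (2 * (k + 1))).intervalIntegrable _ _

/-- Cancels the (2k)! of the cosine series, leaving the k! of the Bessel series; it also evaluates
the norm of P_m. -/
theorem Gamma_natCast_add_half (k : ℕ) :
    Real.Gamma (k + 1 / 2) = (2 * k).factorial * Real.sqrt Real.pi / (4 ^ k * k.factorial) := by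
  induction k with
  | zero => rw [Nat.cast_zero, zero_add, Real.Gamma_one_half_eq]; simp
  | succ k ih =>
    have h0 : (0 : ℝ) < k + 1 / 2 := by positivity
    have a1 : ((k + 1 : ℕ) : ℝ) + 1 / 2 = (k + 1 / 2) + 1 := by push_cast; ring
    rw [a1, Real.Gamma_add_one h0.ne', ih, show 2 * (k + 1) = 2 * k + 1 + 1 by ring,
      Nat.factorial_succ, Nat.factorial_succ, Nat.factorial_succ]
    push_cast
    field_simp
    ring

/-! ### Spherical Bessel functions as Fourier transforms of Legendre polynomials -/

/-- The cosine series is integrated term by term; on [-1,1] the terms are dominated by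
|z|^{2k}/(2k)!. -/
theorem hasSum_integral_one_sub_sq_pow_mul_cos (m : ℕ) (z : ℂ) :
    HasSum (fun k : ℕ => (-1) ^ k * z ^ (2 * k) / ((2 * k).factorial : ℂ) *
        ((∫ t in (-1 : ℝ)..1, (1 - t ^ 2) ^ m * t ^ (2 * k) : ℝ) : ℂ))
      (∫ t in (-1 : ℝ)..1, (((1 - t ^ 2) ^ m : ℝ) : ℂ) * Complex.cos (z * t)) := by
  have h := intervalIntegral.hasSum_integral_of_dominated_convergence (a := (-1 : ℝ)) (b := 1)
    (μ := volume)
    (F := fun (k : ℕ) (t : ℝ) => (((1 - t ^ 2) ^ m : ℝ) : ℂ) *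
      ((-1) ^ k * (z * t) ^ (2 * k) / ((2 * k).factorial : ℂ)))
    (f := fun t : ℝ => (((1 - t ^ 2) ^ m : ℝ) : ℂ) * Complex.cos (z * t))
    (fun k _ => ‖z‖ ^ (2 * k) / ((2 * k).factorial : ℝ))
    (fun k => (by fun_prop : Continuous fun t : ℝ => (((1 - t ^ 2) ^ m : ℝ) : ℂ) *
      ((-1) ^ k * (z * t) ^ (2 * k) / ((2 * k).factorial : ℂ))).aestronglyMeasurable)
    (fun k => .of_forall fun t ht => by
      rw [uIoc_of_le (by norm_num)] at ht
      have h1 : |t| ≤ 1 := abs_le.2 ⟨ht.1.le, ht.2⟩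
      have h2 : t ^ 2 ≤ 1 := (sq_le_one_iff_abs_le_one t).2 h1
      have h3 : |(1 - t ^ 2) ^ m| ≤ 1 := by
        rw [abs_pow]
        refine pow_le_one₀ (abs_nonneg _) (abs_le.2 ⟨by linarith, by nlinarith [sq_nonneg t]⟩)
      rw [norm_mul, norm_div, norm_mul, norm_pow, norm_neg, norm_one, one_pow, one_mul, norm_pow,
        norm_mul, Complex.norm_natCast, Complex.norm_real, Complex.norm_real, Real.norm_eq_abs,
        Real.norm_eq_abs]
      calc _ ≤ 1 * ((‖z‖ * 1) ^ (2 * k) / ((2 * k).factorial : ℝ)) := by gcongr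
        _ = _ := by rw [one_mul, mul_one])
    (.of_forall fun t _ => (Real.summable_pow_div_factorial ‖z‖).comp_injective
      (mul_right_injective₀ (two_ne_zero : (2 : ℕ) ≠ 0)))
    intervalIntegrable_const
    (.of_forall fun t _ => (Complex.hasSum_cos (z * t)).mul_left _)
  refine (congrArg (fun F => HasSum F _) (funext fun k => ?_)).mpr h
  rw [← intervalIntegral.integral_ofReal, ← intervalIntegral.integral_const_mul]
  congr 1
  ext t
  push_cast
  ring

/-- The weight is even, so t ↦ -t removes the odd part of the exponential. -/
theorem integral_one_sub_sq_pow_mul_exp (m : ℕ) (z : ℂ) :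
    ∫ t in (-1 : ℝ)..1, (((1 - t ^ 2) ^ m : ℝ) : ℂ) * Complex.exp (Complex.I * z * t) =
      ∫ t in (-1 : ℝ)..1, (((1 - t ^ 2) ^ m : ℝ) : ℂ) * Complex.cos (z * t) := by
  set W : ℝ → ℂ := fun t => (((1 - t ^ 2) ^ m : ℝ) : ℂ) with hW
  have hWn : ∀ t, W (-t) = W t := fun t => by rw [hW]; simp
  have h1 : ∫ t in (-1 : ℝ)..1, W t * Complex.exp (Complex.I * z * t) =
      ∫ t in (-1 : ℝ)..1, W t * Complex.exp (-(Complex.I * z * t)) := by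
    have := intervalIntegral.integral_comp_neg (a := (-1 : ℝ)) (b := 1)
      (fun t : ℝ => W t * Complex.exp (Complex.I * z * t))
    rw [neg_neg] at this
    rw [← this]
    congr 1
    ext t
    rw [hWn, Complex.ofReal_neg, mul_neg]
  have hWc : Continuous W := by rw [hW]; fun_prop
  have h2 : ∫ t in (-1 : ℝ)..1, W t * Complex.cos (z * t) =
      ((∫ t in (-1 : ℝ)..1, W t * Complex.exp (Complex.I * z * t)) +
        ∫ t in (-1 : ℝ)..1, W t * Complex.exp (-(Complex.I * z * t))) / 2 := by
    rw [← intervalIntegral.integral_add, ← intervalIntegral.integral_div]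
    · congr 1
      ext t
      rw [Complex.cos, show z * t * Complex.I = Complex.I * z * t by ring,
        show -(z * t) * Complex.I = -(Complex.I * z * t) by ring]
      ring
    · exact (by fun_prop : Continuous fun t : ℝ => W t * Complex.exp (Complex.I * z * t)
        ).intervalIntegrable _ _
    · exact (by fun_prop : Continuous fun t : ℝ => W t * Complex.exp (-(Complex.I * z * t))
        ).intervalIntegrable _ _
  rw [h2, ← h1]
  ring

/-- `∫_{-1}^1 P_m(t) e^{izt} dt = 2 i^m j_m(z)`. -/
theorem integral_legendreP_mul_exp (m : ℕ) (z : ℂ) :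
    ∫ t in (-1 : ℝ)..1, (((legendreP m).eval t : ℝ) : ℂ) * Complex.exp (Complex.I * z * t) =
      2 * Complex.I ^ m * sphericalBesselJ m z := by
  have h := integral_legendreP_mul m
    (g := fun i t => (Complex.I * z) ^ i * Complex.exp (Complex.I * z * t)) (fun i t => by
      have h1 : HasDerivAt (fun t : ℝ => Complex.I * z * (t : ℂ)) (Complex.I * z) t := by
        simpa using (Complex.ofRealCLM.hasDerivAt (x := t)).const_mul (Complex.I * z)
      have h2 := (h1.cexp).const_mul ((Complex.I * z) ^ i)
      rwa [← mul_assoc, mul_right_comm, ← pow_succ] at h2)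
  simp only [pow_zero, one_mul] at h
  have e : ∀ t : ℝ, (((1 - t ^ 2) ^ m : ℝ) : ℂ) * ((Complex.I * z) ^ m *
      Complex.exp (Complex.I * z * t)) = (Complex.I * z) ^ m * ((((1 - t ^ 2) ^ m : ℝ) : ℂ) *
      Complex.exp (Complex.I * z * t)) := fun t => by ring
  simp only [e] at h
  -- Rodrigues' formula has produced the factor (iz)^m. What remains is a series of Beta integrals,
  -- to be matched term by term with the power series of j_m.
  rw [h, intervalIntegral.integral_const_mul, integral_one_sub_sq_pow_mul_exp,
    ← (hasSum_integral_one_sub_sq_pow_mul_cos m z).tsum_eq, sphericalBesselJ, ← tsum_mul_left,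
    ← tsum_mul_left, ← tsum_mul_left, ← tsum_mul_left]
  congr 1
  ext k
  have hG : Complex.Gamma (k + m + 3 / 2) = ((Real.Gamma (k + m + 3 / 2) : ℝ) : ℂ) := by
    rw [← Complex.Gamma_ofReal]; push_cast; rfl
  have hG0 : ((Real.Gamma (k + m + 3 / 2) : ℝ) : ℂ) ≠ 0 := by
    exact_mod_cast (Real.Gamma_pos_of_pos (by positivity)).ne'
  rw [integral_one_sub_sq_pow_mul_pow, hG, Gamma_natCast_add_half]
  push_cast
  have f1 : ((2 * k).factorial : ℂ) ≠ 0 := by exact_mod_cast Nat.factorial_ne_zero _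
  have f2 : (k.factorial : ℂ) ≠ 0 := by exact_mod_cast Nat.factorial_ne_zero _
  have f3 : (m.factorial : ℂ) ≠ 0 := by exact_mod_cast Nat.factorial_ne_zero _
  rw [div_pow, pow_add 2, pow_mul 2, show (2 : ℂ) ^ 2 = 4 by norm_num]
  field_simp
  ring

theorem sphericalBesselJ_neg (m : ℕ) (z : ℂ) :
    sphericalBesselJ m (-z) = (-1) ^ m * sphericalBesselJ m z := by
  unfold sphericalBesselJ
  rw [← tsum_mul_left, ← tsum_mul_left, ← tsum_mul_left]
  congr 1
  ext k
  rw [neg_div, neg_pow (z / 2), pow_add (-1 : ℂ), pow_mul (-1 : ℂ)]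
  ring

theorem integral_legendreP_scaled (m : ℕ) {x : ℝ} (hx : 0 < x) (g : ℝ → ℂ) :
    ∫ t in (-x)..x, (((legendreP m).eval (t / x) : ℝ) : ℂ) * g t =
      x * ∫ t in (-1 : ℝ)..1, (((legendreP m).eval t : ℝ) : ℂ) * g (x * t) := by
  have h := intervalIntegral.smul_integral_comp_mul_left (a := (-1 : ℝ)) (b := 1)
    (fun t : ℝ => (((legendreP m).eval (t / x) : ℝ) : ℂ) * g t) x
  rw [mul_neg_one, mul_one] at h
  rw [← h, Complex.real_smul]
  congr 2
  ext t
  rw [mul_div_cancel_left₀ _ hx.ne']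

theorem integral_legendreP_scaled_mul_exp (m : ℕ) {x : ℝ} (hx : 0 < x) (ρ : ℂ) :
    ∫ t in (-x)..x, (((legendreP m).eval (t / x) : ℝ) : ℂ) * Complex.exp (Complex.I * ρ * t) =
      x * (2 * Complex.I ^ m * sphericalBesselJ m (ρ * x)) := by
  rw [integral_legendreP_scaled m hx (fun t => Complex.exp (Complex.I * ρ * t)),
    ← integral_legendreP_mul_exp]
  congr 2
  ext t
  push_cast
  ring_nf

theorem continuous_legendreP_scaled (m : ℕ) (x : ℝ) :
    Continuous fun t : ℝ => (((legendreP m).eval (t / x) : ℝ) : ℂ) :=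
  Complex.continuous_ofReal.comp ((legendreP m).continuous.comp (continuous_id.div_const x))

/-- Average of the exponential formula at ρ and -ρ; since j_m has the parity of m, odd degrees
contribute nothing. The sine formula is the antisymmetric counterpart. -/
theorem integral_legendreP_scaled_mul_cos (m : ℕ) {x : ℝ} (hx : 0 < x) (ρ : ℂ) :
    ∫ t in (-x)..x, (((legendreP m).eval (t / x) : ℝ) : ℂ) * Complex.cos (ρ * t) =
      x * (Complex.I ^ m * (1 + (-1) ^ m) * sphericalBesselJ m (ρ * x)) := by
  have h1 := integral_legendreP_scaled_mul_exp m hx ρ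
  have h2 := integral_legendreP_scaled_mul_exp m hx (-ρ)
  rw [neg_mul ρ, sphericalBesselJ_neg] at h2
  have hc := continuous_legendreP_scaled m x
  have h3 := intervalIntegral.integral_add (a := -x) (b := x) (μ := volume)
    ((by fun_prop : Continuous fun t : ℝ => (((legendreP m).eval (t / x) : ℝ) : ℂ) *
      Complex.exp (Complex.I * ρ * t)).intervalIntegrable _ _)
    ((by fun_prop : Continuous fun t : ℝ => (((legendreP m).eval (t / x) : ℝ) : ℂ) *
      Complex.exp (Complex.I * -ρ * t)).intervalIntegrable _ _)
  rw [h1, h2] at h3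
  have h4 : ∀ t : ℝ, (((legendreP m).eval (t / x) : ℝ) : ℂ) * Complex.cos (ρ * t) = 2⁻¹ *
      ((((legendreP m).eval (t / x) : ℝ) : ℂ) * Complex.exp (Complex.I * ρ * t) +
        (((legendreP m).eval (t / x) : ℝ) : ℂ) * Complex.exp (Complex.I * -ρ * t)) := fun t => by
    rw [Complex.cos, show ρ * t * Complex.I = Complex.I * ρ * t by ring,
      show -(ρ * t) * Complex.I = Complex.I * -ρ * t by ring]
    ring
  simp only [h4]
  rw [intervalIntegral.integral_const_mul, h3]
  ring

theorem integral_legendreP_scaled_mul_sin (m : ℕ) {x : ℝ} (hx : 0 < x) (ρ : ℂ) :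
    ∫ t in (-x)..x, (((legendreP m).eval (t / x) : ℝ) : ℂ) * Complex.sin (ρ * t) =
      x * (-Complex.I * Complex.I ^ m * (1 - (-1) ^ m) * sphericalBesselJ m (ρ * x)) := by
  have h1 := integral_legendreP_scaled_mul_exp m hx ρ
  have h2 := integral_legendreP_scaled_mul_exp m hx (-ρ)
  rw [neg_mul ρ, sphericalBesselJ_neg] at h2
  have hc := continuous_legendreP_scaled m x
  have h3 := intervalIntegral.integral_sub (a := -x) (b := x) (μ := volume)
    ((by fun_prop : Continuous fun t : ℝ => (((legendreP m).eval (t / x) : ℝ) : ℂ) *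
      Complex.exp (Complex.I * ρ * t)).intervalIntegrable _ _)
    ((by fun_prop : Continuous fun t : ℝ => (((legendreP m).eval (t / x) : ℝ) : ℂ) *
      Complex.exp (Complex.I * -ρ * t)).intervalIntegrable _ _)
  rw [h1, h2] at h3
  have h4 : ∀ t : ℝ, (((legendreP m).eval (t / x) : ℝ) : ℂ) * Complex.sin (ρ * t) =
      -(Complex.I / 2) *
      ((((legendreP m).eval (t / x) : ℝ) : ℂ) * Complex.exp (Complex.I * ρ * t) -
        (((legendreP m).eval (t / x) : ℝ) : ℂ) * Complex.exp (Complex.I * -ρ * t)) := fun t => by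
    rw [Complex.sin, show ρ * t * Complex.I = Complex.I * ρ * t by ring,
      show -(ρ * t) * Complex.I = Complex.I * -ρ * t by ring]
    ring
  simp only [h4]
  rw [intervalIntegral.integral_const_mul, h3]
  ring

/-! ### Degrees, orthogonality and completeness of the Legendre polynomials -/

theorem natDegree_legendreP_le (m : ℕ) : (legendreP m).natDegree ≤ m := by
  refine (Polynomial.natDegree_C_mul_le _ _).trans
    ((Polynomial.natDegree_iterate_derivative _ _).trans ?_)
  have : ((Polynomial.X ^ 2 - 1 : Polynomial ℝ) ^ m).natDegree ≤ m * 2 :=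
    Polynomial.natDegree_pow_le_of_le m (by
      rw [show (1 : Polynomial ℝ) = Polynomial.C 1 by simp, Polynomial.natDegree_X_pow_sub_C])
  omega

theorem coeff_legendreP_self (m : ℕ) :
    (legendreP m).coeff m = (2 * m).factorial / (2 ^ m * (m.factorial : ℝ) ^ 2) := by
  have h1 : ((Polynomial.X ^ 2 - 1 : Polynomial ℝ) ^ m).coeff (m + m) = 1 := by
    have hm : (Polynomial.X ^ 2 - 1 : Polynomial ℝ).Monic := by
      rw [show (1 : Polynomial ℝ) = Polynomial.C 1 by simp]
      exact Polynomial.monic_X_pow_sub_C 1 two_ne_zero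
    have hd : ((Polynomial.X ^ 2 - 1 : Polynomial ℝ) ^ m).natDegree = m + m := by
      rw [hm.natDegree_pow, show (1 : Polynomial ℝ) = Polynomial.C 1 by simp,
        Polynomial.natDegree_X_pow_sub_C]
      ring
    have := (hm.pow m).coeff_natDegree
    rwa [hd] at this
  rw [legendreP, Polynomial.coeff_C_mul, Polynomial.coeff_iterate_derivative, h1, ← two_mul,
    nsmul_eq_mul, mul_one, Nat.descFactorial_eq_div (by omega), show 2 * m - m = m by omega,
    Nat.cast_div (Nat.factorial_dvd_factorial (by omega)) (by positivity)]
  field_simp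

theorem natDegree_legendreP (m : ℕ) : (legendreP m).natDegree = m := by
  refine le_antisymm (natDegree_legendreP_le m) (Polynomial.le_natDegree_of_ne_zero ?_)
  rw [coeff_legendreP_self]
  positivity

theorem legendreP_ne_zero (m : ℕ) : legendreP m ≠ 0 := fun h => by
  have := coeff_legendreP_self m
  rw [h, Polynomial.coeff_zero] at this
  have h2 : (0 : ℝ) < (2 * m).factorial / (2 ^ m * (m.factorial : ℝ) ^ 2) := by positivity
  linarith

/-- One polynomial of each exact degree, with invertible leading coefficient, spans all polynomials.
-/
theorem span_range_legendreP : Submodule.span ℝ (Set.range legendreP) = ⊤ := by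
  let S : Polynomial.Sequence ℝ := ⟨legendreP, fun i => by
    rw [Polynomial.degree_eq_natDegree (legendreP_ne_zero i), natDegree_legendreP]⟩
  exact S.span fun i => (Polynomial.leadingCoeff_ne_zero.2 (S.ne_zero i)).isUnit

theorem integral_legendreP_mul_polynomial (m : ℕ) (Q : Polynomial ℝ) :
    ∫ t in (-1 : ℝ)..1, (((legendreP m).eval t : ℝ) : ℂ) * (Q.eval t : ℝ) =
      (2 ^ m * (m.factorial : ℂ))⁻¹ * ∫ t in (-1 : ℝ)..1, (((1 - t ^ 2) ^ m : ℝ) : ℂ) *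
        ((Polynomial.derivative^[m] Q).eval t : ℝ) :=
  integral_legendreP_mul m (g := fun i t => ((Polynomial.derivative^[i] Q).eval t : ℝ))
    fun i t => by
      rw [Function.iterate_succ_apply']
      exact ((Polynomial.derivative^[i] Q).hasDerivAt t).ofReal_comp

theorem integral_legendreP_mul_legendreP_of_lt {m n : ℕ} (h : n < m) :
    ∫ t in (-1 : ℝ)..1, (((legendreP m).eval t : ℝ) : ℂ) * ((legendreP n).eval t : ℝ) = 0 := by
  rw [integral_legendreP_mul_polynomial, Polynomial.iterate_derivative_eq_zero
    (by rw [natDegree_legendreP]; exact h)]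
  simp

/-- The m-th derivative of P_m is the constant m! times its leading coefficient, so Rodrigues'
formula reduces the norm to a Beta integral. -/
theorem integral_legendreP_mul_self (m : ℕ) :
    ∫ t in (-1 : ℝ)..1, (((legendreP m).eval t : ℝ) : ℂ) * ((legendreP m).eval t : ℝ) =
      2 / (2 * m + 1) := by
  have h1 : Polynomial.derivative^[m] (legendreP m) =
      Polynomial.C (m.factorial * (legendreP m).coeff m) := by
    have hd := Polynomial.natDegree_iterate_derivative (legendreP m) m
    rw [natDegree_legendreP, Nat.sub_self] at hd
    rw [Polynomial.eq_C_of_natDegree_le_zero hd, Polynomial.coeff_iterate_derivative, zero_add,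
      Nat.descFactorial_self, nsmul_eq_mul]
  have h2 := integral_one_sub_sq_pow_mul_pow m 0
  simp only [mul_zero, pow_zero, mul_one, Nat.cast_zero, zero_add] at h2
  have h0 : (0 : ℝ) < m + 1 / 2 := by positivity
  rw [Real.Gamma_one_half_eq, show (m : ℝ) + 3 / 2 = (m + 1 / 2) + 1 by ring,
    Real.Gamma_add_one h0.ne', Gamma_natCast_add_half] at h2
  rw [integral_legendreP_mul_polynomial, h1]
  simp only [Polynomial.eval_C]
  rw [intervalIntegral.integral_mul_const, intervalIntegral.integral_ofReal, h2,
    coeff_legendreP_self]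
  have hpi : Real.sqrt Real.pi ≠ 0 := (Real.sqrt_pos.2 Real.pi_pos).ne'
  have key : (2 ^ m * (m.factorial : ℝ))⁻¹ * (√Real.pi * m.factorial / ((m + 1 / 2) *
      ((2 * m).factorial * √Real.pi / (4 ^ m * m.factorial))) *
      (m.factorial * ((2 * m).factorial / (2 ^ m * (m.factorial : ℝ) ^ 2)))) = 2 / (2 * m + 1) := by
    rw [show (4 : ℝ) ^ m = 2 ^ m * 2 ^ m by rw [← mul_pow]; norm_num]
    field_simp
  have key' := congrArg (fun r : ℝ => (r : ℂ)) key
  push_cast at key' ⊢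
  exact key'

/-! ### Fourier-Legendre series in `L²(-x,x)` -/

section

variable {x : ℝ}

theorem natCast_add_half_ne_zero (m : ℕ) : (m : ℂ) + 1 / 2 ≠ 0 := by
  intro h
  have h2 := congrArg Complex.re h
  simp at h2
  have : (0 : ℝ) < m + 2⁻¹ := by positivity
  linarith

theorem natCast_mul_two_add_one_ne_zero (m : ℕ) : (m : ℂ) * 2 + 1 ≠ 0 := by
  exact_mod_cast Nat.succ_ne_zero (m * 2)

theorem memLp_symm_of_continuous {h : ℝ → ℂ} (hh : Continuous h) (x : ℝ) :
    MemLp h 2 (volume.restrict (Ioo (-x) x)) := by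
  have hfin : IsFiniteMeasure (volume.restrict (Ioo (-x) x)) := ⟨by simp [Real.volume_Ioo]⟩
  obtain ⟨C, hC⟩ := isCompact_Icc.exists_bound_of_continuousOn (s := Icc (-x) x) hh.continuousOn
  refine MemLp.of_bound hh.aestronglyMeasurable C ?_
  filter_upwards [ae_restrict_mem measurableSet_Ioo] with t ht
  exact hC t (Ioo_subset_Icc_self ht)

theorem integral_symm_eq (hx : 0 ≤ x) {E : Type*} [NormedAddCommGroup E] [NormedSpace ℝ E]
    (g : ℝ → E) : ∫ t in (-x)..x, g t = ∫ t in Ioo (-x) x, g t := by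
  rw [intervalIntegral.integral_of_le (by linarith), integral_Ioc_eq_integral_Ioo]

/-- The normalized Legendre polynomials on `(-x,x)`. -/
noncomputable def normalizedLegendre (x : ℝ) (m : ℕ) (t : ℝ) : ℂ :=
  (Real.sqrt ((m + 1 / 2) / x) : ℂ) * (((legendreP m).eval (t / x) : ℝ) : ℂ)

theorem continuous_normalizedLegendre (x : ℝ) (m : ℕ) : Continuous (normalizedLegendre x m) :=
  continuous_const.mul (continuous_legendreP_scaled m x)

theorem conj_normalizedLegendre (x : ℝ) (m : ℕ) (t : ℝ) :
    (starRingEnd ℂ) (normalizedLegendre x m t) = normalizedLegendre x m t := by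
  simp [normalizedLegendre]

noncomputable def legendreL2 (x : ℝ) (m : ℕ) : Lp ℂ 2 (volume.restrict (Ioo (-x) x)) :=
  (memLp_symm_of_continuous (continuous_normalizedLegendre x m) x).toLp

theorem inner_toLp_toLp {g h : ℝ → ℂ} (hg : MemLp g 2 (volume.restrict (Ioo (-x) x)))
    (hh : MemLp h 2 (volume.restrict (Ioo (-x) x))) :
    inner ℂ hg.toLp hh.toLp = ∫ t in Ioo (-x) x, (starRingEnd ℂ) (g t) * h t := by
  rw [L2.inner_def]
  refine integral_congr_ae ?_
  filter_upwards [hg.coeFn_toLp, hh.coeFn_toLp] with t h1 h2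
  rw [h1, h2, RCLike.inner_apply, mul_comm]

theorem sqrt_mul_sqrt_normalization (hx : 0 < x) (m : ℕ) :
    (Real.sqrt ((m + 1 / 2) / x) : ℂ) * Real.sqrt ((m + 1 / 2) / x) = (m + 1 / 2) / x := by
  rw [← Complex.ofReal_mul, Real.mul_self_sqrt (by positivity)]
  push_cast
  rfl

theorem orthonormal_legendreL2 (hx : 0 < x) : Orthonormal ℂ (legendreL2 x) := by
  have key : ∀ m n, inner ℂ (legendreL2 x m) (legendreL2 x n) =
      (Real.sqrt ((m + 1 / 2) / x) : ℂ) * Real.sqrt ((n + 1 / 2) / x) * (x *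
        ∫ t in (-1 : ℝ)..1, (((legendreP m).eval t : ℝ) : ℂ) * ((legendreP n).eval t : ℝ)) := by
    intro m n
    rw [legendreL2, legendreL2, inner_toLp_toLp, ← integral_symm_eq hx.le]
    have h1 := integral_legendreP_scaled m hx (fun t => (((legendreP n).eval (t / x) : ℝ) : ℂ))
    simp only [mul_div_cancel_left₀ _ hx.ne'] at h1
    rw [← h1, ← intervalIntegral.integral_const_mul]
    congr 1
    ext t
    rw [conj_normalizedLegendre, normalizedLegendre, normalizedLegendre]
    ring
  have hxc : (x : ℂ) ≠ 0 := by exact_mod_cast hx.ne'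
  rw [orthonormal_iff_ite]
  intro m n
  rw [key]
  split_ifs with h
  · subst h
    rw [sqrt_mul_sqrt_normalization hx, integral_legendreP_mul_self]
    have h1 := natCast_mul_two_add_one_ne_zero m
    have h2 : 2 * (m : ℂ) + 1 ≠ 0 := by rwa [mul_comm]
    field_simp
  · rcases lt_or_gt_of_ne h with h | h
    · have h2 := integral_legendreP_mul_legendreP_of_lt h
      simp only [mul_comm (((legendreP n).eval _ : ℝ) : ℂ)] at h2
      rw [h2]
      ring
    · rw [integral_legendreP_mul_legendreP_of_lt h]
      ring

theorem integral_polynomial_mul_eq_zero {g : ℝ → ℂ}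
    (hg : MemLp g 2 (volume.restrict (Ioo (-x) x)))
    (h : ∀ m, ∫ t in Ioo (-x) x, (((legendreP m).eval (t / x) : ℝ) : ℂ) * g t = 0)
    (Q : Polynomial ℝ) : ∫ t in Ioo (-x) x, ((Q.eval (t / x) : ℝ) : ℂ) * g t = 0 := by
  have hi : ∀ Q : Polynomial ℝ, Integrable (fun t => ((Q.eval (t / x) : ℝ) : ℂ) * g t)
      (volume.restrict (Ioo (-x) x)) := fun Q =>
    (memLp_symm_of_continuous (Complex.continuous_ofReal.comp
      (Q.continuous.comp (continuous_id.div_const x))) x).integrable_mul hg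
  have hQ : Q ∈ Submodule.span ℝ (Set.range legendreP) := by
    rw [span_range_legendreP]; trivial
  induction hQ using Submodule.span_induction with
  | mem q hq => obtain ⟨m, rfl⟩ := hq; exact h m
  | zero => simp
  | add p q _ _ hp hq =>
    simp only [Polynomial.eval_add, Complex.ofReal_add, add_mul]
    rw [integral_add (hi p) (hi q), hp, hq, add_zero]
  | smul c q _ hq =>
    simp only [Polynomial.eval_smul, smul_eq_mul, Complex.ofReal_mul, mul_assoc]
    rw [integral_const_mul, hq, mul_zero]

/-- All polynomial moments of g vanish, and by Weierstrass approximation so do its integrals against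
smooth compactly supported functions. -/
theorem ae_eq_zero_of_integral_legendreP_eq_zero (hx : 0 < x) {g : ℝ → ℂ}
    (hg : MemLp g 2 (volume.restrict (Ioo (-x) x)))
    (h : ∀ m, ∫ t in Ioo (-x) x, (((legendreP m).eval (t / x) : ℝ) : ℂ) * g t = 0) :
    g =ᵐ[volume.restrict (Ioo (-x) x)] 0 := by
  have hfin : IsFiniteMeasure (volume.restrict (Ioo (-x) x)) := ⟨by simp [Real.volume_Ioo]⟩
  have hgi : Integrable g (volume.restrict (Ioo (-x) x)) := hg.integrable (by norm_num)
  have h1 := (isOpen_Ioo (a := -x) (b := x)).ae_eq_zero_of_integral_contDiff_smul_eq_zero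
    (f := g) (μ := volume) (IntegrableOn.locallyIntegrableOn hgi) (by
      intro φ hφ _ hsupp
      have hφc := hφ.continuous
      have e0 : ∫ t, φ t • g t = ∫ t in Ioo (-x) x, φ t • g t := by
        rw [setIntegral_eq_integral_of_forall_compl_eq_zero]
        intro t ht
        rw [image_eq_zero_of_notMem_tsupport (fun h => ht (hsupp h)), zero_smul]
      rw [e0, ← norm_le_zero_iff]
      have hI : 0 ≤ ∫ t in Ioo (-x) x, ‖g t‖ := integral_nonneg fun _ => norm_nonneg _
      refine le_of_forall_pos_le_add fun ε hε => ?_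
      -- The summand 1 keeps the denominator positive when g vanishes.
      set δ := ε / ((∫ t in Ioo (-x) x, ‖g t‖) + 1) with hδ
      have hδ0 : 0 < δ := by positivity
      obtain ⟨p, hp⟩ := exists_polynomial_near_of_continuousOn (-1) 1 (fun s => φ (x * s))
        (by fun_prop) δ hδ0
      have hz := integral_polynomial_mul_eq_zero hg h p
      have i1 : Integrable (fun t => φ t • g t) (volume.restrict (Ioo (-x) x)) := by
        simp only [Complex.real_smul]
        exact (memLp_symm_of_continuous (Complex.continuous_ofReal.comp hφc) x).integrable_mul hg
      have i2 : Integrable (fun t => ((p.eval (t / x) : ℝ) : ℂ) * g t)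
          (volume.restrict (Ioo (-x) x)) :=
        (memLp_symm_of_continuous (Complex.continuous_ofReal.comp
          (p.continuous.comp (continuous_id.div_const x))) x).integrable_mul hg
      calc ‖∫ t in Ioo (-x) x, φ t • g t‖
          = ‖∫ t in Ioo (-x) x, (φ t • g t - ((p.eval (t / x) : ℝ) : ℂ) * g t)‖ := by
            rw [integral_sub i1 i2, hz, sub_zero]
        _ ≤ ∫ t in Ioo (-x) x, δ * ‖g t‖ := by
            refine norm_integral_le_of_norm_le (hgi.norm.const_mul δ) ?_
            filter_upwards [ae_restrict_mem measurableSet_Ioo] with t ht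
            have ht' : t / x ∈ Icc (-1 : ℝ) 1 := by
              rw [mem_Icc, le_div_iff₀ hx, div_le_iff₀ hx]
              exact ⟨by linarith [ht.1], by linarith [ht.2]⟩
            have := hp _ ht'
            rw [mul_div_cancel₀ _ hx.ne', abs_sub_comm] at this
            rw [Complex.real_smul, ← sub_mul, norm_mul, ← Complex.ofReal_sub, Complex.norm_real,
              Real.norm_eq_abs]
            exact mul_le_mul_of_nonneg_right this.le (norm_nonneg _)
        _ = δ * ∫ t in Ioo (-x) x, ‖g t‖ := integral_const_mul _ _
        _ ≤ 0 + ε := by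
            rw [zero_add, hδ, div_mul_eq_mul_div, div_le_iff₀ (by positivity)]
            nlinarith)
  rw [EventuallyEq, ae_restrict_iff' measurableSet_Ioo]
  exact h1

noncomputable def legendreBasis (hx : 0 < x) :
    HilbertBasis ℕ ℂ (Lp ℂ 2 (volume.restrict (Ioo (-x) x))) :=
  HilbertBasis.mkOfOrthogonalEqBot (orthonormal_legendreL2 hx) (by
    rw [Submodule.eq_bot_iff]
    intro Y hY
    have hYL := Lp.memLp Y
    refine Lp.ext ((ae_eq_zero_of_integral_legendreP_eq_zero hx hYL fun m => ?_).trans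
      (Lp.coeFn_zero _ _ _).symm)
    have h1 := Submodule.inner_right_of_mem_orthogonal
      (Submodule.subset_span (mem_range_self m)) hY
    rw [← Lp.toLp_coeFn Y hYL, legendreL2, inner_toLp_toLp] at h1
    simp only [conj_normalizedLegendre] at h1
    simp only [normalizedLegendre, mul_assoc] at h1
    rw [integral_const_mul] at h1
    refine (mul_eq_zero.1 h1).resolve_left ?_
    have : 0 < Real.sqrt ((m + 1 / 2) / x) := Real.sqrt_pos.2 (by positivity)
    exact_mod_cast this.ne')

theorem legendreBasis_apply (hx : 0 < x) (m : ℕ) : legendreBasis hx m = legendreL2 x m := by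
  rw [legendreBasis, HilbertBasis.coe_mkOfOrthogonalEqBot]

variable {K : ℝ → ℝ → ℂ}

theorem inner_legendreL2_toLp (hx : 0 < x) (hK : MemLp (K x) 2 (volume.restrict (Ioo (-x) x)))
    (m : ℕ) : inner ℂ (legendreL2 x m) hK.toLp =
      (Real.sqrt ((m + 1 / 2) / x) : ℂ) * (legendreCoeff K m x / (m + 1 / 2)) := by
  have h0 : (m : ℂ) + 1 / 2 ≠ 0 := natCast_add_half_ne_zero m
  rw [legendreL2, inner_toLp_toLp, legendreCoeff, mul_div_cancel_left₀ _ h0,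
    integral_symm_eq hx.le, ← integral_const_mul]
  congr 1
  ext t
  rw [conj_normalizedLegendre, normalizedLegendre]
  ring

/-- Parseval's identity for K(x,·) against conj h. The two normalising square roots multiply to (m +
1/2)/x, which turns the orthonormal coefficients into a_m(x)/x. -/
theorem hasSum_legendreCoeff_mul_integral (hx : 0 < x)
    (hK : MemLp (K x) 2 (volume.restrict (Ioo (-x) x))) {h : ℝ → ℂ} (hh : Continuous h) :
    HasSum (fun m : ℕ => legendreCoeff K m x / x *
        ∫ t in (-x)..x, (((legendreP m).eval (t / x) : ℝ) : ℂ) * h t)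
      (∫ t in (-x)..x, K x t * h t) := by
  have hL := memLp_symm_of_continuous (Complex.continuous_conj.comp hh) x
  have h1 := (legendreBasis hx).hasSum_inner_mul_inner hL.toLp hK.toLp
  simp only [legendreBasis_apply, inner_legendreL2_toLp hx hK] at h1
  rw [inner_toLp_toLp] at h1
  have e1 : ∫ t in Ioo (-x) x, (starRingEnd ℂ) ((⇑(starRingEnd ℂ) ∘ h) t) * K x t =
      ∫ t in (-x)..x, K x t * h t := by
    rw [integral_symm_eq hx.le]
    congr 1
    ext t
    simp only [Function.comp_apply, Complex.conj_conj]
    ring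
  rw [e1] at h1
  refine (congrArg (fun F => HasSum F _) (funext fun m => ?_)).mpr h1
  have h0 := natCast_add_half_ne_zero m
  rw [legendreL2, inner_toLp_toLp]
  simp only [Function.comp_apply, Complex.conj_conj, normalizedLegendre]
  have e : ∀ t : ℝ, h t * ((Real.sqrt ((m + 1 / 2) / x) : ℂ) *
      (((legendreP m).eval (t / x) : ℝ) : ℂ)) = (Real.sqrt ((m + 1 / 2) / x) : ℂ) *
      ((((legendreP m).eval (t / x) : ℝ) : ℂ) * h t) := fun t => by ring
  simp only [e]
  rw [integral_const_mul, ← integral_symm_eq hx.le]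
  have hxc : (x : ℂ) ≠ 0 := by exact_mod_cast hx.ne'
  have hs := sqrt_mul_sqrt_normalization hx m
  calc _ = ((m + 1 / 2) / x : ℂ) * (legendreCoeff K m x / (m + 1 / 2)) *
        ∫ t in (-x)..x, (((legendreP m).eval (t / x) : ℝ) : ℂ) * h t := by
        rw [div_mul_div_comm, mul_comm ((m : ℂ) + 1 / 2), mul_div_mul_right _ _ h0]
    _ = _ := by rw [← hs]; ring

theorem continuous_kernelPartial (K : ℝ → ℝ → ℂ) (N : ℕ) (x : ℝ) :
    Continuous (kernelPartial K N x) := by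
  unfold kernelPartial
  exact continuous_finsetSum _ fun m _ => continuous_const.mul (continuous_legendreP_scaled m x)

theorem memLp_sub_kernelPartial (hK : MemLp (K x) 2 (volume.restrict (Ioo (-x) x))) (N : ℕ) :
    MemLp (fun t => K x t - kernelPartial K N x t) 2 (volume.restrict (Ioo (-x) x)) :=
  hK.sub (memLp_symm_of_continuous (continuous_kernelPartial K N x) x)

theorem norm_toLp_eq_sqrt {g : ℝ → ℂ} (hg : MemLp g 2 (volume.restrict (Ioo (-x) x))) :
    ‖hg.toLp‖ = Real.sqrt (∫ t in Ioo (-x) x, ‖g t‖ ^ 2) := by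
  rw [Lp.norm_toLp, hg.eLpNorm_eq_integral_rpow_norm two_ne_zero ENNReal.ofNat_ne_top,
    ENNReal.toReal_ofReal (by positivity), Real.sqrt_eq_rpow]
  norm_num

theorem tendsto_kernelError (hx : 0 < x) (hK : MemLp (K x) 2 (volume.restrict (Ioo (-x) x))) :
    Tendsto (fun N => kernelError K N x) atTop (𝓝 0) := by
  have h1 := ((legendreBasis hx).hasSum_repr hK.toLp).tendsto_sum_nat
  -- Degree at most N means N + 1 terms, hence the shift of the index.
  have h2 := (h1.comp (tendsto_add_atTop_nat 1)).const_sub hK.toLp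
  rw [sub_self] at h2
  have h3 := h2.norm
  rw [norm_zero] at h3
  refine h3.congr fun N => ?_
  rw [kernelError, integral_symm_eq hx.le, ← norm_toLp_eq_sqrt (memLp_sub_kernelPartial hK N)]
  congr 1
  refine Lp.ext ?_
  have hb : ∀ m : ℕ, ((legendreL2 x m : Lp ℂ 2 (volume.restrict (Ioo (-x) x))) : ℝ → ℂ)
      =ᵐ[volume.restrict (Ioo (-x) x)] normalizedLegendre x m := fun m => MemLp.coeFn_toLp _
  have hs : ∀ M : ℕ, ((∑ i ∈ Finset.range M, (legendreBasis hx).repr hK.toLp i •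
      legendreBasis hx i : Lp ℂ 2 (volume.restrict (Ioo (-x) x))) : ℝ → ℂ)
      =ᵐ[volume.restrict (Ioo (-x) x)] fun t => ∑ m ∈ Finset.range M,
        legendreCoeff K m x / x * (((legendreP m).eval (t / x) : ℝ) : ℂ) := by
    intro M
    induction M with
    | zero =>
      simp only [Finset.range_zero, Finset.sum_empty]
      exact Lp.coeFn_zero _ _ _
    | succ M ih =>
      simp only [Finset.sum_range_succ]
      filter_upwards [ih, hb M, Lp.coeFn_add (∑ i ∈ Finset.range M,
        (legendreBasis hx).repr hK.toLp i • legendreBasis hx i)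
        ((legendreBasis hx).repr hK.toLp M • legendreBasis hx M),
        Lp.coeFn_smul ((legendreBasis hx).repr hK.toLp M) (legendreBasis hx M)] with t g1 g2 g3 g4
      rw [g3, Pi.add_apply, g1, g4, Pi.smul_apply, HilbertBasis.repr_apply_apply,
        legendreBasis_apply, g2, inner_legendreL2_toLp hx hK, normalizedLegendre, smul_eq_mul]
      congr 1
      have h0 : (M : ℂ) + 1 / 2 ≠ 0 := natCast_add_half_ne_zero M
      have hxc : (x : ℂ) ≠ 0 := by exact_mod_cast hx.ne'
      have hs := sqrt_mul_sqrt_normalization hx M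
      calc _ = ((Real.sqrt ((M + 1 / 2) / x) : ℂ) * Real.sqrt ((M + 1 / 2) / x)) *
            (legendreCoeff K M x / (M + 1 / 2) * (((legendreP M).eval (t / x) : ℝ) : ℂ)) := by
            ring
        _ = _ := by
          rw [hs, ← mul_assoc, div_mul_div_comm, mul_comm ((M : ℂ) + 1 / 2),
            mul_div_mul_right _ _ h0]
  filter_upwards [hs (N + 1), Lp.coeFn_sub hK.toLp (∑ i ∈ Finset.range (N + 1),
    (legendreBasis hx).repr hK.toLp i • legendreBasis hx i), hK.coeFn_toLp,
    (memLp_sub_kernelPartial hK N).coeFn_toLp] with t g1 g2 g3 g4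
  simp only [Function.comp_apply]
  rw [g4, g2, Pi.sub_apply, g1, g3, kernelPartial]

end

/-! ### The Volterra equation for the transmutation kernel -/

/-- The Volterra operator `(T F)(x,t) = ∫_0^x p(s) F(s, x - s - t) ds`. -/
noncomputable def volterraOp (p : ℝ → ℂ) (F : ℝ → ℝ → ℂ) (x t : ℝ) : ℂ :=
  ∫ s in Ioc 0 x, p s * F s (x - s - t)

/-- The free term of the Volterra equation. -/
noncomputable def volterraFree (p : ℝ → ℂ) (x t : ℝ) : ℂ :=
  {q : ℝ × ℝ | |q.2| < q.1}.indicator (fun q => p ((q.1 - q.2) / 2) / 2) (x, t)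

/-- `F(x,·)` vanishes outside `[-x,x]`. -/
def SupportedInCone (F : ℝ → ℝ → ℂ) : Prop :=
  ∀ x t, x < |t| → F x t = 0

/-- The exponential weight for which the Volterra operator is a contraction. -/
noncomputable def volterraWeight (p : ℝ → ℂ) : ℝ := 2 * ((∫ s, ‖p s‖ ^ 2) + 1)

section

variable {p : ℝ → ℂ} {F : ℝ → ℝ → ℂ}

theorem measurable_volterraFree (hpm : Measurable p) :
    Measurable (Function.uncurry (volterraFree p)) := by
  have : Function.uncurry (volterraFree p) =
      {q : ℝ × ℝ | |q.2| < q.1}.indicator (fun q => p ((q.1 - q.2) / 2) / 2) := by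
    ext ⟨x, t⟩; rfl
  rw [this]
  exact Measurable.indicator (by fun_prop)
    (measurableSet_lt (measurable_snd.abs) measurable_fst)

theorem measurable_volterraOp (hpm : Measurable p) (hF : Measurable (Function.uncurry F)) :
    Measurable (Function.uncurry (volterraOp p F)) := by
  have h1 : Measurable (fun q : (ℝ × ℝ) × ℝ =>
      {q : (ℝ × ℝ) × ℝ | 0 < q.2 ∧ q.2 ≤ q.1.1}.indicator
        (fun q => p q.2 * F q.2 (q.1.1 - q.2 - q.1.2)) q) := by
    refine Measurable.indicator ?_ ?_
    · have h2 : Measurable fun q : (ℝ × ℝ) × ℝ => (q.2, q.1.1 - q.2 - q.1.2) := by fun_prop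
      exact (hpm.comp measurable_snd).mul (hF.comp h2)
    · exact (measurableSet_lt measurable_const measurable_snd).inter
        (measurableSet_le measurable_snd (measurable_fst.comp measurable_fst))
  have h3 := h1.stronglyMeasurable.integral_prod_right' (ν := (volume : Measure ℝ))
  convert h3.measurable using 1
  ext ⟨x, t⟩
  rw [Function.uncurry, volterraOp, ← integral_indicator measurableSet_Ioc]
  rfl

/-- If |t| > x and s ≤ x, then |x - s - t| ≥ |t| - (x - s) > s, so every value of F in the integrand
vanishes. -/
theorem SupportedInCone.op (hF : SupportedInCone F) : SupportedInCone (volterraOp p F) := by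
  intro x t hxt
  rw [volterraOp]
  refine setIntegral_eq_zero_of_forall_eq_zero fun s hs => ?_
  rw [hF s (x - s - t), mul_zero]
  have h1 : |t| ≤ |x - s - t| + |x - s| := by
    have := abs_sub_abs_le_abs_sub t (x - s)
    rw [abs_sub_comm t] at this
    linarith
  rw [abs_of_nonneg (sub_nonneg.2 hs.2)] at h1
  linarith

theorem supportedInCone_volterraFree : SupportedInCone (volterraFree p) := by
  intro x t hxt
  exact indicator_of_notMem (by simpa using hxt.le) _

theorem norm_volterraFree_le (x t : ℝ) : ‖volterraFree p x t‖ ≤ ‖p ((x - t) / 2)‖ / 2 := by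
  rw [volterraFree]
  refine (norm_indicator_le_norm_self _ _).trans ?_
  simp

theorem volterraWeight_pos : 0 < volterraWeight p := by
  have : 0 ≤ ∫ s, ‖p s‖ ^ 2 := integral_nonneg fun _ => by positivity
  rw [volterraWeight]
  positivity

theorem integrableOn_norm_mul_exp (hp1 : Integrable p) (c x : ℝ) :
    IntegrableOn (fun s => ‖p s‖ * Real.exp (c * s)) (Ioc 0 x) := by
  obtain ⟨C, hC⟩ := isCompact_Icc.exists_bound_of_continuousOn (s := Icc 0 x)
    (f := fun s => Real.exp (c * s)) (by fun_prop)
  refine Integrable.mono' (hp1.norm.mul_const C).integrableOn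
    (hp1.norm.aestronglyMeasurable.restrict.mul
      (by fun_prop : Continuous fun s => Real.exp (c * s)).aestronglyMeasurable) ?_
  filter_upwards [ae_restrict_mem measurableSet_Ioc] with s hs
  rw [norm_mul, norm_norm]
  exact mul_le_mul_of_nonneg_left (hC s (Ioc_subset_Icc_self hs)) (norm_nonneg _)

/-- With c the weight and u = e^{c(s-x)}, one has |p|u ≤ (|p|²/c + c u²)/2. Both terms in the
bracket integrate to at most 1/2, the first by the choice of c, so the total is at most 1/2. -/
theorem setIntegral_norm_mul_exp_le (hp1 : Integrable p) (hp2 : Integrable fun s => ‖p s‖ ^ 2)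
    {x : ℝ} (hx : 0 ≤ x) :
    ∫ s in Ioc 0 x, ‖p s‖ * Real.exp (volterraWeight p * s) ≤
      Real.exp (volterraWeight p * x) / 2 := by
  set c := volterraWeight p with hc
  have hc0 : 0 < c := volterraWeight_pos
  have hI : 0 ≤ ∫ s, ‖p s‖ ^ 2 := integral_nonneg fun _ => by positivity
  have i1 : IntegrableOn (fun s => c⁻¹ * ‖p s‖ ^ 2) (Ioc 0 x) := (hp2.const_mul _).integrableOn
  have i2 : IntegrableOn (fun s => c * Real.exp (2 * c * s - 2 * c * x)) (Ioc 0 x) :=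
    (by fun_prop : Continuous fun s => c * Real.exp (2 * c * s - 2 * c * x)).integrableOn_Ioc
  have h1 : ∫ s in Ioc 0 x, ‖p s‖ * Real.exp (c * s) ≤
      ∫ s in Ioc 0 x, Real.exp (c * x) / 2 *
        (c⁻¹ * ‖p s‖ ^ 2 + c * Real.exp (2 * c * s - 2 * c * x)) := by
    refine setIntegral_mono (integrableOn_norm_mul_exp hp1 c x) ((i1.add i2).const_mul _) ?_
    intro s
    have e1 : Real.exp (c * s) = Real.exp (c * x) * Real.exp (c * s - c * x) := by
      rw [← Real.exp_add]; ring_nf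
    have e2 : Real.exp (2 * c * s - 2 * c * x) = Real.exp (c * s - c * x) ^ 2 := by
      rw [← Real.exp_nat_mul]; ring_nf
    simp only
    rw [e1, e2]
    set u := Real.exp (c * s - c * x)
    have h3 : ‖p s‖ * u ≤ (c⁻¹ * ‖p s‖ ^ 2 + c * u ^ 2) / 2 := by
      have h4 : 0 ≤ c⁻¹ * (‖p s‖ - c * u) ^ 2 := by positivity
      have h5 : c⁻¹ * (‖p s‖ - c * u) ^ 2 = c⁻¹ * ‖p s‖ ^ 2 + c * u ^ 2 - 2 * (‖p s‖ * u) := by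
        field_simp; ring
      linarith
    nlinarith [Real.exp_pos (c * x)]
  have h2 : ∫ s in Ioc 0 x, c * Real.exp (2 * c * s - 2 * c * x) ≤ 1 / 2 := by
    rw [← intervalIntegral.integral_of_le hx, intervalIntegral.integral_const_mul,
      intervalIntegral.integral_comp_mul_sub (f := Real.exp) (by positivity), integral_exp]
    simp only [sub_self, Real.exp_zero, smul_eq_mul]
    have h3 : c * ((2 * c)⁻¹ * (1 - Real.exp (2 * c * 0 - 2 * c * x))) =
        (1 - Real.exp (2 * c * 0 - 2 * c * x)) / 2 := by field_simp
    rw [h3]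
    linarith [Real.exp_pos (2 * c * 0 - 2 * c * x)]
  have h3 : ∫ s in Ioc 0 x, c⁻¹ * ‖p s‖ ^ 2 ≤ 1 / 2 := by
    rw [integral_const_mul]
    have h4 : ∫ s in Ioc 0 x, ‖p s‖ ^ 2 ≤ ∫ s, ‖p s‖ ^ 2 :=
      setIntegral_le_integral hp2 (.of_forall fun _ => by positivity)
    rw [inv_mul_le_iff₀ hc0, hc, volterraWeight]
    linarith
  rw [integral_const_mul, integral_add i1 i2] at h1
  refine h1.trans ?_
  nlinarith [Real.exp_pos (c * x)]

theorem integrableOn_volterraOp (hp1 : Integrable p) (hF : Measurable (Function.uncurry F))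
    {M : ℝ} (hM : ∀ s, 0 < s → ∀ t, ‖F s t‖ ≤ M * Real.exp (volterraWeight p * s)) (x t : ℝ) :
    IntegrableOn (fun s => p s * F s (x - s - t)) (Ioc 0 x) := by
  refine Integrable.mono' ((integrableOn_norm_mul_exp hp1 (volterraWeight p) x).const_mul M)
    (hp1.aestronglyMeasurable.restrict.mul (Measurable.aestronglyMeasurable
      (hF.comp (by fun_prop : Measurable fun s : ℝ => (s, x - s - t))))) ?_
  filter_upwards [ae_restrict_mem measurableSet_Ioc] with s hs
  rw [norm_mul]
  calc _ ≤ ‖p s‖ * (M * Real.exp (volterraWeight p * s)) :=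
        mul_le_mul_of_nonneg_left (hM s hs.1 _) (norm_nonneg _)
    _ = _ := by ring

theorem setIntegral_norm_volterraOp_le (hp1 : Integrable p)
    (hp2 : Integrable fun s => ‖p s‖ ^ 2) (hF : Measurable (Function.uncurry F))
    {M : ℝ} (hM0 : 0 ≤ M) (hM : ∀ s, 0 < s → ∀ t, ‖F s t‖ ≤ M * Real.exp (volterraWeight p * s))
    (x t : ℝ) : ∫ s in Ioc 0 x, ‖p s * F s (x - s - t)‖ ≤
      M / 2 * Real.exp (volterraWeight p * x) := by
  rcases lt_or_ge x 0 with hx | hx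
  · rw [Ioc_eq_empty (by linarith), Measure.restrict_empty, integral_zero_measure]
    positivity
  calc _ ≤ ∫ s in Ioc 0 x, M * (‖p s‖ * Real.exp (volterraWeight p * s)) := by
        refine setIntegral_mono_on (integrableOn_volterraOp hp1 hF hM x t).norm
          ((integrableOn_norm_mul_exp hp1 (volterraWeight p) x).const_mul M) measurableSet_Ioc ?_
        intro s hs
        rw [norm_mul]
        calc _ ≤ ‖p s‖ * (M * Real.exp (volterraWeight p * s)) :=
              mul_le_mul_of_nonneg_left (hM s hs.1 _) (norm_nonneg _)
          _ = _ := by ring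
    _ = M * ∫ s in Ioc 0 x, ‖p s‖ * Real.exp (volterraWeight p * s) := integral_const_mul _ _
    _ ≤ M * (Real.exp (volterraWeight p * x) / 2) :=
        mul_le_mul_of_nonneg_left (setIntegral_norm_mul_exp_le hp1 hp2 hx) hM0
    _ = _ := by ring

theorem norm_volterraOp_le (hp1 : Integrable p)
    (hp2 : Integrable fun s => ‖p s‖ ^ 2) (hF : Measurable (Function.uncurry F))
    {M : ℝ} (hM0 : 0 ≤ M) (hM : ∀ s, 0 < s → ∀ t, ‖F s t‖ ≤ M * Real.exp (volterraWeight p * s))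
    (x t : ℝ) : ‖volterraOp p F x t‖ ≤ M / 2 * Real.exp (volterraWeight p * x) :=
  (norm_integral_le_integral_norm _).trans
    (setIntegral_norm_volterraOp_le hp1 hp2 hF hM0 hM x t)

theorem integrable_norm_mul_norm_shift (hpm : Measurable p)
    (hp2 : Integrable fun s => ‖p s‖ ^ 2) (d : ℝ) :
    Integrable fun s => ‖p s‖ * ‖p (s - d)‖ := by
  refine Integrable.mono' (hp2.add (hp2.comp_sub_right d)) (by fun_prop) (.of_forall fun s => ?_)
  rw [norm_mul, norm_norm, norm_norm, Pi.add_apply]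
  nlinarith [sq_nonneg (‖p s‖ - ‖p (s - d)‖), sq_nonneg ‖p s‖, sq_nonneg ‖p (s - d)‖]

theorem norm_mul_volterraFree_le (x t s : ℝ) : ‖p s * volterraFree p s (x - s - t)‖ ≤
    ‖p s‖ * ‖p (s - (x - t) / 2)‖ / 2 := by
  rw [norm_mul, mul_div_assoc]
  refine mul_le_mul_of_nonneg_left ((norm_volterraFree_le _ _).trans (le_of_eq ?_)) (norm_nonneg _)
  congr 3
  ring

theorem integrableOn_volterraOp_free (hpm : Measurable p)
    (hp2 : Integrable fun s => ‖p s‖ ^ 2) (x t : ℝ) :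
    IntegrableOn (fun s => p s * volterraFree p s (x - s - t)) (Ioc 0 x) := by
  refine Integrable.mono'
    ((integrable_norm_mul_norm_shift hpm hp2 ((x - t) / 2)).div_const 2).integrableOn
    (Measurable.aestronglyMeasurable (hpm.mul ((measurable_volterraFree hpm).comp
      (by fun_prop : Measurable fun s : ℝ => (s, x - s - t))))) (.of_forall fun s => ?_)
  exact norm_mul_volterraFree_le x t s

/-- The free term need not be bounded, but in T G₀ the integrand is p times a translate of p, whose
integral is controlled by ‖p‖². This is why the iteration starts at T G₀. -/
theorem norm_volterraOp_free_le (hpm : Measurable p)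
    (hp2 : Integrable fun s => ‖p s‖ ^ 2) (x t : ℝ) :
    ‖volterraOp p (volterraFree p) x t‖ ≤ ∫ s, ‖p s‖ ^ 2 := by
  have i := integrable_norm_mul_norm_shift hpm hp2 ((x - t) / 2)
  calc _ ≤ ∫ s in Ioc 0 x, ‖p s‖ * ‖p (s - (x - t) / 2)‖ / 2 :=
        norm_integral_le_of_norm_le (i.div_const 2).integrableOn
          (.of_forall fun s => norm_mul_volterraFree_le x t s)
    _ ≤ ∫ s, ‖p s‖ * ‖p (s - (x - t) / 2)‖ / 2 :=
        setIntegral_le_integral (i.div_const 2) (.of_forall fun s => by positivity)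
    _ ≤ ∫ s, (‖p s‖ ^ 2 / 2 + ‖p (s - (x - t) / 2)‖ ^ 2 / 2) := by
        refine integral_mono (i.div_const 2)
          ((hp2.div_const 2).add ((hp2.comp_sub_right _).div_const 2)) fun s => ?_
        simp only
        nlinarith [sq_nonneg (‖p s‖ - ‖p (s - (x - t) / 2)‖), sq_nonneg ‖p s‖,
          sq_nonneg ‖p (s - (x - t) / 2)‖]
    _ = ∫ s, ‖p s‖ ^ 2 := by
        rw [integral_add (hp2.div_const 2) ((hp2.comp_sub_right _).div_const 2), integral_div,
          integral_div, integral_sub_right_eq_self (fun s => ‖p s‖ ^ 2)]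
        ring

/-- The Neumann iterates of the Volterra equation. -/
noncomputable def volterraIterate (p : ℝ → ℂ) : ℕ → ℝ → ℝ → ℂ
  | 0 => volterraOp p (volterraFree p)
  | n + 1 => volterraOp p (volterraIterate p n)

theorem measurable_volterraIterate (hpm : Measurable p) (n : ℕ) :
    Measurable (Function.uncurry (volterraIterate p n)) := by
  induction n with
  | zero => exact measurable_volterraOp hpm (measurable_volterraFree hpm)
  | succ n ih => exact measurable_volterraOp hpm ih

theorem supportedInCone_volterraIterate (n : ℕ) : SupportedInCone (volterraIterate p n) := by
  induction n with
  | zero => exact supportedInCone_volterraFree.op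
  | succ n ih => exact ih.op

theorem norm_volterraIterate_le (hpm : Measurable p) (hp1 : Integrable p)
    (hp2 : Integrable fun s => ‖p s‖ ^ 2) (n : ℕ) : ∀ x, 0 < x → ∀ t, ‖volterraIterate p n x t‖ ≤
      (∫ s, ‖p s‖ ^ 2) * (1 / 2) ^ n * Real.exp (volterraWeight p * x) := by
  have hI : 0 ≤ ∫ s, ‖p s‖ ^ 2 := integral_nonneg fun _ => by positivity
  induction n with
  | zero =>
    intro x hx t
    rw [pow_zero, mul_one]
    refine (norm_volterraOp_free_le hpm hp2 x t).trans (le_mul_of_one_le_right hI ?_)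
    exact Real.one_le_exp (mul_pos volterraWeight_pos hx).le
  | succ n ih =>
    intro x _ t
    refine (norm_volterraOp_le hp1 hp2 (measurable_volterraIterate hpm n) (by positivity) ih x
      t).trans (le_of_eq ?_)
    ring

/-- The L¹ norms of the integrands decay like 2^{-n} at each fixed point, so T commutes with the sum
everywhere, not just almost everywhere. -/
theorem hasSum_volterraIterate_op (hpm : Measurable p) (hp1 : Integrable p)
    (hp2 : Integrable fun s => ‖p s‖ ^ 2) (x t : ℝ) :
    HasSum (fun n => volterraIterate p (n + 1) x t)
      (volterraOp p (fun s t => ∑' n, volterraIterate p n s t) x t) := by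
  have hI : 0 ≤ ∫ s, ‖p s‖ ^ 2 := integral_nonneg fun _ => by positivity
  have h := hasSum_integral_of_summable_integral_norm (μ := volume.restrict (Ioc 0 x))
    (F := fun (n : ℕ) s => p s * volterraIterate p n s (x - s - t))
    (fun n => integrableOn_volterraOp hp1 (measurable_volterraIterate hpm n)
      (norm_volterraIterate_le hpm hp1 hp2 n) x t) (by
      refine Summable.of_nonneg_of_le (fun n => integral_nonneg fun _ => norm_nonneg _)
        (fun n => setIntegral_norm_volterraOp_le hp1 hp2 (measurable_volterraIterate hpm n)
          (by positivity) (norm_volterraIterate_le hpm hp1 hp2 n) x t) ?_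
      exact (((summable_geometric_of_lt_one (by norm_num) (by norm_num : (1 / 2 : ℝ) < 1)).mul_left
        _).div_const 2).mul_right _)
  simp only [tsum_mul_left] at h
  exact h

theorem summable_volterraIterate (hpm : Measurable p) (hp1 : Integrable p)
    (hp2 : Integrable fun s => ‖p s‖ ^ 2) (x t : ℝ) : Summable fun n => volterraIterate p n x t :=
  (summable_nat_add_iff 1).1 (hasSum_volterraIterate_op hpm hp1 hp2 x t).summable

/-- The solution of the Volterra equation `G = G₀ + T G`. -/
noncomputable def volterraSol (p : ℝ → ℂ) (x t : ℝ) : ℂ :=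
  volterraFree p x t + ∑' n, volterraIterate p n x t

theorem measurable_tsum_volterraIterate (hpm : Measurable p) (hp1 : Integrable p)
    (hp2 : Integrable fun s => ‖p s‖ ^ 2) :
    Measurable (Function.uncurry fun x t => ∑' n, volterraIterate p n x t) := by
  refine measurable_of_tendsto_metrizable (f := fun (N : ℕ) (q : ℝ × ℝ) =>
    ∑ n ∈ Finset.range N, volterraIterate p n q.1 q.2)
    (fun N => Finset.measurable_sum _ fun n _ => measurable_volterraIterate hpm n) ?_
  rw [tendsto_pi_nhds]
  exact fun q => (summable_volterraIterate hpm hp1 hp2 q.1 q.2).hasSum.tendsto_sum_nat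

theorem norm_tsum_volterraIterate_le (hpm : Measurable p) (hp1 : Integrable p)
    (hp2 : Integrable fun s => ‖p s‖ ^ 2) : ∀ x, 0 < x → ∀ t, ‖∑' n, volterraIterate p n x t‖ ≤
      2 * (∫ s, ‖p s‖ ^ 2) * Real.exp (volterraWeight p * x) := by
  intro x hx t
  refine tsum_of_norm_bounded (g := fun n => (∫ s, ‖p s‖ ^ 2) * (1 / 2) ^ n *
    Real.exp (volterraWeight p * x)) ?_ fun n => norm_volterraIterate_le hpm hp1 hp2 n x hx t
  have := (hasSum_geometric_two.mul_left (∫ s, ‖p s‖ ^ 2)).mul_right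
    (Real.exp (volterraWeight p * x))
  rwa [mul_comm _ (2 : ℝ)] at this

theorem measurable_volterraSol (hpm : Measurable p) (hp1 : Integrable p)
    (hp2 : Integrable fun s => ‖p s‖ ^ 2) : Measurable (Function.uncurry (volterraSol p)) :=
  (measurable_volterraFree hpm).add (measurable_tsum_volterraIterate hpm hp1 hp2)

theorem supportedInCone_volterraSol : SupportedInCone (volterraSol p) := by
  intro x t hxt
  rw [volterraSol, supportedInCone_volterraFree x t hxt, zero_add]
  simp only [supportedInCone_volterraIterate _ x t hxt, tsum_zero]

theorem volterraSol_eq (hpm : Measurable p) (hp1 : Integrable p)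
    (hp2 : Integrable fun s => ‖p s‖ ^ 2) (x t : ℝ) :
    volterraSol p x t = volterraFree p x t + volterraOp p (volterraSol p) x t := by
  rw [volterraSol, (summable_volterraIterate hpm hp1 hp2 x t).tsum_eq_zero_add,
    (hasSum_volterraIterate_op hpm hp1 hp2 x t).tsum_eq]
  congr 1
  simp only [volterraIterate, volterraOp, volterraSol, mul_add]
  rw [integral_add (integrableOn_volterraOp_free hpm hp2 x t)
    (integrableOn_volterraOp hp1 (measurable_tsum_volterraIterate hpm hp1 hp2)
      (norm_tsum_volterraIterate_le hpm hp1 hp2) x t)]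

theorem norm_volterraSol_le (hpm : Measurable p) (hp1 : Integrable p)
    (hp2 : Integrable fun s => ‖p s‖ ^ 2) {x ℓ : ℝ} (hx : x ≤ ℓ) (t : ℝ) :
    ‖volterraSol p x t‖ ≤ ‖p ((x - t) / 2)‖ +
      (Icc (-x) x).indicator (fun _ => 2 * (∫ s, ‖p s‖ ^ 2) * Real.exp (volterraWeight p * ℓ)) t := by
  have hI : 0 ≤ ∫ s, ‖p s‖ ^ 2 := integral_nonneg fun _ => by positivity
  by_cases h : t ∈ Icc (-x) x
  · rw [indicator_of_mem h, volterraSol]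
    refine (norm_add_le _ _).trans (add_le_add ?_ ?_)
    · exact (norm_volterraFree_le x t).trans (half_le_self (norm_nonneg _))
    -- The bound for the series assumes x > 0; at x = 0 every iterate is an integral over an empty
    -- set.
    · rcases (neg_le_self_iff.1 (h.1.trans h.2)).eq_or_lt with h0 | h0
      · rw [← h0]
        have : ∀ n, volterraIterate p n 0 t = 0 := fun n => by
          cases n <;> simp [volterraIterate, volterraOp]
        simp only [this, tsum_zero, norm_zero]
        positivity
      · refine (norm_tsum_volterraIterate_le hpm hp1 hp2 x h0 t).trans ?_
        have := volterraWeight_pos (p := p)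
        gcongr
  · rw [indicator_of_notMem h, supportedInCone_volterraSol x t, norm_zero]
    · positivity
    · rw [lt_abs]
      rw [mem_Icc, not_and_or, not_le, not_le] at h
      rcases h with h | h
      · right; linarith
      · left; exact h

end

/-! ### The Fourier transform of the Volterra equation -/

/-- The Fourier-Laplace transform of `F(x,·)`. -/
noncomputable def sliceFourier (F : ℝ → ℝ → ℂ) (ρ : ℂ) (x : ℝ) : ℂ :=
  ∫ t, F x t * Complex.exp (Complex.I * ρ * t)

section

variable {p : ℝ → ℂ} {F : ℝ → ℝ → ℂ}

theorem norm_exp_I_mul_le (ρ : ℂ) (t : ℝ) :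
    ‖Complex.exp (Complex.I * ρ * t)‖ ≤ Real.exp (‖ρ‖ * |t|) := by
  refine (Complex.norm_exp_le_exp_norm _).trans (le_of_eq ?_)
  simp

theorem SupportedInCone.norm_mul_exp_le (hF : SupportedInCone F) (ρ : ℂ) (x t : ℝ) :
    ‖F x t * Complex.exp (Complex.I * ρ * t)‖ ≤ ‖F x t‖ * Real.exp (‖ρ‖ * x) := by
  rcases lt_or_ge x |t| with h | h
  · simp [hF x t h]
  · rw [norm_mul]
    gcongr
    exact (norm_exp_I_mul_le ρ t).trans (by gcongr)

theorem SupportedInCone.integrable_mul_exp (hF : SupportedInCone F) {x : ℝ}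
    (hi : Integrable (F x)) (ρ : ℂ) :
    Integrable fun t : ℝ => F x t * Complex.exp (Complex.I * ρ * t) :=
  Integrable.mono' (hi.norm.mul_const (Real.exp (‖ρ‖ * x)))
    (hi.aestronglyMeasurable.mul
      (by fun_prop : Continuous fun t : ℝ => Complex.exp (Complex.I * ρ * t)).aestronglyMeasurable)
    (.of_forall fun t => hF.norm_mul_exp_le ρ x t)

theorem SupportedInCone.norm_sliceFourier_le (hF : SupportedInCone F) {x : ℝ}
    (hi : Integrable (F x)) (ρ : ℂ) :
    ‖sliceFourier F ρ x‖ ≤ (∫ t, ‖F x t‖) * Real.exp (‖ρ‖ * x) := by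
  rw [← integral_mul_const]
  exact norm_integral_le_of_norm_le (hi.norm.mul_const _)
    (.of_forall fun t => hF.norm_mul_exp_le ρ x t)

theorem measurable_sliceFourier (hF : Measurable (Function.uncurry F)) (ρ : ℂ) :
    Measurable (sliceFourier F ρ) := by
  have h : Measurable fun q : ℝ × ℝ => F q.1 q.2 * Complex.exp (Complex.I * ρ * q.2) :=
    hF.mul (by fun_prop)
  exact (h.stronglyMeasurable.integral_prod_right' (ν := volume)).measurable

/-- This is the Fubini hypothesis. The exponential may be replaced by the constant e^{|ρ|x} because
the integrand vanishes for |t| > x; the rest is a slice-wise translated L¹ bound. -/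
theorem SupportedInCone.integrable_prod (hF : SupportedInCone F) (hpm : Measurable p)
    (hp1 : Integrable p) (hFm : Measurable (Function.uncurry F)) {x C : ℝ}
    (hi : ∀ s ∈ Ioc 0 x, Integrable (F s)) (hC : ∀ s ∈ Ioc 0 x, ∫ t, ‖F s t‖ ≤ C) (ρ : ℂ) :
    Integrable (fun q : ℝ × ℝ => p q.1 * F q.1 (x - q.1 - q.2) *
      Complex.exp (Complex.I * ρ * q.2)) ((volume.restrict (Ioc 0 x)).prod volume) := by
  have hFm2 : Measurable fun q : ℝ × ℝ => F q.1 (x - q.1 - q.2) :=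
    hFm.comp (by fun_prop : Measurable fun q : ℝ × ℝ => (q.1, x - q.1 - q.2))
  have hm : Measurable fun q : ℝ × ℝ => p q.1 * F q.1 (x - q.1 - q.2) *
      Complex.exp (Complex.I * ρ * q.2) := ((hpm.comp measurable_fst).mul hFm2).mul (by fun_prop)
  set B : ℝ := Real.exp (‖ρ‖ * x) with hB
  have hbd : Integrable (fun q : ℝ × ℝ => ‖p q.1‖ * ‖F q.1 (x - q.1 - q.2)‖ * B)
      ((volume.restrict (Ioc 0 x)).prod volume) := by
    have hm2 : Measurable fun q : ℝ × ℝ => ‖p q.1‖ * ‖F q.1 (x - q.1 - q.2)‖ * B :=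
      (((hpm.comp measurable_fst).norm).mul hFm2.norm).mul_const _
    rw [integrable_prod_iff hm2.aestronglyMeasurable]
    constructor
    · filter_upwards [ae_restrict_mem measurableSet_Ioc] with s hs
      exact ((((hi s hs).norm).comp_sub_left (x - s)).const_mul _).mul_const _
    · refine Integrable.mono' ((hp1.norm.mul_const (C * B)).integrableOn)
        hm2.norm.stronglyMeasurable.integral_prod_right'.aestronglyMeasurable ?_
      filter_upwards [ae_restrict_mem measurableSet_Ioc] with s hs
      have e : ∀ t, ‖‖p s‖ * ‖F s (x - s - t)‖ * B‖ = ‖p s‖ * B * ‖F s (x - s - t)‖ := fun t => by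
        rw [Real.norm_of_nonneg (by positivity)]; ring
      simp only [e]
      rw [integral_const_mul, integral_sub_left_eq_self (fun t => ‖F s t‖),
        Real.norm_of_nonneg (by positivity)]
      calc _ ≤ ‖p s‖ * B * C := by gcongr; exact hC s hs
        _ = _ := by ring
  refine hbd.mono' hm.aestronglyMeasurable ?_
  have hae : ∀ᵐ q : ℝ × ℝ ∂((volume.restrict (Ioc 0 x)).prod volume), q.1 ∈ Ioc 0 x :=
    Measure.quasiMeasurePreserving_fst.ae (ae_restrict_mem measurableSet_Ioc)
  filter_upwards [hae] with q hq
  rw [norm_mul, norm_mul]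
  rcases lt_or_ge x |q.2| with h | h
  · have : F q.1 (x - q.1 - q.2) = 0 := hF _ _ (by
      have h1 := abs_sub_abs_le_abs_sub q.2 (x - q.1)
      rw [abs_sub_comm q.2, abs_of_nonneg (sub_nonneg.2 hq.2)] at h1
      linarith)
    simp [this]
  · gcongr
    exact (norm_exp_I_mul_le ρ q.2).trans (by rw [hB]; gcongr)

/-- The substitution u = x - s - t turns the transform at ρ into e^{iρ(x-s)} times the transform at
-ρ: the reflection inside T is what couples ρ with -ρ. -/
theorem SupportedInCone.sliceFourier_volterraOp (hF : SupportedInCone F) (hpm : Measurable p)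
    (hp1 : Integrable p) (hFm : Measurable (Function.uncurry F)) {x C : ℝ}
    (hi : ∀ s ∈ Ioc 0 x, Integrable (F s)) (hC : ∀ s ∈ Ioc 0 x, ∫ t, ‖F s t‖ ≤ C) (ρ : ℂ) :
    sliceFourier (volterraOp p F) ρ x = ∫ s in Ioc 0 x,
      Complex.exp (Complex.I * ρ * (x - s)) * (p s * sliceFourier F (-ρ) s) := by
  have hint := hF.integrable_prod hpm hp1 hFm hi hC ρ
  have h1 : sliceFourier (volterraOp p F) ρ x = ∫ t, ∫ s in Ioc 0 x,
      p s * F s (x - s - t) * Complex.exp (Complex.I * ρ * t) := by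
    rw [sliceFourier]
    congr 1
    ext t
    rw [volterraOp, integral_mul_const]
  rw [h1, ← integral_integral_swap (f := fun s t => p s * F s (x - s - t) *
    Complex.exp (Complex.I * ρ * t)) hint]
  congr 1
  ext s
  have h2 := integral_sub_left_eq_self (μ := volume)
    (fun u : ℝ => p s * F s u * Complex.exp (Complex.I * ρ * ((x - s - u : ℝ) : ℂ))) (x - s)
  simp only [sub_sub_cancel] at h2
  rw [h2, sliceFourier, ← integral_const_mul, ← integral_const_mul]
  congr 1
  ext u
  have h3 : Complex.I * ρ * ((x - s - u : ℝ) : ℂ) =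
      Complex.I * ρ * (x - s) + Complex.I * -ρ * u := by
    push_cast; ring
  rw [h3, Complex.exp_add]
  ring

/-- The substitution s = (x - t)/2 maps |t| < x onto 0 < s < x, and t = (x - s) - s splits the
exponential. The Jacobian 2 cancels the factor 1/2 in the free term. -/
theorem sliceFourier_volterraFree (ρ : ℂ) (x : ℝ) :
    sliceFourier (volterraFree p) ρ x = ∫ s in Ioc 0 x,
      Complex.exp (Complex.I * ρ * (x - s)) * (p s * Complex.exp (Complex.I * -ρ * s)) := by
  set h : ℝ → ℂ := (Ioo 0 x).indicator fun s =>
    Complex.exp (Complex.I * ρ * (x - s)) * (p s * Complex.exp (Complex.I * -ρ * s)) with hh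
  have e1 : ∀ t : ℝ, volterraFree p x t * Complex.exp (Complex.I * ρ * t) =
      h ((x - t) / 2) / 2 := by
    intro t
    rw [volterraFree, hh]
    have hiff : (x, t) ∈ {q : ℝ × ℝ | |q.2| < q.1} ↔ (x - t) / 2 ∈ Ioo 0 x := by
      simp only [mem_ofPred_eq, mem_Ioo, abs_lt]
      constructor
      · rintro ⟨a, b⟩; constructor <;> linarith
      · rintro ⟨a, b⟩; constructor <;> linarith
    by_cases ht : (x, t) ∈ {q : ℝ × ℝ | |q.2| < q.1}
    · rw [indicator_of_mem ht, indicator_of_mem (hiff.1 ht)]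
      have : Complex.exp (Complex.I * ρ * t) = Complex.exp (Complex.I * ρ * (x -
          (((x - t) / 2 : ℝ) : ℂ))) * Complex.exp (Complex.I * -ρ * (((x - t) / 2 : ℝ) : ℂ)) := by
        rw [← Complex.exp_add]
        congr 1
        push_cast
        ring
      rw [this]
      ring
    · rw [indicator_of_notMem ht, indicator_of_notMem (fun h' => ht (hiff.2 h'))]
      simp
  rw [sliceFourier]
  simp only [e1]
  rw [integral_sub_left_eq_self (fun u : ℝ => h (u / 2) / 2) volume x, integral_div,
    Measure.integral_comp_div h 2, hh, integral_indicator measurableSet_Ioo,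
    integral_Ioc_eq_integral_Ioo, abs_of_pos (by norm_num : (0 : ℝ) < 2), Complex.real_smul]
  push_cast
  ring

theorem integrable_comp_sub_div_two {E : Type*} [NormedAddCommGroup E] {q : ℝ → E}
    (hq : Integrable q) (x : ℝ) : Integrable fun t => q ((x - t) / 2) :=
  (hq.comp_div two_ne_zero).comp_sub_left x

theorem integral_comp_sub_div_two (q : ℝ → ℝ) (x : ℝ) :
    ∫ t, q ((x - t) / 2) = 2 * ∫ t, q t := by
  rw [integral_sub_left_eq_self (fun u : ℝ => q (u / 2)) volume x, Measure.integral_comp_div q 2,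
    abs_of_pos (by norm_num : (0 : ℝ) < 2), smul_eq_mul]

theorem integrable_volterraSol (hpm : Measurable p) (hp1 : Integrable p)
    (hp2 : Integrable fun s => ‖p s‖ ^ 2) (x : ℝ) : Integrable (volterraSol p x) := by
  refine Integrable.mono' ((integrable_comp_sub_div_two hp1 x).norm.add
    ((integrable_indicator_iff measurableSet_Icc).2
      (integrableOn_const (by simp [Real.volume_Icc]))))
    ((measurable_volterraSol hpm hp1 hp2).comp measurable_prodMk_left).aestronglyMeasurable
    (.of_forall fun t => norm_volterraSol_le hpm hp1 hp2 le_rfl t)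

theorem exists_integral_norm_volterraSol_le (hpm : Measurable p) (hp1 : Integrable p)
    (hp2 : Integrable fun s => ‖p s‖ ^ 2) (ℓ : ℝ) :
    ∃ C, 0 ≤ C ∧ ∀ x ∈ Icc 0 ℓ, ∫ t, ‖volterraSol p x t‖ ≤ C := by
  have hI : 0 ≤ ∫ s, ‖p s‖ ^ 2 := integral_nonneg fun _ => by positivity
  have hI1 : 0 ≤ ∫ s, ‖p s‖ := integral_nonneg fun _ => by positivity
  set M := 2 * (∫ s, ‖p s‖ ^ 2) * Real.exp (volterraWeight p * ℓ) with hM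
  have hM0 : 0 ≤ M := by positivity
  refine ⟨2 * (∫ s, ‖p s‖) + |2 * ℓ| * M, by positivity, fun x hx => ?_⟩
  have i1 := (integrable_comp_sub_div_two hp1 x).norm
  have i2 : Integrable ((Icc (-x) x).indicator fun _ => M) :=
    (integrable_indicator_iff measurableSet_Icc).2
      (integrableOn_const (by simp [Real.volume_Icc]))
  calc _ ≤ ∫ t, (‖p ((x - t) / 2)‖ + (Icc (-x) x).indicator (fun _ => M) t) :=
        integral_mono (integrable_volterraSol hpm hp1 hp2 x).norm (i1.add i2)
          fun t => norm_volterraSol_le hpm hp1 hp2 hx.2 t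
    _ = 2 * (∫ s, ‖p s‖) + 2 * x * M := by
        rw [integral_add i1 i2, integral_comp_sub_div_two (fun s => ‖p s‖),
          integral_indicator measurableSet_Icc, setIntegral_const, smul_eq_mul, measureReal_def,
          Real.volume_Icc, ENNReal.toReal_ofReal (by linarith [hx.1])]
        ring
    _ ≤ _ := by
        gcongr
        exact (by linarith [hx.2] : 2 * x ≤ 2 * ℓ).trans (le_abs_self _)

/-- `g(ρ,x) = e^{iρx} + ∫ G(x,t) e^{iρt} dt`. -/
noncomputable def volterraExp (p : ℝ → ℂ) (ρ : ℂ) (x : ℝ) : ℂ :=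
  Complex.exp (Complex.I * ρ * x) + sliceFourier (volterraSol p) ρ x

/-- In the transformed Volterra equation the free term supplies e^{-iρs} and T supplies the
transform of G at -ρ; together they are g(-ρ,s). -/
theorem volterraExp_eq (hpm : Measurable p) (hp1 : Integrable p)
    (hp2 : Integrable fun s => ‖p s‖ ^ 2) (ρ : ℂ) {x : ℝ} :
    volterraExp p ρ x = Complex.exp (Complex.I * ρ * x) + ∫ s in Ioc 0 x,
      Complex.exp (Complex.I * ρ * (x - s)) * (p s * volterraExp p (-ρ) s) := by
  obtain ⟨C, hC0, hC⟩ := exists_integral_norm_volterraSol_le hpm hp1 hp2 x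
  have hS : SupportedInCone (volterraSol p) := supportedInCone_volterraSol
  have hm := measurable_volterraSol hpm hp1 hp2
  have hi := integrable_volterraSol hpm hp1 hp2
  have hop := hS.sliceFourier_volterraOp hpm hp1 hm (fun s _ => hi s)
    (fun s hs => hC s (Ioc_subset_Icc_self hs)) ρ
  have hfree : Integrable (volterraFree p x) :=
    Integrable.mono' ((integrable_comp_sub_div_two hp1 x).norm.div_const 2)
      ((measurable_volterraFree hpm).comp measurable_prodMk_left).aestronglyMeasurable
      (.of_forall fun t => norm_volterraFree_le x t)
  have hopi : Integrable (volterraOp p (volterraSol p) x) := by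
    refine ((hi x).sub hfree).congr (.of_forall fun t => ?_)
    simp only [Pi.sub_apply]
    rw [volterraSol_eq hpm hp1 hp2]
    ring
  have e1 : sliceFourier (volterraSol p) ρ x = sliceFourier (volterraFree p) ρ x +
      sliceFourier (volterraOp p (volterraSol p)) ρ x := by
    rw [sliceFourier, sliceFourier, sliceFourier, ← integral_add
      (supportedInCone_volterraFree.integrable_mul_exp hfree ρ)
      (hS.op.integrable_mul_exp hopi ρ)]
    congr 1
    ext t
    rw [volterraSol_eq hpm hp1 hp2]
    ring
  have hbdd : ∀ (u : ℝ → ℂ) (D : ℝ), Measurable u → (∀ s ∈ Ioc 0 x, ‖u s‖ ≤ D) →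
      IntegrableOn (fun s : ℝ => Complex.exp (Complex.I * ρ * (x - s)) * (p s * u s)) (Ioc 0 x) := by
    intro u D hu hD
    refine Integrable.mono' (hp1.norm.mul_const (Real.exp (‖ρ‖ * x) * D)).integrableOn
      ((by fun_prop : Measurable fun s : ℝ => Complex.exp (Complex.I * ρ * (x - s))).mul
        (hpm.mul hu)).aestronglyMeasurable ?_
    filter_upwards [ae_restrict_mem measurableSet_Ioc] with s hs
    have h1 := norm_exp_I_mul_le ρ (x - s)
    rw [Complex.ofReal_sub] at h1
    have h2 : Real.exp (‖ρ‖ * |x - s|) ≤ Real.exp (‖ρ‖ * x) := by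
      rw [abs_of_nonneg (sub_nonneg.2 hs.2)]
      gcongr
      linarith [hs.1]
    rw [norm_mul, norm_mul]
    calc _ ≤ Real.exp (‖ρ‖ * x) * (‖p s‖ * D) := by
          gcongr
          · exact h1.trans h2
          · exact hD s hs
      _ = _ := by ring
  rw [volterraExp, e1, sliceFourier_volterraFree, hop, ← integral_add]
  · congr 2
    ext s
    rw [volterraExp]
    ring
  · refine hbdd _ (Real.exp (‖ρ‖ * x)) (by fun_prop) fun s hs => ?_
    refine (norm_exp_I_mul_le (-ρ) s).trans ?_
    rw [norm_neg, abs_of_pos hs.1]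
    gcongr
    exact hs.2
  · refine hbdd _ (C * Real.exp (‖ρ‖ * x)) (measurable_sliceFourier hm _) fun s hs => ?_
    refine (hS.norm_sliceFourier_le (hi s) (-ρ)).trans ?_
    rw [norm_neg]
    gcongr
    · exact hC s (Ioc_subset_Icc_self hs)
    · exact hs.2

theorem MemW12.congr {ℓ : ℝ} {u w : ℝ → ℂ} (hℓ : 0 ≤ ℓ) (hu : MemW12 ℓ u)
    (h : EqOn w u (Icc 0 ℓ)) : MemW12 ℓ w :=
  memW12_of_eq_integral hℓ hu.2 fun _ hx => (h hx).trans (hu.eq_integral hℓ hx)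

theorem memW12_volterraExp {ℓ : ℝ} (hℓ : 0 ≤ ℓ) (hpm : Measurable p) (hp1 : Integrable p)
    (hp2 : Integrable fun s => ‖p s‖ ^ 2) (ρ : ℂ) :
    MemW12 ℓ (volterraExp p ρ) ∧ ∀ᵐ x ∂(volume.restrict (Ioo 0 ℓ)),
      deriv (volterraExp p ρ) x = Complex.I * ρ * volterraExp p ρ x + p x * volterraExp p (-ρ) x := by
  obtain ⟨C, hC0, hC⟩ := exists_integral_norm_volterraSol_le hpm hp1 hp2 ℓ
  have hpL : MemLp p 2 (volume.restrict (Ioo 0 ℓ)) :=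
    (memLp_two_iff_integrable_sq_norm hpm.aestronglyMeasurable).2 hp2.integrableOn
  set k : ℝ → ℂ := fun s => Complex.exp (-(Complex.I * ρ * s)) * (p s * volterraExp p (-ρ) s)
    with hk
  have hgm : Measurable (volterraExp p (-ρ)) :=
    (by fun_prop : Measurable fun x : ℝ => Complex.exp (Complex.I * -ρ * x)).add
      (measurable_sliceFourier (measurable_volterraSol hpm hp1 hp2) _)
  have hkL : MemLp k 2 (volume.restrict (Ioo 0 ℓ)) := by
    refine MemLp.of_le_mul (c := Real.exp (‖ρ‖ * ℓ) * (Real.exp (‖ρ‖ * ℓ) +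
      C * Real.exp (‖ρ‖ * ℓ))) hpL ((by fun_prop : Measurable fun s : ℝ =>
        Complex.exp (-(Complex.I * ρ * s))).mul (hpm.mul hgm)).aestronglyMeasurable ?_
    filter_upwards [ae_restrict_mem measurableSet_Ioo] with s hs
    have h1 := norm_exp_I_mul_le (-ρ) s
    rw [norm_neg, abs_of_pos hs.1] at h1
    have h2 : Real.exp (‖ρ‖ * s) ≤ Real.exp (‖ρ‖ * ℓ) := by gcongr; exact hs.2.le
    have h3 : ‖volterraExp p (-ρ) s‖ ≤ Real.exp (‖ρ‖ * ℓ) + C * Real.exp (‖ρ‖ * ℓ) := by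
      refine (norm_add_le _ _).trans (add_le_add (h1.trans h2) ?_)
      refine (supportedInCone_volterraSol.norm_sliceFourier_le
        (integrable_volterraSol hpm hp1 hp2 s) (-ρ)).trans ?_
      rw [norm_neg]
      exact mul_le_mul (hC s (Ioo_subset_Icc_self hs)) h2 (Real.exp_pos _).le hC0
    rw [hk, norm_mul, norm_mul, show -(Complex.I * ρ * s) = Complex.I * -ρ * s by ring]
    calc _ ≤ Real.exp (‖ρ‖ * ℓ) * (‖p s‖ * (Real.exp (‖ρ‖ * ℓ) + C * Real.exp (‖ρ‖ * ℓ))) := by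
          gcongr
          exact h1.trans h2
      _ = _ := by ring
  -- Variation of constants: g(ρ,x) = e^{iρx} u(x), so the product rule gives both membership in
  -- W^{1,2} and the differential equation.
  set u : ℝ → ℂ := fun x => 1 + ∫ s in (0 : ℝ)..x, k s with hu
  have huW : MemW12 ℓ u := memW12_of_eq_integral hℓ hkL (c := 1) fun _ _ => rfl
  have hud := deriv_ae_eq_of_eq_integral (u := u) (c := 1) hℓ
    (intervalIntegrable_of_memLp_two hℓ hkL) fun _ _ => rfl
  have hed : ∀ x : ℝ, HasDerivAt (fun x : ℝ => Complex.exp (Complex.I * ρ * x))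
      (Complex.exp (Complex.I * ρ * x) * (Complex.I * ρ)) x := fun x => by
    have h1 : HasDerivAt (fun t : ℝ => Complex.I * ρ * (t : ℂ)) (Complex.I * ρ) x := by
      simpa using (Complex.ofRealCLM.hasDerivAt (x := x)).const_mul (Complex.I * ρ)
    exact h1.cexp
  have heW : MemW12 ℓ (fun x : ℝ => Complex.exp (Complex.I * ρ * x)) := by
    refine memW12_of_eq_integral (c := 1) hℓ (memLp_of_continuousOn (ℓ := ℓ)
      (u := fun x : ℝ => Complex.exp (Complex.I * ρ * x) * (Complex.I * ρ)) (by fun_prop)) ?_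
    intro x _
    rw [intervalIntegral.integral_eq_sub_of_hasDerivAt (fun t _ => hed t)
      ((by fun_prop : Continuous fun x : ℝ =>
        Complex.exp (Complex.I * ρ * x) * (Complex.I * ρ)).intervalIntegrable _ _)]
    simp
  have heq : EqOn (volterraExp p ρ) (fun x : ℝ => Complex.exp (Complex.I * ρ * x) * u x)
      (Icc 0 ℓ) := by
    intro x hx
    rw [volterraExp_eq hpm hp1 hp2]
    simp only [hu, hk]
    rw [mul_add, mul_one, intervalIntegral.integral_of_le hx.1, ← integral_const_mul]
    congr 2
    ext s
    rw [show Complex.I * ρ * (x - s) = Complex.I * ρ * x + -(Complex.I * ρ * s) by ring,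
      Complex.exp_add]
    ring
  refine ⟨(heW.mul hℓ huW).congr hℓ heq, ?_⟩
  filter_upwards [heW.mul_deriv hℓ huW, hud, ae_restrict_mem measurableSet_Ioo] with x h1 h2 hx
  have h3 : deriv (volterraExp p ρ) x =
      deriv (fun x : ℝ => Complex.exp (Complex.I * ρ * x) * u x) x := by
    refine Filter.EventuallyEq.deriv_eq ?_
    filter_upwards [isOpen_Ioo.mem_nhds hx] with z hz
    exact heq (Ioo_subset_Icc_self hz)
  have h4 : Complex.exp (Complex.I * ρ * x) * Complex.exp (-(Complex.I * ρ * x)) = 1 := by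
    rw [← Complex.exp_add, add_neg_cancel, Complex.exp_zero]
  rw [h3, h1, h2, (hed x).deriv, heq (Ioo_subset_Icc_self hx), hk]
  linear_combination (p x * volterraExp p (-ρ) x) * h4

theorem volterraExp_zero (ρ : ℂ) (hpm : Measurable p) (hp1 : Integrable p)
    (hp2 : Integrable fun s => ‖p s‖ ^ 2) : volterraExp p ρ 0 = 1 := by
  rw [volterraExp_eq hpm hp1 hp2]
  simp

/-! ### Square integrability -/

/-- Each slice has the same squared norm c, so the square is already integrable on the whole strip
[0,ℓ] × ℝ. -/
theorem memLp_triangle_comp {ℓ c : ℝ} (hpm : Measurable p) {φ : ℝ → ℝ → ℝ}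
    (hφ : Measurable (Function.uncurry φ)) (hi : ∀ x, Integrable fun t => ‖p (φ x t)‖ ^ 2)
    (hc : ∀ x, ∫ t, ‖p (φ x t)‖ ^ 2 = c) :
    MemLp (fun q : ℝ × ℝ => p (φ q.1 q.2)) 2 (volume.restrict (triangle ℓ)) := by
  have hm : Measurable fun q : ℝ × ℝ => p (φ q.1 q.2) := hpm.comp hφ
  rw [memLp_two_iff_integrable_sq_norm hm.aestronglyMeasurable]
  have hsub : triangle ℓ ⊆ Icc 0 ℓ ×ˢ univ := fun q hq => ⟨⟨hq.1, hq.2.1⟩, mem_univ _⟩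
  refine IntegrableOn.mono_set ?_ hsub
  rw [IntegrableOn, Measure.volume_eq_prod, ← Measure.prod_restrict, Measure.restrict_univ,
    integrable_prod_iff (hm.norm.pow_const 2).aestronglyMeasurable]
  refine ⟨.of_forall fun x => hi x, ?_⟩
  simp only [norm_pow, norm_norm, hc]
  exact integrable_const c

theorem volume_triangle_lt_top (ℓ : ℝ) : volume (triangle ℓ) < ⊤ := by
  have hsub : triangle ℓ ⊆ Icc 0 ℓ ×ˢ Icc (-ℓ) ℓ := fun q hq =>
    ⟨⟨hq.1, hq.2.1⟩, abs_le.1 (hq.2.2.trans hq.2.1)⟩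
  exact (measure_mono hsub).trans_lt (isCompact_Icc.prod isCompact_Icc).measure_lt_top

theorem measurableSet_triangle (ℓ : ℝ) : MeasurableSet (triangle ℓ) :=
  (measurableSet_le measurable_const measurable_fst).inter
    ((measurableSet_le measurable_fst measurable_const).inter
      (measurableSet_le measurable_snd.abs measurable_fst))

theorem norm_volterraSol_le_add (hpm : Measurable p) (hp1 : Integrable p)
    (hp2 : Integrable fun s => ‖p s‖ ^ 2) {x ℓ : ℝ} (hx : x ≤ ℓ) (t : ℝ) :
    ‖volterraSol p x t‖ ≤ ‖p ((x - t) / 2)‖ +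
      2 * (∫ s, ‖p s‖ ^ 2) * Real.exp (volterraWeight p * ℓ) := by
  have hI : 0 ≤ ∫ s, ‖p s‖ ^ 2 := integral_nonneg fun _ => by positivity
  refine (norm_volterraSol_le hpm hp1 hp2 hx t).trans (add_le_add_right ?_ _)
  exact indicator_le_self' (fun _ _ => by positivity) _

/-- Applied with θ the identity and with θ(t) = -t, for the direct and the reflected terms of the
kernel. -/
theorem memLp_volterraSol_triangle (hpm : Measurable p) (hp1 : Integrable p)
    (hp2 : Integrable fun s => ‖p s‖ ^ 2) (ℓ : ℝ) {θ : ℝ → ℝ} (hθ : Measurable θ)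
    (hi : ∀ g : ℝ → ℝ, Integrable g → Integrable fun t => g (θ t))
    (hθi : ∀ g : ℝ → ℝ, ∫ t, g (θ t) = ∫ t, g t) :
    MemLp (fun q : ℝ × ℝ => volterraSol p q.1 (θ q.2)) 2 (volume.restrict (triangle ℓ)) := by
  have hfin : IsFiniteMeasure (volume.restrict (triangle ℓ)) :=
    ⟨by simpa using volume_triangle_lt_top ℓ⟩
  have h1 := memLp_triangle_comp (ℓ := ℓ) (c := 2 * ∫ s, ‖p s‖ ^ 2) hpm
    (φ := fun x t => (x - θ t) / 2) (by
      have : Measurable fun q : ℝ × ℝ => (q.1 - θ q.2) / 2 := by fun_prop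
      exact this)
    (fun x => hi (fun t => ‖p ((x - t) / 2)‖ ^ 2) (integrable_comp_sub_div_two hp2 x))
    (fun x => by
      rw [hθi (fun t => ‖p ((x - t) / 2)‖ ^ 2), integral_comp_sub_div_two (fun s => ‖p s‖ ^ 2)])
  have h2 := h1.norm.add (memLp_const
    (2 * (∫ s, ‖p s‖ ^ 2) * Real.exp (volterraWeight p * ℓ)))
  refine h2.of_le ((measurable_volterraSol hpm hp1 hp2).comp
    (by fun_prop : Measurable fun q : ℝ × ℝ => (q.1, θ q.2))).aestronglyMeasurable ?_
  filter_upwards [ae_restrict_mem (measurableSet_triangle ℓ)] with q hq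
  exact (norm_volterraSol_le_add hpm hp1 hp2 hq.2.1 (θ q.2)).trans (le_abs_self _)

theorem memLp_volterraSol_slice (hpm : Measurable p) (hp1 : Integrable p)
    (hp2 : Integrable fun s => ‖p s‖ ^ 2) (x : ℝ) {θ : ℝ → ℝ} (hθ : Measurable θ)
    (hi : ∀ g : ℝ → ℝ, Integrable g → Integrable fun t => g (θ t)) :
    MemLp (fun t => volterraSol p x (θ t)) 2 (volume.restrict (Ioo (-x) x)) := by
  have hfin : IsFiniteMeasure (volume.restrict (Ioo (-x) x)) := ⟨by simp [Real.volume_Ioo]⟩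
  have hm : Measurable fun t => p ((x - θ t) / 2) := by fun_prop
  have h1 : MemLp (fun t => p ((x - θ t) / 2)) 2 (volume.restrict (Ioo (-x) x)) :=
    (memLp_two_iff_integrable_sq_norm hm.aestronglyMeasurable).2
      (hi (fun t => ‖p ((x - t) / 2)‖ ^ 2) (integrable_comp_sub_div_two hp2 x)).integrableOn
  have h2 := h1.norm.add (memLp_const
    (2 * (∫ s, ‖p s‖ ^ 2) * Real.exp (volterraWeight p * x)))
  refine h2.of_le ((measurable_volterraSol hpm hp1 hp2).comp
    (by fun_prop : Measurable fun t : ℝ => (x, θ t))).aestronglyMeasurable (.of_forall fun t => ?_)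
  exact (norm_volterraSol_le_add hpm hp1 hp2 le_rfl (θ t)).trans (le_abs_self _)

end

/-! ### Existence of the transmutation kernel -/

/-- Reflection in t is how the functions g(-ρ,·) are written as transforms at ρ. -/
theorem sliceFourier_reflect (F : ℝ → ℝ → ℂ) (ρ : ℂ) (x : ℝ) :
    ∫ t, F x (-t) * Complex.exp (Complex.I * ρ * t) = sliceFourier F (-ρ) x := by
  rw [sliceFourier, ← integral_neg_eq_self]
  congr 1
  ext t
  push_cast
  ring_nf

theorem intervalIntegral_eq_integral_of_cone {g : ℝ → ℂ} {x : ℝ} (hg : ∀ t, x < |t| → g t = 0) :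
    ∫ t in (-x)..x, g t = ∫ t, g t := by
  rcases lt_or_ge x 0 with hx | hx
  · have : g = fun _ => 0 := funext fun t => hg t (hx.trans_le (abs_nonneg t))
    simp [this]
  · rw [intervalIntegral.integral_of_le (by linarith), ← integral_Icc_eq_integral_Ioc]
    refine setIntegral_eq_integral_of_forall_compl_eq_zero fun t ht => hg t ?_
    rw [mem_Icc, ← abs_le, not_le] at ht
    exact ht

/-- The transmutation kernel built from the solutions of the Volterra equations for `±p`. -/
noncomputable def transmutationKernel (p : ℝ → ℂ) (x t : ℝ) : ℂ :=
  1 / 2 * (volterraSol p x t + volterraSol (-p) x t +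
    (volterraSol p x (-t) - volterraSol (-p) x (-t)))

section

variable {ℓ : ℝ} {σ f p : ℝ → ℂ}

theorem exp_add_integral_transmutationKernel (hpm : Measurable p) (hp1 : Integrable p)
    (hp2 : Integrable fun s => ‖p s‖ ^ 2) (ρ : ℂ) (x : ℝ) :
    Complex.exp (Complex.I * ρ * x) +
      ∫ t in (-x)..x, transmutationKernel p x t * Complex.exp (Complex.I * ρ * t) =
    1 / 2 * (1 * volterraExp p ρ x + 1 * volterraExp (-p) ρ x) +
      1 / 2 * (1 * volterraExp p (-ρ) x + (-1) * volterraExp (-p) (-ρ) x) := by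
  have hp2' : Integrable fun s => ‖(-p) s‖ ^ 2 := by simpa using hp2
  have hS : SupportedInCone (volterraSol p) := supportedInCone_volterraSol
  have hS' : SupportedInCone (volterraSol (-p)) := supportedInCone_volterraSol
  have i1 := hS.integrable_mul_exp (integrable_volterraSol hpm hp1 hp2 x) ρ
  have i2 := hS'.integrable_mul_exp (integrable_volterraSol hpm.neg hp1.neg hp2' x) ρ
  have r : ∀ {F : ℝ → ℝ → ℂ}, Integrable (fun t : ℝ => F x t * Complex.exp (Complex.I * -ρ * t)) →
      Integrable fun t : ℝ => F x (-t) * Complex.exp (Complex.I * ρ * t) := fun {F} h => by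
    refine h.comp_neg.congr (.of_forall fun t => ?_)
    push_cast
    ring_nf
  have i3 := r (hS.integrable_mul_exp (integrable_volterraSol hpm hp1 hp2 x) (-ρ))
  have i4 := r (hS'.integrable_mul_exp (integrable_volterraSol hpm.neg hp1.neg hp2' x) (-ρ))
  rw [intervalIntegral_eq_integral_of_cone]
  · have e : ∀ t : ℝ, transmutationKernel p x t * Complex.exp (Complex.I * ρ * t) = 1 / 2 *
        (volterraSol p x t * Complex.exp (Complex.I * ρ * t) +
          volterraSol (-p) x t * Complex.exp (Complex.I * ρ * t) +
          (volterraSol p x (-t) * Complex.exp (Complex.I * ρ * t) -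
            volterraSol (-p) x (-t) * Complex.exp (Complex.I * ρ * t))) := fun t => by
      rw [transmutationKernel]; ring
    simp only [e]
    have i12 : Integrable fun t : ℝ => volterraSol p x t * Complex.exp (Complex.I * ρ * t) +
        volterraSol (-p) x t * Complex.exp (Complex.I * ρ * t) := i1.add i2
    have i34 : Integrable fun t : ℝ => volterraSol p x (-t) * Complex.exp (Complex.I * ρ * t) -
        volterraSol (-p) x (-t) * Complex.exp (Complex.I * ρ * t) := i3.sub i4
    rw [integral_const_mul, integral_add i12 i34, integral_add i1 i2,
      integral_sub i3 i4, sliceFourier_reflect, sliceFourier_reflect]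
    simp only [volterraExp]
    change _ + 1 / 2 * (sliceFourier _ ρ x + sliceFourier _ ρ x + _) = _
    ring
  · intro t ht
    have ht' : x < |-t| := by rwa [abs_neg]
    rw [transmutationKernel, hS x t ht, hS' x t ht, hS x _ ht', hS' x _ ht']
    simp

theorem isTransmutationKernel_transmutationKernel (hℓ : 0 ≤ ℓ)
    (hf : IsNonvanishingSolution ℓ σ f) (hpm : Measurable p) (hp1 : Integrable p)
    (hp2 : Integrable fun s => ‖p s‖ ^ 2)
    (hp : ∀ᵐ x ∂(volume.restrict (Ioo 0 ℓ)), p x = deriv f x / f x) :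
    IsTransmutationKernel ℓ σ f (transmutationKernel p) := by
  have hp2' : Integrable fun s => ‖(-p) s‖ ^ 2 := by simpa using hp2
  have hi : ∀ g : ℝ → ℝ, Integrable g → Integrable fun t => g (-t) := fun g hg => hg.comp_neg
  constructor
  · have m1 := memLp_volterraSol_triangle hpm hp1 hp2 ℓ measurable_id (fun _ h => h) fun _ => rfl
    have m2 := memLp_volterraSol_triangle hpm.neg hp1.neg hp2' ℓ measurable_id (fun _ h => h)
      fun _ => rfl
    have m3 := memLp_volterraSol_triangle hpm hp1 hp2 ℓ measurable_neg hi
      fun g => integral_neg_eq_self g volume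
    have m4 := memLp_volterraSol_triangle hpm.neg hp1.neg hp2' ℓ measurable_neg hi
      fun g => integral_neg_eq_self g volume
    exact ((m1.add m2).add (m3.sub m4)).const_mul (1 / 2)
  · intro x _
    have m1 := memLp_volterraSol_slice hpm hp1 hp2 x measurable_id fun _ h => h
    have m2 := memLp_volterraSol_slice hpm.neg hp1.neg hp2' x measurable_id fun _ h => h
    have m3 := memLp_volterraSol_slice hpm hp1 hp2 x measurable_neg hi
    have m4 := memLp_volterraSol_slice hpm.neg hp1.neg hp2' x measurable_neg hi
    exact ((m1.add m2).add (m3.sub m4)).const_mul (1 / 2)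
  · intro ρ
    simp only [exp_add_integral_transmutationKernel hpm hp1 hp2]
    obtain ⟨w1, d1⟩ := memW12_volterraExp hℓ hpm hp1 hp2 ρ
    obtain ⟨w2, d2⟩ := memW12_volterraExp hℓ hpm.neg hp1.neg hp2' ρ
    obtain ⟨w3, d3⟩ := memW12_volterraExp hℓ hpm hp1 hp2 (-ρ)
    obtain ⟨w4, d4⟩ := memW12_volterraExp hℓ hpm.neg hp1.neg hp2' (-ρ)
    have z1 := volterraExp_zero ρ hpm hp1 hp2
    have z2 := volterraExp_zero ρ hpm.neg hp1.neg hp2'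
    have z3 := volterraExp_zero (-ρ) hpm hp1 hp2
    have z4 := volterraExp_zero (-ρ) hpm.neg hp1.neg hp2'
    set y₁ : ℝ → ℂ := fun x => 1 * volterraExp p ρ x + 1 * volterraExp (-p) ρ x with hy₁
    set y₂ : ℝ → ℂ := fun x => 1 * volterraExp p (-ρ) x + (-1) * volterraExp (-p) (-ρ) x with hy₂
    have W1 : MemW12 ℓ y₁ := w1.linearComb hℓ w2 1 1
    have W2 : MemW12 ℓ y₂ := w3.linearComb hℓ w4 1 (-1)
    have D1 := w1.add_deriv hℓ w2 1 1
    have D2 := w3.add_deriv hℓ w4 1 (-1)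
    -- Here y₁' = iρ y₁ + p y₂ and y₂' = -iρ y₂ + p y₁. Hence y = (y₁ + y₂)/2 and v = iρ(y₁ - y₂)/2
    -- satisfy y' = py + v and v' = -pv - ρ²y.
    refine isCauchySolution_of_system hℓ hf
      (v := fun x => Complex.I * ρ / 2 * y₁ x + -(Complex.I * ρ / 2) * y₂ x)
      (W1.linearComb hℓ W2 (1 / 2) (1 / 2)) (W1.linearComb hℓ W2 _ _) ?_ ?_ ?_ ?_
    · filter_upwards [W1.add_deriv hℓ W2 (1 / 2) (1 / 2), D1, D2, d1, d2, d3, d4, hp] with x e1 e2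
        e3 e4 e5 e6 e7 e8
      rw [darbouxD, e1, e2, e3, e4, e5, e6, e7, ← e8, neg_neg, Pi.neg_apply, hy₁, hy₂]
      ring
    · filter_upwards [W1.add_deriv hℓ W2 (Complex.I * ρ / 2) (-(Complex.I * ρ / 2)), D1, D2, d1, d2,
        d3, d4, hp] with x e1 e2 e3 e4 e5 e6 e7 e8
      rw [e1, e2, e3, e4, e5, e6, e7, ← e8, neg_neg, Pi.neg_apply, hy₁, hy₂]
      linear_combination (ρ ^ 2 / 2 * (volterraExp p ρ x + volterraExp (-p) ρ x +
        volterraExp p (-ρ) x - volterraExp (-p) (-ρ) x)) * Complex.I_sq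
    · simp only [z1, z2, z3, z4]; ring
    · simp only [z1, z2, z3, z4, hy₁, hy₂]; ring

theorem exists_isTransmutationKernel (hℓ : 0 ≤ ℓ) (hf : IsNonvanishingSolution ℓ σ f) :
    ∃ K, IsTransmutationKernel ℓ σ f K := by
  have hfin : IsFiniteMeasure (volume.restrict (Ioo (0 : ℝ) ℓ)) := ⟨by simp [Real.volume_Ioo]⟩
  have hfW := hf.isSolution.1
  have hq := memLp_mul_continuousOn hfW.2 ((hfW.continuousOn hℓ).inv₀ hf.ne_zero)
  -- A Borel representative of f'/f, extended by zero outside (0,ℓ), makes the Volterra theory on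
  -- the whole line applicable.
  set p₀ := hq.1.mk with hp₀
  have hae : (fun x => deriv f x * (f x)⁻¹) =ᵐ[volume.restrict (Ioo 0 ℓ)] p₀ := hq.1.ae_eq_mk
  have hp₀L : MemLp p₀ 2 (volume.restrict (Ioo 0 ℓ)) := hq.ae_eq hae
  have hp₀m : Measurable p₀ := hq.1.stronglyMeasurable_mk.measurable
  have hpm : Measurable ((Ioo 0 ℓ).indicator p₀) := hp₀m.indicator measurableSet_Ioo
  have hpL : MemLp ((Ioo 0 ℓ).indicator p₀) 2 volume :=
    (memLp_indicator_iff_restrict measurableSet_Ioo).2 hp₀L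
  refine ⟨_, isTransmutationKernel_transmutationKernel (p := (Ioo 0 ℓ).indicator p₀) hℓ hf hpm
    ((integrable_indicator_iff measurableSet_Ioo).2 (hp₀L.integrable (by norm_num)))
    ((memLp_two_iff_integrable_sq_norm hpm.aestronglyMeasurable).1 hpL) ?_⟩
  filter_upwards [hae, ae_restrict_mem measurableSet_Ioo] with x h1 h2
  rw [indicator_of_mem h2, ← h1, div_eq_mul_inv]

/-! ### Solutions in terms of the kernel -/

variable {K : ℝ → ℝ → ℂ}

/-- For ρ ≠ 0 this is the odd part (e_f(ρ) - e_f(-ρ))/(2iρ); at ρ = 0 the quotient is meaningless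
and reduction of order replaces it. -/
theorem exists_isCauchySolution_sine (hℓ : 0 ≤ ℓ) (hf : IsNonvanishingSolution ℓ σ f)
    (hK : IsTransmutationKernel ℓ σ f K) (ρ : ℂ) :
    ∃ y, IsCauchySolution ℓ σ f (ρ ^ 2) 0 1 y := by
  rcases eq_or_ne ρ 0 with rfl | hρ
  · simpa using exists_isCauchySolution_zero_one hℓ hf
  · have h2 := hK.represents (-ρ)
    rw [neg_sq] at h2
    have h3 := (hK.represents ρ).linearComb hℓ hf h2 (1 / (2 * Complex.I * ρ))
      (-(1 / (2 * Complex.I * ρ)))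
    have e0 : 1 / (2 * Complex.I * ρ) * 1 + -(1 / (2 * Complex.I * ρ)) * 1 = 0 := by ring
    have e1 : 1 / (2 * Complex.I * ρ) * (Complex.I * ρ) +
        -(1 / (2 * Complex.I * ρ)) * (Complex.I * -ρ) = 1 := by
      have := Complex.I_ne_zero
      field_simp
      ring
    rw [e0, e1] at h3
    exact ⟨_, h3⟩

theorem exists_isCauchySolution_cosine (hℓ : 0 ≤ ℓ) (hf : IsNonvanishingSolution ℓ σ f)
    (hK : IsTransmutationKernel ℓ σ f K) (ρ : ℂ) :
    ∃ y, IsCauchySolution ℓ σ f (ρ ^ 2) 1 0 y := by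
  have h2 := hK.represents (-ρ)
  rw [neg_sq] at h2
  have h3 := (hK.represents ρ).linearComb hℓ hf h2 (1 / 2) (1 / 2)
  have e0 : (1 / 2 : ℂ) * 1 + 1 / 2 * 1 = 1 := by norm_num
  have e1 : 1 / 2 * (Complex.I * ρ) + 1 / 2 * (Complex.I * -ρ) = 0 := by ring
  rw [e0, e1] at h3
  exact ⟨_, h3⟩

theorem IsTransmutationKernel.integrable_mul (hK : IsTransmutationKernel ℓ σ f K) {x : ℝ}
    (hx : x ∈ Ioc 0 ℓ) {h : ℝ → ℂ} (hh : Continuous h) :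
    IntervalIntegrable (fun t => K x t * h t) volume (-x) x := by
  rw [intervalIntegrable_iff_integrableOn_Ioo_of_le (by linarith [hx.1])]
  exact (hK.memLp_slice x hx).integrable_mul (memLp_symm_of_continuous hh x)

/-- `e_f(ρ,x) = C_f(ρ,x) + iρ S_f(ρ,x)`. -/
theorem IsTransmutationKernel.eq_add (hℓ : 0 < ℓ) (hf : IsNonvanishingSolution ℓ σ f)
    (hK : IsTransmutationKernel ℓ σ f K) {ρ : ℂ} {c s : ℝ → ℂ}
    (hc : IsCauchySolution ℓ σ f (ρ ^ 2) 1 0 c) (hs : IsCauchySolution ℓ σ f (ρ ^ 2) 0 1 s)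
    (ε : ℂ) (hε : ε ^ 2 = 1) {x : ℝ} (hx : x ∈ Icc 0 ℓ) :
    Complex.exp (Complex.I * (ε * ρ) * x) +
      ∫ t in (-x)..x, K x t * Complex.exp (Complex.I * (ε * ρ) * t) =
    1 * c x + (Complex.I * (ε * ρ)) * s x := by
  have h1 := hK.represents (ε * ρ)
  rw [mul_pow, hε, one_mul] at h1
  have h2 := hc.linearComb hℓ.le hf hs 1 (Complex.I * (ε * ρ))
  simp only [mul_zero, mul_one, add_zero, zero_add] at h2
  exact h1.unique hℓ hf h2 hx

/-- The even part in ρ of e_f = C_f + iρ S_f; C_f and S_f depend only on ρ². -/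
theorem cosine_eq (hℓ : 0 < ℓ) (hf : IsNonvanishingSolution ℓ σ f)
    (hK : IsTransmutationKernel ℓ σ f K) {ρ : ℂ} {c s : ℝ → ℂ}
    (hc : IsCauchySolution ℓ σ f (ρ ^ 2) 1 0 c) (hs : IsCauchySolution ℓ σ f (ρ ^ 2) 0 1 s)
    {x : ℝ} (hx : x ∈ Ioc 0 ℓ) :
    c x = Complex.cos (ρ * x) + ∫ t in (-x)..x, K x t * Complex.cos (ρ * t) := by
  have h1 := hK.eq_add hℓ hf hc hs 1 (by norm_num) (Ioc_subset_Icc_self hx)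
  have h2 := hK.eq_add hℓ hf hc hs (-1) (by norm_num) (Ioc_subset_Icc_self hx)
  have e : ∀ t : ℝ, K x t * Complex.cos (ρ * t) = 1 / 2 *
      (K x t * Complex.exp (Complex.I * (1 * ρ) * t) +
        K x t * Complex.exp (Complex.I * (-1 * ρ) * t)) := fun t => by
    rw [Complex.cos, show ρ * t * Complex.I = Complex.I * (1 * ρ) * t by ring,
      show -(ρ * t) * Complex.I = Complex.I * (-1 * ρ) * t by ring]
    ring
  simp only [e]
  rw [intervalIntegral.integral_const_mul, intervalIntegral.integral_add
    (hK.integrable_mul hx (by fun_prop)) (hK.integrable_mul hx (by fun_prop)), Complex.cos,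
    show ρ * x * Complex.I = Complex.I * (1 * ρ) * x by ring,
    show -(ρ * x) * Complex.I = Complex.I * (-1 * ρ) * x by ring]
  linear_combination -(1 / 2) * h1 - (1 / 2) * h2

theorem sine_eq (hℓ : 0 < ℓ) (hf : IsNonvanishingSolution ℓ σ f)
    (hK : IsTransmutationKernel ℓ σ f K) {ρ : ℂ} {c s : ℝ → ℂ}
    (hc : IsCauchySolution ℓ σ f (ρ ^ 2) 1 0 c) (hs : IsCauchySolution ℓ σ f (ρ ^ 2) 0 1 s)
    {x : ℝ} (hx : x ∈ Ioc 0 ℓ) :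
    ρ * s x = Complex.sin (ρ * x) + ∫ t in (-x)..x, K x t * Complex.sin (ρ * t) := by
  have h1 := hK.eq_add hℓ hf hc hs 1 (by norm_num) (Ioc_subset_Icc_self hx)
  have h2 := hK.eq_add hℓ hf hc hs (-1) (by norm_num) (Ioc_subset_Icc_self hx)
  have e : ∀ t : ℝ, K x t * Complex.sin (ρ * t) = -(Complex.I / 2) *
      (K x t * Complex.exp (Complex.I * (1 * ρ) * t) -
        K x t * Complex.exp (Complex.I * (-1 * ρ) * t)) := fun t => by
    rw [Complex.sin, show ρ * t * Complex.I = Complex.I * (1 * ρ) * t by ring,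
      show -(ρ * t) * Complex.I = Complex.I * (-1 * ρ) * t by ring]
    ring
  simp only [e]
  rw [intervalIntegral.integral_const_mul, intervalIntegral.integral_sub
    (hK.integrable_mul hx (by fun_prop)) (hK.integrable_mul hx (by fun_prop)), Complex.sin,
    show ρ * x * Complex.I = Complex.I * (1 * ρ) * x by ring,
    show -(ρ * x) * Complex.I = Complex.I * (-1 * ρ) * x by ring]
  linear_combination (Complex.I / 2) * h1 - (Complex.I / 2) * h2 + (ρ * s x) * Complex.I_sq

end

/-! ### Partial sums and error bounds -/

theorem sum_range_even {c : ℕ → ℂ} (hc : ∀ n, c (2 * n + 1) = 0) (N : ℕ) :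
    ∑ m ∈ Finset.range (N + 1), c m = ∑ n ∈ Finset.range (N / 2 + 1), c (2 * n) := by
  induction N with
  | zero => simp
  | succ N ih =>
    rw [Finset.sum_range_succ, ih]
    rcases Nat.even_or_odd' N with ⟨k, rfl | rfl⟩
    · rw [hc, add_zero, show (2 * k + 1) / 2 = k by omega, show 2 * k / 2 = k by omega]
    · rw [show (2 * k + 1) / 2 = k by omega, show (2 * k + 1 + 1) / 2 = k + 1 by omega,
        Finset.sum_range_succ _ (k + 1)]
      rfl

theorem sum_range_odd {c : ℕ → ℂ} (hc : ∀ n, c (2 * n) = 0) {N : ℕ} (hN : 1 ≤ N) :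
    ∑ m ∈ Finset.range (N + 1), c m =
      ∑ n ∈ Finset.range ((N - 1) / 2 + 1), c (2 * n + 1) := by
  have h0 : c 0 = 0 := hc 0
  rw [Finset.sum_range_succ', h0, add_zero, ← Nat.sub_add_cancel hN, Nat.add_sub_cancel]
  exact sum_range_even (c := fun m => c (m + 1)) (fun n => hc (n + 1)) (N - 1)

section

variable {K : ℝ → ℝ → ℂ} {x : ℝ}

theorem integral_kernelPartial_mul (K : ℝ → ℝ → ℂ) (N : ℕ) (x : ℝ) {h : ℝ → ℂ}
    (hh : Continuous h) :
    ∫ t in (-x)..x, kernelPartial K N x t * h t = ∑ m ∈ Finset.range (N + 1),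
      legendreCoeff K m x / x * ∫ t in (-x)..x, (((legendreP m).eval (t / x) : ℝ) : ℂ) * h t := by
  simp only [kernelPartial, Finset.sum_mul, mul_assoc]
  rw [intervalIntegral.integral_finsetSum]
  · simp only [intervalIntegral.integral_const_mul]
  · intro m _
    exact (continuous_const.mul ((continuous_legendreP_scaled m x).mul hh)).intervalIntegrable _ _

theorem legendreCoeff_mul_integral_cos_even (hx : 0 < x) (n : ℕ) (ρ : ℂ) :
    legendreCoeff K (2 * n) x / x *
      ∫ t in (-x)..x, (((legendreP (2 * n)).eval (t / x) : ℝ) : ℂ) * Complex.cos (ρ * t) =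
    (-1) ^ n * alphaCoeff K (2 * n) x * sphericalBesselJ (2 * n) (ρ * x) := by
  have hxc : (x : ℂ) ≠ 0 := by exact_mod_cast hx.ne'
  rw [integral_legendreP_scaled_mul_cos _ hx, alphaCoeff, pow_mul, pow_mul, Complex.I_sq]
  field_simp
  ring

theorem legendreCoeff_mul_integral_cos_odd (hx : 0 < x) (n : ℕ) (ρ : ℂ) :
    legendreCoeff K (2 * n + 1) x / x *
      ∫ t in (-x)..x, (((legendreP (2 * n + 1)).eval (t / x) : ℝ) : ℂ) * Complex.cos (ρ * t) =
    0 := by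
  rw [integral_legendreP_scaled_mul_cos _ hx, pow_succ (-1 : ℂ), pow_mul]
  ring

theorem legendreCoeff_mul_integral_sin_odd (hx : 0 < x) (n : ℕ) (ρ : ℂ) :
    legendreCoeff K (2 * n + 1) x / x *
      ∫ t in (-x)..x, (((legendreP (2 * n + 1)).eval (t / x) : ℝ) : ℂ) * Complex.sin (ρ * t) =
    (-1) ^ n * alphaCoeff K (2 * n + 1) x * sphericalBesselJ (2 * n + 1) (ρ * x) := by
  have hxc : (x : ℂ) ≠ 0 := by exact_mod_cast hx.ne'
  rw [integral_legendreP_scaled_mul_sin _ hx, alphaCoeff, pow_succ, pow_succ, pow_mul, pow_mul,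
    Complex.I_sq]
  have h : -Complex.I * ((-1) ^ n * Complex.I) = (-1) ^ n := by
    linear_combination (-(-1 : ℂ) ^ n) * Complex.I_sq
  rw [h]
  field_simp
  ring

theorem legendreCoeff_mul_integral_sin_even (hx : 0 < x) (n : ℕ) (ρ : ℂ) :
    legendreCoeff K (2 * n) x / x *
      ∫ t in (-x)..x, (((legendreP (2 * n)).eval (t / x) : ℝ) : ℂ) * Complex.sin (ρ * t) =
    0 := by
  rw [integral_legendreP_scaled_mul_sin _ hx, pow_mul (-1 : ℂ)]
  ring

theorem cosPartial_eq (K : ℝ → ℝ → ℂ) (hx : 0 < x) (N : ℕ) (ρ : ℂ) :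
    cosPartial K N ρ x = Complex.cos (ρ * x) +
      ∫ t in (-x)..x, kernelPartial K N x t * Complex.cos (ρ * t) := by
  rw [cosPartial, integral_kernelPartial_mul K N x (by fun_prop), sum_range_even
    (fun n => legendreCoeff_mul_integral_cos_odd hx n ρ) N]
  simp only [legendreCoeff_mul_integral_cos_even hx]

theorem mul_sinPartial_eq (K : ℝ → ℝ → ℂ) (hx : 0 < x) {N : ℕ} (hN : 1 ≤ N) (ρ : ℂ) :
    ρ * sinPartial K N ρ x = Complex.sin (ρ * x) +
      ∫ t in (-x)..x, kernelPartial K N x t * Complex.sin (ρ * t) := by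
  -- At ρ = 0 the left side is 0 through its explicit factor ρ, and every sine on the right
  -- vanishes.
  rcases eq_or_ne ρ 0 with rfl | hρ
  · simp
  rw [sinPartial, integral_kernelPartial_mul K N x (by fun_prop), sum_range_odd
    (fun n => legendreCoeff_mul_integral_sin_even hx n ρ) hN]
  simp only [legendreCoeff_mul_integral_sin_odd hx]
  field_simp

theorem hasSum_cos_series (hx : 0 < x) (hK : MemLp (K x) 2 (volume.restrict (Ioo (-x) x)))
    (ρ : ℂ) : HasSum (fun n : ℕ => (-1) ^ n * alphaCoeff K (2 * n) x *
      sphericalBesselJ (2 * n) (ρ * x)) (∫ t in (-x)..x, K x t * Complex.cos (ρ * t)) := by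
  have h := hasSum_legendreCoeff_mul_integral hx hK (h := fun t : ℝ => Complex.cos (ρ * t))
    (by fun_prop)
  have hinj : Function.Injective fun n : ℕ => 2 * n := mul_right_injective₀ two_ne_zero
  rw [← hinj.hasSum_iff] at h
  · refine (congrArg (fun F => HasSum F _) (funext fun n => ?_)).mp h
    exact legendreCoeff_mul_integral_cos_even hx n ρ
  · intro m hm
    rcases Nat.even_or_odd' m with ⟨k, rfl | rfl⟩
    · exact absurd ⟨k, rfl⟩ hm
    · exact legendreCoeff_mul_integral_cos_odd hx k ρ

theorem hasSum_sin_series (hx : 0 < x) (hK : MemLp (K x) 2 (volume.restrict (Ioo (-x) x)))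
    (ρ : ℂ) : HasSum (fun n : ℕ => (-1) ^ n * alphaCoeff K (2 * n + 1) x *
      sphericalBesselJ (2 * n + 1) (ρ * x)) (∫ t in (-x)..x, K x t * Complex.sin (ρ * t)) := by
  have h := hasSum_legendreCoeff_mul_integral hx hK (h := fun t : ℝ => Complex.sin (ρ * t))
    (by fun_prop)
  have hinj : Function.Injective fun n : ℕ => 2 * n + 1 :=
    (add_left_injective 1).comp (mul_right_injective₀ two_ne_zero)
  rw [← hinj.hasSum_iff] at h
  · refine (congrArg (fun F => HasSum F _) (funext fun n => ?_)).mp h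
    exact legendreCoeff_mul_integral_sin_odd hx n ρ
  · intro m hm
    rcases Nat.even_or_odd' m with ⟨k, rfl | rfl⟩
    · exact legendreCoeff_mul_integral_sin_even hx k ρ
    · exact absurd ⟨k, rfl⟩ hm

/-- Cauchy-Schwarz for (K - K_N)h, where B dominates the squared L² norm of h. -/
theorem norm_integral_kernelError_mul_le (hx : 0 < x)
    (hK : MemLp (K x) 2 (volume.restrict (Ioo (-x) x))) (N : ℕ) {h : ℝ → ℂ} (hh : Continuous h)
    {B : ℝ} (hB : ∫ t in (-x)..x, ‖h t‖ ^ 2 ≤ B) :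
    ‖(∫ t in (-x)..x, K x t * h t) - ∫ t in (-x)..x, kernelPartial K N x t * h t‖ ≤
      kernelError K N x * Real.sqrt B := by
  have hL := memLp_symm_of_continuous (Complex.continuous_conj.comp hh) x
  have hE := memLp_sub_kernelPartial hK N
  have h1 := norm_inner_le_norm (𝕜 := ℂ) hL.toLp hE.toLp
  rw [inner_toLp_toLp, norm_toLp_eq_sqrt, norm_toLp_eq_sqrt] at h1
  simp only [Function.comp_apply, Complex.conj_conj, RCLike.norm_conj] at h1
  have hhL := memLp_symm_of_continuous hh x
  have hpL := memLp_symm_of_continuous (continuous_kernelPartial K N x) x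
  have e : (∫ t in Ioo (-x) x, K x t * h t) - ∫ t in Ioo (-x) x, kernelPartial K N x t * h t =
      ∫ t in Ioo (-x) x, h t * (K x t - kernelPartial K N x t) := by
    have i1 : Integrable (fun t => K x t * h t) (volume.restrict (Ioo (-x) x)) :=
      hK.integrable_mul hhL
    have i2 : Integrable (fun t => kernelPartial K N x t * h t) (volume.restrict (Ioo (-x) x)) :=
      hpL.integrable_mul hhL
    rw [← integral_sub i1 i2]
    congr 1
    ext t
    ring
  rw [integral_symm_eq hx.le, integral_symm_eq hx.le, e, kernelError, integral_symm_eq hx.le,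
    mul_comm]
  rw [integral_symm_eq hx.le] at hB
  exact h1.trans (mul_le_mul_of_nonneg_right (Real.sqrt_le_sqrt hB) (Real.sqrt_nonneg _))

theorem norm_integral_le_of_ae_bound (hx : 0 < x)
    (hK : MemLp (K x) 2 (volume.restrict (Ioo (-x) x))) (N : ℕ) {h : ℝ → ℂ} (hh : Continuous h)
    {M B : ℝ} (hM : ∀ᵐ t ∂(volume.restrict (Ioo (-x) x)), ‖K x t - kernelPartial K N x t‖ ≤ M)
    (hB : ∫ t in (-x)..x, ‖h t‖ ≤ B) :
    ‖(∫ t in (-x)..x, K x t * h t) - ∫ t in (-x)..x, kernelPartial K N x t * h t‖ ≤ M * B := by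
  -- The interval has positive measure, so the almost everywhere bound holds at some point;
  -- nonnegativity is needed to insert the bound B.
  have hM0 : 0 ≤ M := by
    have : (ae (volume.restrict (Ioo (-x) x))).NeBot := by
      rw [ae_neBot, Ne, Measure.restrict_eq_zero, Real.volume_Ioo]
      simpa using hx
    obtain ⟨t, ht⟩ := hM.exists
    exact (norm_nonneg _).trans ht
  have hhL := memLp_symm_of_continuous hh x
  have hpL := memLp_symm_of_continuous (continuous_kernelPartial K N x) x
  have hfin : IsFiniteMeasure (volume.restrict (Ioo (-x) x)) := ⟨by simp [Real.volume_Ioo]⟩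
  have i1 : Integrable (fun t => K x t * h t) (volume.restrict (Ioo (-x) x)) :=
    hK.integrable_mul hhL
  have i2 : Integrable (fun t => kernelPartial K N x t * h t) (volume.restrict (Ioo (-x) x)) :=
    hpL.integrable_mul hhL
  have i3 : Integrable (fun t => M * ‖h t‖) (volume.restrict (Ioo (-x) x)) :=
    (hhL.integrable (by norm_num)).norm.const_mul M
  rw [integral_symm_eq hx.le, integral_symm_eq hx.le, ← integral_sub i1 i2]
  rw [integral_symm_eq hx.le] at hB
  refine (norm_integral_le_of_norm_le i3 ?_).trans ?_
  · filter_upwards [hM] with t ht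
    rw [← sub_mul, norm_mul]
    exact mul_le_mul_of_nonneg_right ht (norm_nonneg _)
  · rw [integral_const_mul]
    exact mul_le_mul_of_nonneg_left hB hM0

/-! ### Sine and cosine in a horizontal strip -/

theorem norm_exp_I_mul_add_le (z : ℂ) :
    ‖Complex.exp (z * Complex.I)‖ + ‖Complex.exp (-z * Complex.I)‖ = 2 * Real.cosh z.im := by
  rw [Complex.norm_exp, Complex.norm_exp, Real.cosh_eq]
  simp
  ring

theorem norm_cos_le_cosh (z : ℂ) : ‖Complex.cos z‖ ≤ Real.cosh z.im := by
  rw [Complex.cos, norm_div]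
  have h1 := norm_add_le (Complex.exp (z * Complex.I)) (Complex.exp (-z * Complex.I))
  rw [norm_exp_I_mul_add_le] at h1
  rw [Complex.norm_ofNat]
  linarith

theorem norm_sin_le_cosh (z : ℂ) : ‖Complex.sin z‖ ≤ Real.cosh z.im := by
  rw [Complex.sin, norm_div, norm_mul, Complex.norm_I, mul_one]
  have h1 := norm_sub_le (Complex.exp (-z * Complex.I)) (Complex.exp (z * Complex.I))
  rw [add_comm, norm_exp_I_mul_add_le] at h1
  rw [Complex.norm_ofNat]
  linarith

theorem cosh_im_mul_le {C : ℝ} {ρ : ℂ} (hρ : |ρ.im| ≤ C) (t : ℝ) :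
    Real.cosh (ρ * t).im ≤ Real.cosh (C * t) := by
  rw [Real.cosh_le_cosh, Complex.im_mul_ofReal, abs_mul, abs_mul]
  exact mul_le_mul_of_nonneg_right (hρ.trans (le_abs_self C)) (abs_nonneg t)

theorem integral_cosh_mul {c : ℝ} (hc : c ≠ 0) (x : ℝ) :
    ∫ t in (-x)..x, Real.cosh (c * t) = 2 * Real.sinh (c * x) / c := by
  rw [intervalIntegral.integral_comp_mul_left (fun t => Real.cosh t) hc,
    intervalIntegral.integral_eq_sub_of_hasDerivAt (fun t _ => Real.hasDerivAt_sinh t)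
      (Real.continuous_cosh.intervalIntegrable _ _), mul_neg, Real.sinh_neg, smul_eq_mul]
  field_simp
  ring

theorem integral_norm_le_of_cosh {C : ℝ} (hC : 0 < C) (hx : 0 ≤ x) {h : ℝ → ℂ}
    (hh : Continuous h) (hb : ∀ t, ‖h t‖ ≤ Real.cosh (C * t)) :
    ∫ t in (-x)..x, ‖h t‖ ≤ 2 * Real.sinh (C * x) / C := by
  rw [← integral_cosh_mul hC.ne']
  exact intervalIntegral.integral_mono (by linarith) (hh.norm.intervalIntegrable _ _)
    ((by fun_prop : Continuous fun t => Real.cosh (C * t)).intervalIntegrable _ _) hb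

/-- Since cosh(2u) = 2cosh²u - 1 and cosh u ≥ 1, one has cosh²u ≤ cosh(2u), whose integral is
explicit. -/
theorem integral_norm_sq_le_of_cosh {C : ℝ} (hC : 0 < C) (hx : 0 ≤ x) {h : ℝ → ℂ}
    (hh : Continuous h) (hb : ∀ t, ‖h t‖ ≤ Real.cosh (C * t)) :
    ∫ t in (-x)..x, ‖h t‖ ^ 2 ≤ Real.sinh (2 * C * x) / C := by
  have e : Real.sinh (2 * C * x) / C = 2 * Real.sinh (2 * C * x) / (2 * C) := by field_simp
  rw [e, ← integral_cosh_mul (by positivity)]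
  refine intervalIntegral.integral_mono (by linarith) ((hh.norm.pow 2).intervalIntegrable _ _)
    ((by fun_prop : Continuous fun t => Real.cosh (2 * C * t)).intervalIntegrable _ _) fun t => ?_
  simp only
  have h1 : Real.cosh (2 * C * t) = 2 * Real.cosh (C * t) ^ 2 - 1 := by
    rw [mul_assoc, Real.cosh_two_mul, Real.sinh_sq]; ring
  have h2 := Real.one_le_cosh (C * t)
  rw [h1]
  nlinarith [hb t, norm_nonneg (h t)]

/-- Mean value inequality for sin between 0 and ρt in the convex strip |Im z| ≤ Cx. The factor |ρ|
it provides keeps sin(ρt)/ρ bounded near ρ = 0. -/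
theorem norm_sin_mul_le {C : ℝ} {ρ : ℂ} (hρ : |ρ.im| ≤ C) {t : ℝ} (ht : |t| ≤ x) :
    ‖Complex.sin (ρ * t)‖ ≤ Real.cosh (C * x) * (‖ρ‖ * x) := by
  have hC : 0 ≤ C := (abs_nonneg _).trans hρ
  have hx : 0 ≤ x := (abs_nonneg _).trans ht
  have hconv : Convex ℝ (Complex.imLm ⁻¹' Icc (-(C * x)) (C * x)) :=
    (convex_Icc _ _).linear_preimage Complex.imLm
  have hmem : ρ * t ∈ Complex.imLm ⁻¹' Icc (-(C * x)) (C * x) := by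
    change (ρ * t).im ∈ Icc _ _
    rw [mem_Icc, ← abs_le, Complex.im_mul_ofReal, abs_mul]
    exact mul_le_mul hρ ht (abs_nonneg _) hC
  have h0 : (0 : ℂ) ∈ Complex.imLm ⁻¹' Icc (-(C * x)) (C * x) := by
    change (0 : ℂ).im ∈ Icc _ _
    rw [Complex.zero_im, mem_Icc]
    constructor <;> nlinarith
  have h1 := hconv.norm_image_sub_le_of_norm_deriv_le (f := Complex.sin) (C := Real.cosh (C * x))
    (fun z _ => Complex.differentiable_sin z) (fun z hz => by
      rw [Complex.deriv_sin]
      refine (norm_cos_le_cosh z).trans (Real.cosh_le_cosh.2 ?_)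
      have hz' : z.im ∈ Icc (-(C * x)) (C * x) := hz
      rw [abs_of_nonneg (by positivity : 0 ≤ C * x)]
      exact abs_le.2 hz') h0 hmem
  rw [Complex.sin_zero, sub_zero, sub_zero, norm_mul, Complex.norm_real, Real.norm_eq_abs] at h1
  refine h1.trans (mul_le_mul_of_nonneg_left ?_ (Real.cosh_pos _).le)
  exact mul_le_mul_of_nonneg_left ht (norm_nonneg _)

/-! ### The limit at zero spectral parameter -/

theorem legendreP_one : legendreP 1 = Polynomial.X := by
  simp only [legendreP, pow_one, Function.iterate_one, Nat.factorial_one, Nat.cast_one, mul_one,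
    Polynomial.derivative_sub, Polynomial.derivative_X_pow, Polynomial.derivative_one, sub_zero]
  rw [← mul_assoc, ← Polynomial.C_mul]
  norm_num

theorem alphaCoeff_one_mul (hx : 0 < x) (K : ℝ → ℝ → ℂ) :
    alphaCoeff K 1 x * (x / 3) = ∫ t in (-x)..x, K x t * t := by
  have hxc : (x : ℂ) ≠ 0 := by exact_mod_cast hx.ne'
  have e : ∀ t : ℝ, K x t * (((legendreP 1).eval (t / x) : ℝ) : ℂ) = (x : ℂ)⁻¹ * (K x t * t) :=
    fun t => by rw [legendreP_one, Polynomial.eval_X]; push_cast; ring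
  rw [alphaCoeff, legendreCoeff]
  simp only [e]
  rw [intervalIntegral.integral_const_mul]
  push_cast
  field_simp
  ring

theorem tendsto_sin_mul_div (t : ℂ) :
    Tendsto (fun ρ : ℂ => Complex.sin (ρ * t) / ρ) (𝓝[≠] 0) (𝓝 t) := by
  have h1 : HasDerivAt (fun ρ : ℂ => Complex.sin (ρ * t)) t 0 := by
    have := ((hasDerivAt_id (0 : ℂ)).mul_const t).csin
    simpa using this
  have h2 := hasDerivAt_iff_tendsto_slope_zero.1 h1
  simpa [div_eq_inv_mul] using h2

/-- Dominated convergence: for |ρ| < 1 the quotient sin(ρt)/ρ is bounded by x cosh x on (-x,x) and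
tends to t. -/
theorem tendsto_integral_sin_div (hx : 0 < x)
    (hK : MemLp (K x) 2 (volume.restrict (Ioo (-x) x))) :
    Tendsto (fun ρ : ℂ => (Complex.sin (ρ * x) + ∫ t in (-x)..x, K x t * Complex.sin (ρ * t)) / ρ)
      (𝓝[≠] 0) (𝓝 (x + ∫ t in (-x)..x, K x t * t)) := by
  have hfin : IsFiniteMeasure (volume.restrict (Ioo (-x) x)) := ⟨by simp [Real.volume_Ioo]⟩
  simp only [add_div]
  refine (tendsto_sin_mul_div x).add ?_
  have e : (fun ρ : ℂ => (∫ t in (-x)..x, K x t * Complex.sin (ρ * t)) / ρ) =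
      fun ρ : ℂ => ∫ t in Ioo (-x) x, K x t * Complex.sin (ρ * t) / ρ := by
    ext ρ
    rw [integral_symm_eq hx.le, integral_div]
  rw [e, integral_symm_eq hx.le]
  refine tendsto_integral_filter_of_dominated_convergence
    (fun t => ‖K x t‖ * (Real.cosh (1 * x) * x)) (.of_forall fun ρ => ?_) ?_
    ((hK.integrable (by norm_num)).norm.mul_const _) (.of_forall fun t => ?_)
  · simp only [mul_div_assoc]
    exact hK.1.mul (by fun_prop : Continuous fun t : ℝ =>
      Complex.sin (ρ * t) / ρ).aestronglyMeasurable
  · have h1 : ∀ᶠ ρ : ℂ in 𝓝[≠] 0, ‖ρ‖ < 1 :=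
      nhdsWithin_le_nhds ((continuous_norm.tendsto' (0 : ℂ) 0 norm_zero).eventually
        (gt_mem_nhds one_pos))
    filter_upwards [h1, self_mem_nhdsWithin] with ρ hρ hρ0
    filter_upwards [ae_restrict_mem measurableSet_Ioo] with t ht
    have h2 := norm_sin_mul_le ((Complex.abs_im_le_norm ρ).trans hρ.le)
      (abs_le.2 ⟨ht.1.le, ht.2.le⟩)
    have h3 : 0 < ‖ρ‖ := norm_pos_iff.2 hρ0
    rw [norm_div, norm_mul, mul_div_assoc]
    refine mul_le_mul_of_nonneg_left ?_ (norm_nonneg _)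
    rw [div_le_iff₀ h3]
    linarith
  · simp only [mul_div_assoc]
    exact (tendsto_sin_mul_div t).const_mul _

end

theorem tendstoUniformlyOn_of_norm_sub_le {F : ℕ → ℂ → ℂ} {G : ℂ → ℂ} {s : Set ℂ} {e : ℕ → ℝ}
    (he : Tendsto e atTop (𝓝 0)) (D : ℝ)
    (h : ∀ N, 1 ≤ N → ∀ ρ ∈ s, ‖G ρ - F N ρ‖ ≤ e N * D) : TendstoUniformlyOn F G atTop s := by
  rw [Metric.tendstoUniformlyOn_iff]
  intro δ hδ
  have h1 := he.mul_const D
  rw [zero_mul] at h1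
  filter_upwards [h1.eventually (gt_mem_nhds hδ), eventually_ge_atTop 1] with N h2 h3 ρ hρ
  rw [dist_eq_norm]
  exact (h N h3 ρ hρ).trans_lt h2

/-! ### Error estimates for the two solutions -/

section

variable {ℓ : ℝ} {σ f : ℝ → ℂ} {K : ℝ → ℝ → ℂ} {c s : ℝ → ℂ} {ρ : ℂ} {x C : ℝ}

theorem norm_cosine_sub_le (hℓ : 0 < ℓ) (hf : IsNonvanishingSolution ℓ σ f)
    (hK : IsTransmutationKernel ℓ σ f K) (hc : IsCauchySolution ℓ σ f (ρ ^ 2) 1 0 c)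
    (hs : IsCauchySolution ℓ σ f (ρ ^ 2) 0 1 s) (hx : x ∈ Ioc 0 ℓ) (hC : 0 < C)
    (hρ : |ρ.im| ≤ C) (N : ℕ) :
    ‖c x - cosPartial K N ρ x‖ ≤ kernelError K N x * Real.sqrt (Real.sinh (2 * C * x) / C) ∧
    ∀ M : ℝ, (∀ᵐ t ∂(volume.restrict (Ioo (-x) x)), ‖K x t - kernelPartial K N x t‖ ≤ M) →
      ‖c x - cosPartial K N ρ x‖ ≤ M * (2 * Real.sinh (C * x) / C) := by
  have hh : Continuous fun t : ℝ => Complex.cos (ρ * t) := by fun_prop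
  have hb : ∀ t : ℝ, ‖Complex.cos (ρ * t)‖ ≤ Real.cosh (C * t) := fun t =>
    (norm_cos_le_cosh _).trans (cosh_im_mul_le hρ t)
  rw [cosine_eq hℓ hf hK hc hs hx, cosPartial_eq K hx.1, add_sub_add_left_eq_sub]
  have hL := hK.memLp_slice x hx
  exact ⟨norm_integral_kernelError_mul_le hx.1 hL N hh
    (integral_norm_sq_le_of_cosh hC hx.1.le hh hb), fun M hM =>
    norm_integral_le_of_ae_bound hx.1 hL N hh hM (integral_norm_le_of_cosh hC hx.1.le hh hb)⟩

theorem norm_mul_sine_sub_le (hℓ : 0 < ℓ) (hf : IsNonvanishingSolution ℓ σ f)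
    (hK : IsTransmutationKernel ℓ σ f K) (hc : IsCauchySolution ℓ σ f (ρ ^ 2) 1 0 c)
    (hs : IsCauchySolution ℓ σ f (ρ ^ 2) 0 1 s) (hx : x ∈ Ioc 0 ℓ) (hC : 0 < C)
    (hρ : |ρ.im| ≤ C) {N : ℕ} (hN : 1 ≤ N) :
    ‖ρ * s x - ρ * sinPartial K N ρ x‖ ≤
      kernelError K N x * Real.sqrt (Real.sinh (2 * C * x) / C) ∧
    ∀ M : ℝ, (∀ᵐ t ∂(volume.restrict (Ioo (-x) x)), ‖K x t - kernelPartial K N x t‖ ≤ M) →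
      ‖ρ * s x - ρ * sinPartial K N ρ x‖ ≤ M * (2 * Real.sinh (C * x) / C) := by
  have hh : Continuous fun t : ℝ => Complex.sin (ρ * t) := by fun_prop
  have hb : ∀ t : ℝ, ‖Complex.sin (ρ * t)‖ ≤ Real.cosh (C * t) := fun t =>
    (norm_sin_le_cosh _).trans (cosh_im_mul_le hρ t)
  rw [sine_eq hℓ hf hK hc hs hx, mul_sinPartial_eq K hx.1 hN, add_sub_add_left_eq_sub]
  have hL := hK.memLp_slice x hx
  exact ⟨norm_integral_kernelError_mul_le hx.1 hL N hh
    (integral_norm_sq_le_of_cosh hC hx.1.le hh hb), fun M hM =>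
    norm_integral_le_of_ae_bound hx.1 hL N hh hM (integral_norm_le_of_cosh hC hx.1.le hh hb)⟩

/-- Dividing the bound for ρ S_f by ρ would not be uniform near 0. Instead sin(ρt)/ρ itself is the
function paired with K - K_N, with its ρ-independent bound x cosh(Cx). -/
theorem norm_sine_sub_le (hℓ : 0 < ℓ) (hf : IsNonvanishingSolution ℓ σ f)
    (hK : IsTransmutationKernel ℓ σ f K) (hc : IsCauchySolution ℓ σ f (ρ ^ 2) 1 0 c)
    (hs : IsCauchySolution ℓ σ f (ρ ^ 2) 0 1 s) (hx : x ∈ Ioc 0 ℓ) (hρ : |ρ.im| ≤ C)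
    (hρ0 : ρ ≠ 0) {N : ℕ} (hN : 1 ≤ N) :
    ‖s x - sinPartial K N ρ x‖ ≤
      kernelError K N x * Real.sqrt (2 * x * (Real.cosh (C * x) * x) ^ 2) := by
  have hh : Continuous fun t : ℝ => Complex.sin (ρ * t) / ρ := by fun_prop
  have e : s x - sinPartial K N ρ x =
      (∫ t in (-x)..x, K x t * (Complex.sin (ρ * t) / ρ)) -
        ∫ t in (-x)..x, kernelPartial K N x t * (Complex.sin (ρ * t) / ρ) := by
    refine mul_left_cancel₀ hρ0 ?_
    rw [mul_sub, sine_eq hℓ hf hK hc hs hx, mul_sinPartial_eq K hx.1 hN, add_sub_add_left_eq_sub,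
      mul_sub, ← intervalIntegral.integral_const_mul, ← intervalIntegral.integral_const_mul]
    congr 3 <;>
    · ext t
      field_simp
  rw [e]
  refine norm_integral_kernelError_mul_le hx.1 (hK.memLp_slice x hx) N hh ?_
  have hx0 := hx.1
  have h1 := intervalIntegral.integral_mono_on (a := -x) (b := x) (μ := volume) (by linarith)
    ((hh.norm.pow 2).intervalIntegrable _ _)
    (intervalIntegrable_const (c := (Real.cosh (C * x) * x) ^ 2)) (fun t ht => by
      have h2 := norm_sin_mul_le hρ (abs_le.2 ht)
      have h3 : 0 < ‖ρ‖ := norm_pos_iff.2 hρ0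
      refine pow_le_pow_left₀ (norm_nonneg _) ?_ 2
      rw [norm_div, div_le_iff₀ h3]
      linarith)
  rw [intervalIntegral.integral_const, smul_eq_mul] at h1
  refine h1.trans (le_of_eq ?_)
  ring

/-- The identity for ρ S_f carries no information at ρ = 0, so it is divided by ρ and passed to the
limit, using continuity of S_f in ρ on the left. -/
theorem sine_zero_eq (hℓ : 0 < ℓ) (hf : IsNonvanishingSolution ℓ σ f)
    (hK : IsTransmutationKernel ℓ σ f K) {Cf Sf : ℂ → ℝ → ℂ}
    (hc : ∀ ρ : ℂ, IsCauchySolution ℓ σ f (ρ ^ 2) 1 0 (Cf ρ))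
    (hs : ∀ ρ : ℂ, IsCauchySolution ℓ σ f (ρ ^ 2) 0 1 (Sf ρ)) (hx : x ∈ Ioc 0 ℓ) :
    Sf 0 x = x + alphaCoeff K 1 x * (x / 3) := by
  rw [alphaCoeff_one_mul hx.1]
  refine tendsto_nhds_unique ((tendsto_sineSolution_zero hℓ hf hs
    (Ioc_subset_Icc_self hx)).mono_left nhdsWithin_le_nhds)
    ((tendsto_integral_sin_div hx.1 (hK.memLp_slice x hx)).congr' ?_)
  filter_upwards [self_mem_nhdsWithin] with ρ hρ
  rw [← sine_eq hℓ hf hK (hc ρ) (hs ρ) hx, mul_div_cancel_left₀ _ hρ]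

end

end NSBF

/-! ### The main theorem -/

theorem mainTheorem8 (ℓ : ℝ) (hℓ : 0 < ℓ) (σ f : ℝ → ℂ)
    (hσ : MeasureTheory.MemLp σ 2 (MeasureTheory.volume.restrict (Set.Ioo 0 ℓ)))
    (hf : NSBF.IsNonvanishingSolution ℓ σ f) :
    -- the solutions `C_f`, `S_f` and the kernel `K_f` exist
    (∀ ρ : ℂ, (∃ y, NSBF.IsCauchySolution ℓ σ f (ρ ^ 2) 1 0 y) ∧
      (∃ y, NSBF.IsCauchySolution ℓ σ f (ρ ^ 2) 0 1 y)) ∧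
    (∃ K, NSBF.IsTransmutationKernel ℓ σ f K) ∧
    ∀ (Cf Sf : ℂ → ℝ → ℂ) (K : ℝ → ℝ → ℂ),
      (∀ ρ : ℂ, NSBF.IsCauchySolution ℓ σ f (ρ ^ 2) 1 0 (Cf ρ)) →
      (∀ ρ : ℂ, NSBF.IsCauchySolution ℓ σ f (ρ ^ 2) 0 1 (Sf ρ)) →
      NSBF.IsTransmutationKernel ℓ σ f K →
      ∀ x ∈ Set.Ioc 0 ℓ,
        -- the Fourier-Legendre series of `K_f(x,·)` converges in `L²(-x,x)`
        Filter.Tendsto (fun N => NSBF.kernelError K N x) Filter.atTop (nhds 0) ∧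
        -- series representation of `C_f`
        (∀ ρ : ℂ,
          Summable (fun m : ℕ => (-1) ^ m * NSBF.alphaCoeff K (2 * m) x *
            NSBF.sphericalBesselJ (2 * m) (ρ * x)) ∧
          Cf ρ x = Complex.cos (ρ * x) + ∑' m : ℕ, (-1) ^ m * NSBF.alphaCoeff K (2 * m) x *
            NSBF.sphericalBesselJ (2 * m) (ρ * x)) ∧
        -- series representation of `S_f`, and its limiting form at `ρ = 0`
        (∀ ρ : ℂ, ρ ≠ 0 →
          Summable (fun m : ℕ => (-1) ^ m * NSBF.alphaCoeff K (2 * m + 1) x *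
            NSBF.sphericalBesselJ (2 * m + 1) (ρ * x)) ∧
          Sf ρ x = Complex.sin (ρ * x) / ρ +
            1 / ρ * ∑' m : ℕ, (-1) ^ m * NSBF.alphaCoeff K (2 * m + 1) x *
              NSBF.sphericalBesselJ (2 * m + 1) (ρ * x)) ∧
        Sf 0 x = x + NSBF.alphaCoeff K 1 x * (x / 3) ∧
        ∀ C : ℝ, 0 < C →
          -- error bounds for the partial sums in the strip `|Im ρ| ≤ C`
          (∀ N : ℕ, 1 ≤ N → ∀ ρ : ℂ, |ρ.im| ≤ C →
            ‖Cf ρ x - NSBF.cosPartial K N ρ x‖ ≤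
              NSBF.kernelError K N x * Real.sqrt (Real.sinh (2 * C * x) / C) ∧
            ‖ρ * Sf ρ x - ρ * NSBF.sinPartial K N ρ x‖ ≤
              NSBF.kernelError K N x * Real.sqrt (Real.sinh (2 * C * x) / C) ∧
            ∀ M : ℝ, (∀ᵐ t ∂(MeasureTheory.volume.restrict (Set.Ioo (-x) x)),
                ‖K x t - NSBF.kernelPartial K N x t‖ ≤ M) →
              ‖Cf ρ x - NSBF.cosPartial K N ρ x‖ ≤ M * (2 * Real.sinh (C * x) / C) ∧
              ‖ρ * Sf ρ x - ρ * NSBF.sinPartial K N ρ x‖ ≤ M * (2 * Real.sinh (C * x) / C)) ∧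
          -- uniform convergence in the strip `|Im ρ| ≤ C`
          TendstoUniformlyOn (fun (N : ℕ) (ρ : ℂ) => NSBF.cosPartial K N ρ x)
            (fun ρ => Cf ρ x) Filter.atTop {ρ : ℂ | |ρ.im| ≤ C} ∧
          TendstoUniformlyOn (fun (N : ℕ) (ρ : ℂ) => NSBF.sinPartial K N ρ x)
            (fun ρ => Sf ρ x) Filter.atTop {ρ : ℂ | |ρ.im| ≤ C ∧ ρ ≠ 0} := by
  obtain ⟨K₀, hK₀⟩ := NSBF.exists_isTransmutationKernel hℓ.le hf
  refine ⟨fun ρ => ⟨NSBF.exists_isCauchySolution_cosine hℓ.le hf hK₀ ρ,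
    NSBF.exists_isCauchySolution_sine hℓ.le hf hK₀ ρ⟩, ⟨K₀, hK₀⟩, ?_⟩
  intro Cf Sf K hc hs hK x hx
  have hL := hK.memLp_slice x hx
  have hE := NSBF.tendsto_kernelError hx.1 hL
  refine ⟨hE, fun ρ => ?_, fun ρ hρ => ?_, NSBF.sine_zero_eq hℓ hf hK hc hs hx, fun C hC =>
    ⟨fun N hN ρ hρ => ?_, ?_, ?_⟩⟩
  · have h := NSBF.hasSum_cos_series hx.1 hL ρ
    exact ⟨h.summable, by rw [h.tsum_eq, NSBF.cosine_eq hℓ hf hK (hc ρ) (hs ρ) hx]⟩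
  · have h := NSBF.hasSum_sin_series hx.1 hL ρ
    refine ⟨h.summable, mul_left_cancel₀ hρ ?_⟩
    rw [h.tsum_eq, NSBF.sine_eq hℓ hf hK (hc ρ) (hs ρ) hx]
    field_simp
  · have h1 := NSBF.norm_cosine_sub_le hℓ hf hK (hc ρ) (hs ρ) hx hC hρ N
    have h2 := NSBF.norm_mul_sine_sub_le hℓ hf hK (hc ρ) (hs ρ) hx hC hρ hN
    exact ⟨h1.1, h2.1, fun M hM => ⟨h1.2 M hM, h2.2 M hM⟩⟩
  · exact NSBF.tendstoUniformlyOn_of_norm_sub_le hE _ fun N _ ρ hρ =>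
      (NSBF.norm_cosine_sub_le hℓ hf hK (hc ρ) (hs ρ) hx hC hρ N).1
  · exact NSBF.tendstoUniformlyOn_of_norm_sub_le hE _ fun N hN ρ hρ =>
      NSBF.norm_sine_sub_le hℓ hf hK (hc ρ) (hs ρ) hx hρ.1 hρ.2 hN
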